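/- All categories are $\mathbb{C}$-linear. Let $G=\mathbb{Z}/3\times S_3$, let $\mathrm{Vec}(G)$ be the fusion category of finite-dimensional $G$-graded vector spaces with $(V\otimes W)_k=\bigoplus_{gh=k}V_g\otimes W_h$ and trivial associator, let $r\in S_3$ be a $3$-cycle, and let $Q_8$ be the left $\mathrm{Vec}(G)$-module category attached to the subgroup $H=\langle(1,r)\rangle\cong\mathbb{Z}/3$ with trivial cocycle: its objects are the finite-dimensional $(G/H)$-graded vector spaces, with action $(V\odot M)_x=\bigoplus_{g\cdot y=x}V_g\otimes M_y$. For a finite abelian group $A$, a nondegenerate symmetric bicharacter $\chi:A\times A\to\mathbb{C}^\times$ and a sign $\nu\in\{1,-1\}$, the Tambara–Yamagami category $\mathcal{TY}(A,\chi,\nu)$ is the semisimple monoidal category with simple objects $A\sqcup\{\sigma\}$, unit object $0\in A$ and fusion rules $$a\otimes b=a+b,\qquad a\otimes\sigma=\sigma=\sigma\otimes a,\qquad \sigma\otimes\sigma=\bigoplus_{a\in A}a ,$$ whose associator $(x\otimes y)\otimes z\to x\otimes(y\otimes z)$ is given by $$[F_{a,\sigma,b}^{\sigma}]_{\sigma,\sigma}=\chi(a,b),\qquad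 [F_{\sigma,a,\sigma}^{b}]_{\sigma,\sigma}=\chi(a,b),\qquad [F_{\sigma,\sigma,\sigma}^{\sigma}]_{a,b}=\frac{\nu}{\sqrt{|A|}\,\chi(a,b)},$$ all other admissible $F$-symbols being $1$. Let $\omega=e^{2\pi i/3}$ and let $\chi$ be the symmetric bicharacter $\chi((g_0,h_0),(g_1,h_1))=\omega^{g_0h_1+h_0g_1}$ on $\mathbb{Z}/3\times\mathbb{Z}/3$. **Proposition.** The categories $\mathrm{Vec}(G)$ and $\mathcal{TY}(\mathbb{Z}/3\times\mathbb{Z}/3,\chi,1)$ are fusion categories (finite semisimple rigid monoidal categories with bilinear tensor product and simple unit), and they are Morita equivalent: there is an indecomposable finite semisimple $\mathrm{Vec}(G)$-module category $\mathcal{M}$ such that $\mathcal{TY}(\mathbb{Z}/3\times\mathbb{Z}/3,\chi,1)$ is equivalent, as a $\mathbb{C}$-linear monoidal category, to the category $\mathrm{End}(\mathcal{M})$ of $\mathrm{Vec}(G)$-module endofunctors of $\mathcal{M}$, whose tensor product $F\otimes F'$ is the composite "$F$ followed by $F'$". More precisely, one can take $\mathcal{M}=Q_8$: the category $Q_8$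 is finite semisimple and indecomposable as a $\mathrm{Vec}(G)$-module category, and $\mathrm{End}(Q_8)$ is equivalent, as a $\mathbb{C}$-linear monoidal category, to $\mathcal{TY}(\mathbb{Z}/3\times\mathbb{Z}/3,\chi,1)$. In particular, $\mathrm{End}(Q_8)$ has $9$ invertible simple objects and one further simple object $\sigma$, and its associator is given, up to gauge, by the above $F$-symbols with $\nu=1$. -/

import Mathlib

open CategoryTheory MonoidalCategory
open scoped TensorProduct MonoidalCategory.MonoidalLeftAction

/-! ### Finite-dimensional graded vector spaces -/

/-- A finite-dimensional complex vector space `V` with an `X`-grading, that is,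
a direct sum decomposition `V = ⨁ x, V_x` into subspaces `gr x = V_x`. -/
structure GrVect (X : Type) : Type 1 where
  carrier : Type
  [addCommGroup : AddCommGroup carrier]
  [module : Module ℂ carrier]
  [finite : FiniteDimensional ℂ carrier]
  gr : X → Submodule ℂ carrier
  indep : iSupIndep gr
  iSup_eq : iSup gr = ⊤

namespace GrVect

attribute [instance] GrVect.addCommGroup GrVect.module GrVect.finite

instance (X : Type) : CoeSort (GrVect X) Type := ⟨GrVect.carrier⟩

variable {X Y Z : Type}

/-- Morphisms of graded vector spaces: linear maps which preserve the grading. -/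
@[ext]
structure Hom (V W : GrVect X) where
  lin : V →ₗ[ℂ] W
  map_gr : ∀ (x : X) (v : V), v ∈ V.gr x → lin v ∈ W.gr x

instance : Category (GrVect X) where
  Hom := Hom
  id V := ⟨LinearMap.id, fun _ _ h => h⟩
  comp f g := ⟨g.lin ∘ₗ f.lin, fun x v h => g.map_gr x _ (f.map_gr x v h)⟩

@[ext]
theorem hom_ext {V W : GrVect X} {f g : V ⟶ W} (h : f.lin = g.lin) : f = g := Hom.ext h

@[simp] theorem id_lin (V : GrVect X) : Hom.lin (𝟙 V) = LinearMap.id := rfl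

@[simp] theorem comp_lin {U V W : GrVect X} (f : U ⟶ V) (g : V ⟶ W) :
    Hom.lin (f ≫ g) = g.lin ∘ₗ f.lin := rfl

section Linear

variable (V W : GrVect X)

/-- The graded maps form a subspace of all linear maps. -/
def homSubmodule : Submodule ℂ (V →ₗ[ℂ] W) where
  carrier := {f | ∀ (x : X) (v : V), v ∈ V.gr x → f v ∈ W.gr x}
  add_mem' hf hg x v h := (W.gr x).add_mem (hf x v h) (hg x v h)
  zero_mem' x _ _ := (W.gr x).zero_mem
  smul_mem' c _ hf x v h := (W.gr x).smul_mem c (hf x v h)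

/-- Graded maps as elements of the subspace of graded maps. -/
def homEquiv : (V ⟶ W) ≃ homSubmodule V W where
  toFun f := ⟨f.lin, f.map_gr⟩
  invFun f := ⟨f.1, f.2⟩

instance : AddCommGroup (V ⟶ W) := (homEquiv V W).addCommGroup

instance : Module ℂ (V ⟶ W) := (homEquiv V W).module ℂ

@[simp] theorem add_lin {V W : GrVect X} (f g : V ⟶ W) : Hom.lin (f + g) = f.lin + g.lin := rfl

@[simp] theorem smul_lin {V W : GrVect X} (c : ℂ) (f : V ⟶ W) : Hom.lin (c • f) = c • f.lin := rfl

end Linear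

instance : Preadditive (GrVect X) where
  add_comp _ _ _ f f' g := by ext v; simp
  comp_add _ _ _ f g g' := by ext v; simp

instance : Linear ℂ (GrVect X) where
  smul_comp _ _ _ r f g := by ext v; simp
  comp_smul _ _ _ f r g := by ext v; simp

/-- The projections onto the homogeneous components of a graded vector space. -/
theorem exists_proj (V : GrVect X) : ∃ P : X → V →ₗ[ℂ] V,
    (∀ x, ∀ v ∈ V.gr x, P x v = v) ∧ ∀ x y, x ≠ y → ∀ v ∈ V.gr y, P x v = 0 := by
  classical
  have h := (DirectSum.isInternal_submodule_iff_iSupIndep_and_iSup_eq_top V.gr).2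
    ⟨V.indep, V.iSup_eq⟩
  refine ⟨fun x => (V.gr x).subtype ∘ₗ (DirectSum.component ℂ X (fun i => V.gr i) x) ∘ₗ
    (LinearEquiv.ofBijective (DirectSum.coeLinearMap V.gr) h).symm.toLinearMap, ?_, ?_⟩
  · intro x v hv
    have := h.ofBijective_coeLinearMap_of_mem hv
    exact congrArg Subtype.val this
  · intro x y hxy v hv
    have := h.ofBijective_coeLinearMap_of_mem_ne hxy.symm hv
    exact congrArg Subtype.val this

/-- A spanning family of subspaces with a compatible family of projections is independent. -/
theorem indep_of_proj {E : Type} [AddCommGroup E] [Module ℂ E] (g : Z → Submodule ℂ E)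
    (P : Z → E →ₗ[ℂ] E) (h1 : ∀ z, ∀ v ∈ g z, P z v = v)
    (h2 : ∀ z y, z ≠ y → ∀ v ∈ g y, P z v = 0) : iSupIndep g := by
  intro z
  rw [Submodule.disjoint_def]
  intro v hv hv'
  have : (⨆ j, ⨆ (_ : j ≠ z), g j) ≤ LinearMap.ker (P z) :=
    iSup₂_le fun j hj w hw => h2 z j hj.symm w hw
  rw [← h1 z v hv]
  exact this hv'

section Tensor

variable [Finite X] [Finite Y]

/-- The tensor product of an `X`-graded space `V` and a `Y`-graded space `W`, made into a
`Z`-graded space along a map `m : X → Y → Z`: `(V ⊗ W)_z = ⨁_{m x y = z} V_x ⊗ W_y`. -/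
noncomputable def tensor (m : X → Y → Z) (V : GrVect X) (W : GrVect Y) : GrVect Z where
  carrier := V ⊗[ℂ] W
  gr z := Submodule.span ℂ
    {t | ∃ x y, m x y = z ∧ ∃ v ∈ V.gr x, ∃ w ∈ W.gr y, t = v ⊗ₜ[ℂ] w}
  indep := by
    classical
    have := Fintype.ofFinite X
    have := Fintype.ofFinite Y
    obtain ⟨P, hP1, hP2⟩ := exists_proj V
    obtain ⟨Q, hQ1, hQ2⟩ := exists_proj W
    refine indep_of_proj _ (fun z => ∑ x, ∑ y,
      if m x y = z then TensorProduct.map (P x) (Q y) else 0) ?_ ?_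
    · intro z t ht
      induction ht using Submodule.span_induction with
      | mem t ht =>
        obtain ⟨x, y, h, v, hv, w, hw, rfl⟩ := ht
        rw [LinearMap.sum_apply, Finset.sum_eq_single x, LinearMap.sum_apply,
          Finset.sum_eq_single y]
        · simp [h, hP1 x v hv, hQ1 y w hw]
        · intro y' _ hy
          split_ifs <;> simp [hQ2 y' y hy w hw]
        · simp
        · intro x' _ hx
          rw [LinearMap.sum_apply]
          refine Finset.sum_eq_zero fun y' _ => ?_
          split_ifs <;> simp [hP2 x' x hx v hv]
        · simp
      | zero => simp
      | add a b _ _ ha hb => rw [map_add, ha, hb]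
      | smul c a _ ha => rw [map_smul, ha]
    · intro z z' hz t ht
      induction ht using Submodule.span_induction with
      | mem t ht =>
        obtain ⟨x, y, h, v, hv, w, hw, rfl⟩ := ht
        simp only [LinearMap.sum_apply]
        refine Finset.sum_eq_zero fun x' _ => Finset.sum_eq_zero fun y' _ => ?_
        split_ifs with h'
        · by_cases hx : x' = x
          · have hy : y' ≠ y := by
              rintro rfl
              subst hx
              exact hz (h'.symm.trans h)
            simp [hQ2 y' y hy w hw]
          · simp [hP2 x' x hx v hv]
        · simp
      | zero => simp
      | add a b _ _ ha hb => rw [map_add, ha, hb, add_zero]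
      | smul c a _ ha => rw [map_smul, ha, smul_zero]
  iSup_eq := by
    rw [eq_top_iff, ← TensorProduct.span_tmul_eq_top, Submodule.span_le]
    rintro _ ⟨v, w, rfl⟩
    have hv : v ∈ iSup V.gr := V.iSup_eq ▸ Submodule.mem_top
    have hw : w ∈ iSup W.gr := W.iSup_eq ▸ Submodule.mem_top
    induction hv using Submodule.iSup_induction' with
    | zero => simp
    | add a b _ _ ha hb => rw [TensorProduct.add_tmul]; exact Submodule.add_mem _ ha hb
    | mem x v hv =>
      induction hw using Submodule.iSup_induction' with
      | zero => simp
      | add a b _ _ ha hb => rw [TensorProduct.tmul_add]; exact Submodule.add_mem _ ha hb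
      | mem y w hw =>
        exact Submodule.mem_iSup_of_mem (m x y)
          (Submodule.subset_span ⟨x, y, rfl, v, hv, w, hw, rfl⟩)

theorem tmul_mem {m : X → Y → Z} {V : GrVect X} {W : GrVect Y} {x : X} {y : Y} {z : Z} {v : V}
    {w : W} (h : m x y = z) (hv : v ∈ V.gr x) (hw : w ∈ W.gr y) :
    (v ⊗ₜ[ℂ] w : V ⊗[ℂ] W) ∈ (tensor m V W).gr z := by
  have : (v ⊗ₜ[ℂ] w : V ⊗[ℂ] W) ∈ Submodule.span ℂ
    {t | ∃ x y, m x y = z ∧ ∃ v ∈ V.gr x, ∃ w ∈ W.gr y, t = v ⊗ₜ[ℂ] w} :=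
    Submodule.subset_span ⟨x, y, h, v, hv, w, hw, rfl⟩
  exact this

/-- To check that a linear map on a tensor product is graded, it is enough to consider
tensors of homogeneous elements. -/
theorem map_gr_of_tmul {m : X → Y → Z} {V : GrVect X} {W : GrVect Y} {E : Type}
    [AddCommGroup E] [Module ℂ E] (f : V ⊗[ℂ] W →ₗ[ℂ] E) (g : Submodule ℂ E) (z : Z)
    (h : ∀ x y, m x y = z → ∀ v ∈ V.gr x, ∀ w ∈ W.gr y, f (v ⊗ₜ w) ∈ g)
    (t : V ⊗[ℂ] W) (ht : t ∈ (tensor m V W).gr z) : f t ∈ g := by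
  have : (tensor m V W).gr z ≤ g.comap f := Submodule.span_le.2 (by
    rintro _ ⟨x, y, hxy, v, hv, w, hw, rfl⟩
    exact h x y hxy v hv w hw)
  exact this ht

/-- The tensor product of two graded maps. -/
noncomputable def tensorMap (m : X → Y → Z) {V V' : GrVect X} {W W' : GrVect Y}
    (f : V ⟶ V') (g : W ⟶ W') : tensor m V W ⟶ tensor m V' W' :=
  ⟨TensorProduct.map f.lin g.lin, fun z => map_gr_of_tmul _ _ z fun x y h v hv w hw =>
    tmul_mem h (f.map_gr x v hv) (g.map_gr y w hw)⟩

@[simp] theorem tensorMap_lin (m : X → Y → Z) {V V' : GrVect X} {W W' : GrVect Y}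
    (f : V ⟶ V') (g : W ⟶ W') :
    Hom.lin (tensorMap m f g) = TensorProduct.map f.lin g.lin := rfl

end Tensor

/-- The one-dimensional space `ℂ` in degree `x`. -/
noncomputable def single (x : X) : GrVect X where
  carrier := ℂ
  gr y := ⨆ _ : y = x, ⊤
  indep := by
    classical
    refine indep_of_proj _ (fun z => if z = x then LinearMap.id else 0) ?_ ?_
    · intro z v hv
      by_cases h : z = x
      · simp [h]
      · simpa [h, eq_comm] using hv
    · intro z y hzy v hv
      by_cases h : z = x
      · have : y ≠ x := fun h' => hzy (h.trans h'.symm)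
        simpa [this, h] using hv
      · simp [h]
  iSup_eq := by
    refine eq_top_iff.2 (le_trans ?_ (le_iSup _ x))
    simp

theorem mem_single_self (x : X) (v : ℂ) : v ∈ (single x).gr x :=
  Submodule.mem_iSup_of_mem rfl Submodule.mem_top

theorem mem_single {x y : X} {v : ℂ} (hv : v ∈ (single x).gr y) (h : y ≠ x) : v = 0 := by
  have h' : v ∈ (⨆ _ : y = x, ⊤ : Submodule ℂ ℂ) := hv
  rw [iSup_neg h, Submodule.mem_bot] at h'
  exact h'

section Structure

variable [Finite X] [Finite Y] {X₁ X₂ X₃ X₁₂ X₂₃ T : Type} [Finite X₁] [Finite X₂] [Finite X₃] [Finite X₁₂] [Finite X₂₃]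

/-- The associativity constraint, which is that of vector spaces. -/
noncomputable def assoc (m : X₁ → X₂ → X₁₂) (m' : X₁₂ → X₃ → T) (n : X₂ → X₃ → X₂₃)
    (n' : X₁ → X₂₃ → T) (h : ∀ a b c, m' (m a b) c = n' a (n b c))
    (U : GrVect X₁) (V : GrVect X₂) (W : GrVect X₃) :
    tensor m' (tensor m U V) W ≅ tensor n' U (tensor n V W) where
  hom := ⟨(TensorProduct.assoc ℂ U V W).toLinearMap, fun z =>
    map_gr_of_tmul _ _ z fun x c hxc t ht w hw => by
      refine map_gr_of_tmul ((TensorProduct.assoc ℂ U V W).toLinearMap ∘ₗ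
        (TensorProduct.mk ℂ (U ⊗[ℂ] V) W).flip w) _ x (fun a b hab u hu v hv => ?_) t ht
      exact tmul_mem (by rw [← h, hab, hxc]) hu (tmul_mem rfl hv hw)⟩
  inv := ⟨(TensorProduct.assoc ℂ U V W).symm.toLinearMap, fun z =>
    map_gr_of_tmul _ _ z fun a x hax u hu t ht => by
      refine map_gr_of_tmul ((TensorProduct.assoc ℂ U V W).symm.toLinearMap ∘ₗ
        TensorProduct.mk ℂ U (V ⊗[ℂ] W) u) _ x (fun b c hbc v hv w hw => ?_) t ht
      exact tmul_mem (by rw [h, hbc, hax]) (tmul_mem rfl hu hv) hw⟩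
  hom_inv_id := hom_ext (LinearMap.ext fun t => (TensorProduct.assoc ℂ U V W).symm_apply_apply t)
  inv_hom_id := hom_ext (LinearMap.ext fun t => (TensorProduct.assoc ℂ U V W).apply_symm_apply t)

@[simp] theorem assoc_hom_lin (m : X₁ → X₂ → X₁₂) (m' : X₁₂ → X₃ → T) (n : X₂ → X₃ → X₂₃)
    (n' : X₁ → X₂₃ → T) (h : ∀ a b c, m' (m a b) c = n' a (n b c))
    (U : GrVect X₁) (V : GrVect X₂) (W : GrVect X₃) :
    Hom.lin (assoc m m' n n' h U V W).hom = (TensorProduct.assoc ℂ U V W).toLinearMap := rfl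

@[simp] theorem assoc_inv_lin (m : X₁ → X₂ → X₁₂) (m' : X₁₂ → X₃ → T) (n : X₂ → X₃ → X₂₃)
    (n' : X₁ → X₂₃ → T) (h : ∀ a b c, m' (m a b) c = n' a (n b c))
    (U : GrVect X₁) (V : GrVect X₂) (W : GrVect X₃) :
    Hom.lin (assoc m m' n n' h U V W).inv = (TensorProduct.assoc ℂ U V W).symm.toLinearMap := rfl

/-- The left unit constraint, which is that of vector spaces. -/
noncomputable def lunit (m : X → Y → Y) (e : X) (h : ∀ y, m e y = y) (V : GrVect Y) :
    tensor m (single e) V ≅ V where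
  hom := ⟨(TensorProduct.lid ℂ V).toLinearMap, fun z =>
    map_gr_of_tmul _ _ z fun x y hxy c hc v hv => by
      by_cases hx : x = e
      · subst hx
        rw [h] at hxy
        subst hxy
        exact (V.gr y).smul_mem (show ℂ from c) hv
      · have h0 : (show ℂ from c) = 0 := mem_single hc hx
        have h1 : (show ℂ from c) • v = 0 := by rw [h0, zero_smul]
        have h2 : (show ℂ from c) • v ∈ V.gr z := h1 ▸ zero_mem _
        exact h2⟩
  inv := ⟨(TensorProduct.lid ℂ V).symm.toLinearMap, fun z v hv => by
    exact tmul_mem (h z) (mem_single_self e 1) hv⟩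
  hom_inv_id := hom_ext (LinearMap.ext fun t => (TensorProduct.lid ℂ V).symm_apply_apply t)
  inv_hom_id := hom_ext (LinearMap.ext fun t => (TensorProduct.lid ℂ V).apply_symm_apply t)

@[simp] theorem lunit_hom_lin (m : X → Y → Y) (e : X) (h : ∀ y, m e y = y) (V : GrVect Y) :
    Hom.lin (lunit m e h V).hom = (TensorProduct.lid ℂ V).toLinearMap := rfl

/-- The right unit constraint, which is that of vector spaces. -/
noncomputable def runit (m : Y → X → Y) (e : X) (h : ∀ y, m y e = y) (V : GrVect Y) :
    tensor m V (single e) ≅ V where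
  hom := ⟨(TensorProduct.rid ℂ V).toLinearMap, fun z =>
    map_gr_of_tmul _ _ z fun y x hxy v hv c hc => by
      by_cases hx : x = e
      · subst hx
        rw [h] at hxy
        subst hxy
        exact (V.gr y).smul_mem (show ℂ from c) hv
      · have h0 : (show ℂ from c) = 0 := mem_single hc hx
        have h1 : (show ℂ from c) • v = 0 := by rw [h0, zero_smul]
        have h2 : (show ℂ from c) • v ∈ V.gr z := h1 ▸ zero_mem _
        exact h2⟩
  inv := ⟨(TensorProduct.rid ℂ V).symm.toLinearMap, fun z v hv => by
    exact tmul_mem (h z) hv (mem_single_self e 1)⟩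
  hom_inv_id := hom_ext (LinearMap.ext fun t => (TensorProduct.rid ℂ V).symm_apply_apply t)
  inv_hom_id := hom_ext (LinearMap.ext fun t => (TensorProduct.rid ℂ V).apply_symm_apply t)

@[simp] theorem runit_hom_lin (m : Y → X → Y) (e : X) (h : ∀ y, m y e = y) (V : GrVect Y) :
    Hom.lin (runit m e h V).hom = (TensorProduct.rid ℂ V).toLinearMap := rfl

end Structure

/-- The monoidal category `Vec(G)` of finite-dimensional `G`-graded vector spaces, with
`(V ⊗ W)_k = ⨁_{g h = k} V_g ⊗ W_h` and trivial associator. -/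
noncomputable instance monoidalCategory (G : Type) [Group G] [Finite G] :
    MonoidalCategory (GrVect G) :=
  letI : MonoidalCategoryStruct (GrVect G) :=
    { tensorObj := tensor (· * ·)
      tensorHom := tensorMap (· * ·)
      whiskerLeft := fun V _ _ f => tensorMap (· * ·) (𝟙 V) f
      whiskerRight := fun f W => tensorMap (· * ·) f (𝟙 W)
      tensorUnit := single 1
      associator := assoc _ _ _ _ mul_assoc
      leftUnitor := lunit _ 1 one_mul
      rightUnitor := runit _ 1 mul_one }
  MonoidalCategory.ofTensorHom
    (id_tensorHom_id := fun _ _ => hom_ext TensorProduct.map_id)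
    (id_tensorHom := fun _ _ _ _ => rfl)
    (tensorHom_id := fun _ _ => rfl)
    (tensorHom_comp_tensorHom := fun _ _ _ _ => hom_ext (TensorProduct.map_comp _ _ _ _).symm)
    (associator_naturality := fun _ _ _ => hom_ext (TensorProduct.ext_threefold fun _ _ _ => rfl))
    (leftUnitor_naturality := fun f => hom_ext (TensorProduct.ext' fun c v =>
      (map_smul f.lin (show ℂ from c) v).symm))
    (rightUnitor_naturality := fun f => hom_ext (TensorProduct.ext' fun v c =>
      (map_smul f.lin (show ℂ from c) v).symm))
    (pentagon := fun _ _ _ _ => hom_ext (TensorProduct.ext_fourfold fun _ _ _ _ => rfl))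
    (triangle := fun _ _ => hom_ext (TensorProduct.ext_threefold fun v c w =>
      (TensorProduct.smul_tmul (show ℂ from c) v w).symm))

/-- For a finite `G`-set `X`, the category `Vec(G)` acts on `X`-graded vector spaces by
`(V ⊙ M)_x = ⨁_{g • y = x} V_g ⊗ M_y`, with trivial associativity constraint. -/
noncomputable instance leftAction (G : Type) [Group G] [Finite G] (X : Type) [Finite X]
    [MulAction G X] : MonoidalLeftAction (GrVect G) (GrVect X) where
  actionObj := tensor (· • ·)
  actionHom := tensorMap (· • ·)
  actionHomLeft f M := tensorMap (· • ·) f (𝟙 M)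
  actionHomRight V _ _ f := tensorMap (· • ·) (𝟙 V) f
  actionAssocIso := assoc _ _ _ _ mul_smul
  actionUnitIso := lunit _ 1 (one_smul G)
  actionHom_def _ _ := hom_ext (TensorProduct.ext' fun _ _ => rfl)
  actionHomRight_id _ _ := hom_ext TensorProduct.map_id
  id_actionHomLeft _ _ := hom_ext TensorProduct.map_id
  actionHom_comp _ _ _ _ := hom_ext (TensorProduct.map_comp _ _ _ _)
  actionAssocIso_hom_naturality _ _ _ := hom_ext (TensorProduct.ext_threefold fun _ _ _ => rfl)
  actionUnitIso_hom_naturality f := hom_ext (TensorProduct.ext' fun c v => map_smul f.lin (show ℂ from c) v)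
  whiskerLeft_actionHomLeft _ _ _ _ _ := hom_ext (TensorProduct.ext_threefold fun _ _ _ => rfl)
  whiskerRight_actionHomLeft _ _ _ := hom_ext (TensorProduct.ext_threefold fun _ _ _ => rfl)
  associator_actionHom _ _ _ _ := hom_ext (TensorProduct.ext_fourfold fun _ _ _ _ => rfl)
  leftUnitor_actionHom _ _ := hom_ext (TensorProduct.ext_threefold fun c v w =>
    TensorProduct.smul_tmul' (show ℂ from c) v w)
  rightUnitor_actionHom _ _ := hom_ext (TensorProduct.ext_threefold fun v c w =>
    (TensorProduct.smul_tmul (show ℂ from c) v w))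

end GrVect

/-! ### Semisimple categories, fusion categories, module categories -/

/-- A `ℂ`-linear category is *finite semisimple* if it is abelian, its morphism spaces are
finite-dimensional, every object is a finite direct sum of simple objects, and there are finitely
many simple objects up to isomorphism. -/
structure IsFiniteSemisimple (C : Type*) [Category* C] [Preadditive C] [Linear ℂ C] : Prop where
  hasFiniteBiproducts : Limits.HasFiniteBiproducts C
  hasKernels : Limits.HasKernels C
  hasCokernels : Limits.HasCokernels C
  normalMono : IsNormalMonoCategory C
  normalEpi : IsNormalEpiCategory C
  finiteDimensional_hom : ∀ X Y : C, FiniteDimensional ℂ (X ⟶ Y)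
  semisimple : ∀ X : C, ∃ (n : ℕ) (S : Fin n → C) (b : Limits.Bicone S),
    (∀ i, Simple (S i)) ∧ Nonempty b.IsBilimit ∧ Nonempty (X ≅ b.pt)
  finite_simple : ∃ (n : ℕ) (S : Fin n → C), ∀ X : C, Simple X → ∃ i, Nonempty (X ≅ S i)

/-- A fusion category over `ℂ`: a finite semisimple rigid monoidal category with bilinear tensor
product and simple unit object. -/
structure IsFusionCategory (C : Type*) [Category* C] [Preadditive C] [Linear ℂ C]
    [MonoidalCategory C] : Prop where
  finiteSemisimple : IsFiniteSemisimple C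
  monoidalPreadditive : MonoidalPreadditive C
  monoidalLinear : MonoidalLinear ℂ C
  rigid : Nonempty (RigidCategory C)
  simple_unit : Simple (𝟙_ C)

/-- The action of a `ℂ`-linear monoidal category on a `ℂ`-linear category is *bilinear* if it is
so on morphisms. -/
class IsBilinearAction (C M : Type*) [Category* C] [Preadditive C] [Linear ℂ C]
    [MonoidalCategory C] [Category* M] [Preadditive M] [Linear ℂ M] [MonoidalLeftAction C M] :
    Prop where
  add_actionHomLeft : ∀ {c c' : C} (f g : c ⟶ c') (m : M), (f + g) ⊵ₗ m = f ⊵ₗ m + g ⊵ₗ m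
  smul_actionHomLeft : ∀ {c c' : C} (r : ℂ) (f : c ⟶ c') (m : M),
    (r • f) ⊵ₗ m = r • (f ⊵ₗ m)
  actionHomRight_add : ∀ (c : C) {m m' : M} (f g : m ⟶ m'), c ⊴ₗ (f + g) = c ⊴ₗ f + c ⊴ₗ g
  actionHomRight_smul : ∀ (c : C) {m m' : M} (r : ℂ) (f : m ⟶ m'),
    c ⊴ₗ (r • f) = r • (c ⊴ₗ f)

/-- A module category `M` is *indecomposable* if it is nonzero and not a direct sum `P ⊕ Q` of two
nonzero module subcategories: `P` and `Q` are stable under the action, there are no nonzero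
morphisms between them, and every object is the direct sum of an object in `P` and one in `Q`. -/
def IsIndecomposableModule (C M : Type*) [Category* C] [MonoidalCategory C] [Category* M]
    [Preadditive M] [MonoidalLeftAction C M] : Prop :=
  (∃ X : M, ¬ Limits.IsZero X) ∧
  ∀ P Q : ObjectProperty M,
    (∀ (c : C) (X : M), P X → P (c ⊙ₗ X)) →
    (∀ (c : C) (Y : M), Q Y → Q (c ⊙ₗ Y)) →
    (∀ X Y : M, P X → Q Y → (∀ f : X ⟶ Y, f = 0) ∧ ∀ g : Y ⟶ X, g = 0) →
    (∀ Z : M, ∃ (X Y : M) (b : Limits.BinaryBicone X Y),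
      P X ∧ Q Y ∧ Nonempty b.IsBilimit ∧ Nonempty (Z ≅ b.pt)) →
    (∀ X : M, P X → Limits.IsZero X) ∨ (∀ Y : M, Q Y → Limits.IsZero Y)

/-! ### The dual category of a module category -/

/-- A `ℂ`-linear `C`-module endofunctor of `M`: an endofunctor `F` with coherent natural
isomorphisms `c ⊙ F(m) ≅ F(c ⊙ m)`. -/
structure ModEnd (C M : Type*) [Category* C] [MonoidalCategory C] [Category* M]
    [Preadditive M] [Linear ℂ M] [MonoidalLeftAction C M] where
  functor : M ⥤ M
  [additive : functor.Additive]
  [linear : functor.Linear ℂ]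
  [leftLinear : functor.LeftLinear C]

namespace ModEnd

open Functor.LaxLeftLinear Functor.OplaxLeftLinear

attribute [instance] ModEnd.additive ModEnd.linear ModEnd.leftLinear

variable {C M : Type*} [Category* C] [MonoidalCategory C] [Category* M]
  [MonoidalLeftAction C M]

/-- The identity functor is a module functor. -/
instance idLeftLinear : (𝟭 M).LeftLinear C where
  μₗ c m := 𝟙 _
  δₗ c m := 𝟙 _
  μₗ_comp_δₗ := by simp
  δₗ_comp_μₗ := by simp

/-- The composite of two module functors is a module functor. -/
instance compLeftLinear (F G : M ⥤ M) [F.LeftLinear C] [G.LeftLinear C] :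
    (F ⋙ G).LeftLinear C where
  μₗ c m := μₗ G c (F.obj m) ≫ G.map (μₗ F c m)
  μₗ_naturality_left f m := by
    simp [← Functor.map_comp]
  μₗ_naturality_right c _ _ f := by
    simp [← Functor.map_comp]
  μₗ_associativity c c' m := by
    rw [Functor.comp_map, Category.assoc, ← Functor.map_comp, μₗ_associativity]
    simp
  μₗ_unitality m := by
    simp [← Functor.map_comp]
  δₗ c m := G.map (δₗ F c m) ≫ δₗ G c (F.obj m)
  δₗ_naturality_left f m := by
    rw [Functor.comp_map, ← Functor.map_comp_assoc, δₗ_naturality_left]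
    simp
  δₗ_naturality_right c _ _ f := by
    rw [Functor.comp_map, ← Functor.map_comp_assoc, δₗ_naturality_right]
    simp
  δₗ_associativity c c' m := by
    have h := congrArg G.map (δₗ_associativity F c c' m)
    simp only [Functor.map_comp] at h
    simp [reassoc_of% h]
  δₗ_unitality_inv m := by
    simp
  μₗ_comp_δₗ c m := by
    simp [← Functor.map_comp_assoc]
  δₗ_comp_μₗ c m := by
    simp [← Functor.map_comp]

@[simp] theorem id_μₗ (c : C) (m : M) : μₗ (𝟭 M) c m = 𝟙 (c ⊙ₗ m) := rfl

@[simp] theorem comp_μₗ (F G : M ⥤ M) [F.LeftLinear C] [G.LeftLinear C] (c : C) (m : M) :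
    μₗ (F ⋙ G) c m = μₗ G c (F.obj m) ≫ G.map (μₗ F c m) := rfl

variable [Preadditive M] [Linear ℂ M]

/-- Morphisms of module functors: natural transformations compatible with the isomorphisms
`c ⊙ F(m) ≅ F(c ⊙ m)`. -/
@[ext]
structure Hom (F G : ModEnd C M) where
  nat : F.functor ⟶ G.functor
  comm : ∀ (c : C) (m : M),
    μₗ F.functor c m ≫ nat.app (c ⊙ₗ m) = c ⊴ₗ nat.app m ≫ μₗ G.functor c m

theorem Hom.comm_assoc {F G : ModEnd C M} (f : Hom F G) (c : C) (m : M) {Z : M}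
    (h : G.functor.obj (c ⊙ₗ m) ⟶ Z) :
    μₗ F.functor c m ≫ f.nat.app (c ⊙ₗ m) ≫ h = c ⊴ₗ f.nat.app m ≫ μₗ G.functor c m ≫ h := by
  rw [← Category.assoc, f.comm, Category.assoc]

instance : Category (ModEnd C M) where
  Hom := Hom
  id F := ⟨𝟙 _, by simp⟩
  comp f g := ⟨f.nat ≫ g.nat, fun c m => by simp [f.comm_assoc, g.comm]⟩

@[ext]
theorem hom_ext {F G : ModEnd C M} {f g : F ⟶ G} (h : ∀ m, f.nat.app m = g.nat.app m) : f = g :=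
  Hom.ext (NatTrans.ext (funext h))

@[simp] theorem id_nat (F : ModEnd C M) : Hom.nat (𝟙 F) = 𝟙 F.functor := rfl

@[simp] theorem comp_nat {F G H : ModEnd C M} (f : F ⟶ G) (g : G ⟶ H) :
    Hom.nat (f ≫ g) = f.nat ≫ g.nat := rfl


section Linear

variable [Preadditive C] [Linear ℂ C] [IsBilinearAction C M] (F G : ModEnd C M)

/-- The natural transformations of module functors form a subspace of all natural
transformations. -/
def homSubmodule : Submodule ℂ (F.functor ⟶ G.functor) where
  carrier := {t | ∀ (c : C) (m : M),
    μₗ F.functor c m ≫ t.app (c ⊙ₗ m) = c ⊴ₗ t.app m ≫ μₗ G.functor c m}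
  add_mem' {s t} hs ht c m := by
    rw [NatTrans.app_add, NatTrans.app_add, Preadditive.comp_add, hs, ht,
      IsBilinearAction.actionHomRight_add, Preadditive.add_comp]
  zero_mem' c m := by
    have h : c ⊴ₗ (0 : F.functor.obj m ⟶ G.functor.obj m) = 0 := by
      have := IsBilinearAction.actionHomRight_smul c (0 : ℂ)
        (0 : F.functor.obj m ⟶ G.functor.obj m)
      rwa [zero_smul, zero_smul] at this
    simp [h]
  smul_mem' r t ht c m := by
    rw [NatTrans.app_smul, NatTrans.app_smul, Linear.comp_smul, ht,
      IsBilinearAction.actionHomRight_smul, Linear.smul_comp]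

/-- Morphisms of module functors as elements of this subspace. -/
def homEquiv : (F ⟶ G) ≃ homSubmodule F G where
  toFun f := ⟨f.nat, f.comm⟩
  invFun f := ⟨f.1, f.2⟩

instance : AddCommGroup (F ⟶ G) := (homEquiv F G).addCommGroup

instance : Module ℂ (F ⟶ G) := (homEquiv F G).module ℂ

@[simp] theorem add_nat {F G : ModEnd C M} (f g : F ⟶ G) : Hom.nat (f + g) = f.nat + g.nat := rfl

@[simp] theorem smul_nat {F G : ModEnd C M} (r : ℂ) (f : F ⟶ G) :
    Hom.nat (r • f) = r • f.nat := rfl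

instance : Preadditive (ModEnd C M) where

instance : Linear ℂ (ModEnd C M) where

end Linear

/-- A natural isomorphism compatible with the module structures is an isomorphism of module
functors. -/
def mkIso {F G : ModEnd C M} (e : F.functor ≅ G.functor)
    (h : ∀ (c : C) (m : M),
      μₗ F.functor c m ≫ e.hom.app (c ⊙ₗ m) = c ⊴ₗ e.hom.app m ≫ μₗ G.functor c m) : F ≅ G where
  hom := ⟨e.hom, h⟩
  inv := ⟨e.inv, fun c m => by
    rw [← cancel_mono (e.hom.app _), Category.assoc, Category.assoc, h]
    simp [← MonoidalLeftAction.actionHomRight_comp_assoc]⟩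

/-- The tensor product of module endofunctors is composition: `F ⊗ G` is `F` followed by `G`. -/
instance : MonoidalCategoryStruct (ModEnd C M) where
  tensorObj F G := ⟨F.functor ⋙ G.functor⟩
  tensorUnit := ⟨𝟭 M⟩
  whiskerLeft F _ _ t := ⟨Functor.whiskerLeft F.functor t.nat, fun c m => by
    simp [t.comm_assoc]⟩
  whiskerRight t G := ⟨Functor.whiskerRight t.nat G.functor, fun c m => by
    simp [← Functor.map_comp, t.comm]⟩
  associator F G H := mkIso (Functor.associator F.functor G.functor H.functor) (by simp)
  leftUnitor F := mkIso (Functor.leftUnitor F.functor) (by simp)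
  rightUnitor F := mkIso (Functor.rightUnitor F.functor) (by simp)

@[simp] theorem tensorObj_functor (F G : ModEnd C M) :
    (F ⊗ G).functor = F.functor ⋙ G.functor := rfl

@[simp] theorem whiskerLeft_app (F : ModEnd C M) {G H : ModEnd C M} (t : G ⟶ H) (m : M) :
    (F ◁ t).nat.app m = t.nat.app (F.functor.obj m) := rfl

@[simp] theorem whiskerRight_app {F G : ModEnd C M} (t : F ⟶ G) (H : ModEnd C M) (m : M) :
    (t ▷ H).nat.app m = H.functor.map (t.nat.app m) := rfl

@[simp] theorem associator_hom_app (F G H : ModEnd C M) (m : M) :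
    (α_ F G H).hom.nat.app m = 𝟙 _ := rfl

@[simp] theorem leftUnitor_hom_app (F : ModEnd C M) (m : M) :
    (λ_ F).hom.nat.app m = 𝟙 _ := rfl

@[simp] theorem rightUnitor_hom_app (F : ModEnd C M) (m : M) :
    (ρ_ F).hom.nat.app m = 𝟙 _ := rfl

/-- The dual category `End_C(M)` of a module category is monoidal under composition. -/
instance monoidalCategory : MonoidalCategory (ModEnd C M) where
  tensorHom_def _ _ := rfl
  id_tensorHom_id F G := hom_ext fun m => by
    exact (Category.comp_id _).trans (G.functor.map_id _)
  tensorHom_comp_tensorHom {X₁ Y₁ Z₁ X₂ Y₂ Z₂} f₁ f₂ g₁ g₂ := hom_ext fun m => by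
    change (X₂.functor.map (f₁.nat.app m) ≫ f₂.nat.app (Y₁.functor.obj m)) ≫
      Y₂.functor.map (g₁.nat.app m) ≫ g₂.nat.app (Z₁.functor.obj m) =
      X₂.functor.map (f₁.nat.app m ≫ g₁.nat.app m) ≫
        f₂.nat.app (Z₁.functor.obj m) ≫ g₂.nat.app (Z₁.functor.obj m)
    simp
  whiskerLeft_id _ _ := rfl
  id_whiskerRight F G := hom_ext fun m => G.functor.map_id _
  associator_naturality f₁ f₂ f₃ := hom_ext fun m => by
    change (CategoryTheory.Functor.map _ (_ ≫ _) ≫ _) ≫ 𝟙 _ = 𝟙 _ ≫ _ ≫ (_ ≫ _)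
    simp [← CategoryTheory.Functor.map_comp]
  leftUnitor_naturality f := hom_ext fun m => by
    exact (Category.comp_id _).trans (Category.id_comp _).symm
  rightUnitor_naturality f := hom_ext fun m => by
    exact (Category.comp_id _).trans (Category.id_comp _).symm
  pentagon W X Y Z := hom_ext fun m => by
    change CategoryTheory.Functor.map _ (𝟙 _) ≫ 𝟙 _ ≫ 𝟙 _ = 𝟙 _ ≫ 𝟙 _
    simp
  triangle X Y := hom_ext fun m => by
    exact (Category.comp_id _).trans (Y.functor.map_id _).symm

end ModEnd

/-! ### Morita equivalence -/

/-- `M` is an indecomposable (finite semisimple) left module category over `C`, and `D` is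
equivalent, as a `ℂ`-linear monoidal category, to the dual category `End_C(M)`. -/
structure IsMoritaContext (C D M : Type*) [Category* C] [Preadditive C] [Linear ℂ C]
    [MonoidalCategory C] [Category* D] [Preadditive D] [Linear ℂ D] [MonoidalCategory D]
    [Category* M] [Preadditive M] [Linear ℂ M] [MonoidalLeftAction C M] [IsBilinearAction C M] :
    Prop where
  finiteSemisimple : IsFiniteSemisimple M
  indecomposable : IsIndecomposableModule C M
  equivalence : ∃ (Φ : D ⥤ ModEnd C M) (_ : Φ.Monoidal),
    Φ.IsEquivalence ∧ Φ.Additive ∧ Φ.Linear ℂ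

universe v u v' u'

/-- Two fusion categories `C` and `D` are (categorically) *Morita equivalent* if there is an
indecomposable module category `M` over `C` such that `D` is monoidally equivalent to the dual
category `End_C(M)`. -/
def MoritaEquivalent (C : Type u) (D : Type u') [Category.{v} C] [Preadditive C] [Linear ℂ C]
    [MonoidalCategory C] [Category.{v'} D] [Preadditive D] [Linear ℂ D] [MonoidalCategory D] :
    Prop :=
  IsFusionCategory C ∧ IsFusionCategory D ∧
  ∃ (M : Type u) (_ : Category.{v} M) (_ : Preadditive M) (_ : Linear ℂ M)
    (_ : MonoidalLeftAction C M) (_ : IsBilinearAction C M), IsMoritaContext C D M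

/-! ### Categories given by fusion rules and F-symbols -/

/-- Multiplicity-free fusion rules on a finite set `I` of simple objects, together with
F-symbols satisfying the pentagon and triangle equations.

* `N a b c` says that `c` is a summand of `a ⊗ b` (with multiplicity one).
* `F a b c d e f` is the coefficient of the associator `(a ⊗ b) ⊗ c ⟶ a ⊗ (b ⊗ c)` from the summand
  `d` of `e ⊗ c`, where `e` is a summand of `a ⊗ b`, to the summand `d` of `a ⊗ f`, where `f` is a
  summand of `b ⊗ c`. Its values on other arguments play no role.
* `F'` are the coefficients of the inverse of the associator. -/
structure FusionData (I : Type) [Fintype I] [DecidableEq I] where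
  one : I
  N : I → I → I → Prop
  [decN : ∀ a b c, Decidable (N a b c)]
  one_N : ∀ a c, N one a c ↔ c = a
  N_one : ∀ a c, N a one c ↔ c = a
  F : I → I → I → I → I → I → ℂ
  F' : I → I → I → I → I → I → ℂ
  F_F' : ∀ a b c d e e', N a b e → N e c d → N a b e' → N e' c d →
    (∑ f, if N b c f ∧ N a f d then F a b c d e f * F' a b c d f e' else 0) =
      if e = e' then 1 else 0
  F'_F : ∀ a b c d f f', N b c f → N a f d → N b c f' → N a f' d →
    (∑ e, if N a b e ∧ N e c d then F' a b c d f e * F a b c d e f' else 0) =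
      if f = f' then 1 else 0
  triangle : ∀ a b c, N a b c → F a one b c a b = 1
  pentagon : ∀ a b c d e f g k l, N a b e → N e c f → N f d g → N c d l → N b l k → N a k g →
    (∑ h, if N b c h ∧ N a h f ∧ N h d k then
      F a b c f e h * F a h d g f k * F b c d k h l else 0) =
      if N e l g then F e c d g f l * F a b l g e k else 0

attribute [instance] FusionData.decN

/-- An object of the category with fusion data `D`: a finite formal direct sum
`⨁ s : ι, label s` of simple objects. -/
structure FusionObj {I : Type} [Fintype I] [DecidableEq I] (D : FusionData I) : Type 1 where
  ι : Type
  [fintype : Fintype ι]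
  [decEq : DecidableEq ι]
  label : ι → I

namespace FusionObj

attribute [instance] FusionObj.fintype FusionObj.decEq

variable {I : Type} [Fintype I] [DecidableEq I] {D : FusionData I}

/-- Morphisms between formal direct sums of simple objects: matrices of scalars, with zero entries
between distinct simple objects. -/
@[ext]
structure Hom (X Y : FusionObj D) where
  mat : X.ι → Y.ι → ℂ
  supp : ∀ s t, X.label s ≠ Y.label t → mat s t = 0

instance : Category (FusionObj D) where
  Hom := Hom
  id X := ⟨fun s t => if s = t then 1 else 0, fun s t h => if_neg fun h' => h (congrArg _ h')⟩
  comp {X Y Z} f g := ⟨fun s u => ∑ t, f.mat s t * g.mat t u, fun s u h =>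
    Finset.sum_eq_zero fun t _ => by
      by_cases h' : X.label s = Y.label t
      · rw [g.supp t u fun h'' => h (h'.trans h''), mul_zero]
      · rw [f.supp s t h', zero_mul]⟩
  id_comp f := Hom.ext (by ext s t; simp)
  comp_id f := Hom.ext (by ext s t; simp)
  assoc f g h := Hom.ext (by
    ext s t
    simp only [Finset.sum_mul, Finset.mul_sum, mul_assoc]
    exact Finset.sum_comm)

theorem hom_ext {X Y : FusionObj D} {f g : X ⟶ Y} (h : ∀ s t, f.mat s t = g.mat s t) : f = g :=
  Hom.ext (funext fun s => funext fun t => h s t)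

theorem id_mat (X : FusionObj D) (s t : X.ι) : Hom.mat (𝟙 X) s t = if s = t then 1 else 0 := rfl

theorem comp_mat {X Y Z : FusionObj D} (f : X ⟶ Y) (g : Y ⟶ Z) (s : X.ι) (u : Z.ι) :
    Hom.mat (f ≫ g) s u = ∑ t, f.mat s t * g.mat t u := rfl

section Linear

variable (X Y : FusionObj D)

/-- The matrices supported on equal labels form a subspace of all matrices. -/
def homSubmodule : Submodule ℂ (X.ι → Y.ι → ℂ) where
  carrier := {m | ∀ s t, X.label s ≠ Y.label t → m s t = 0}
  add_mem' hf hg s t h := by simp [hf s t h, hg s t h]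
  zero_mem' _ _ _ := rfl
  smul_mem' c _ hf s t h := by simp [hf s t h]

/-- Morphisms as elements of this subspace. -/
def homEquiv : (X ⟶ Y) ≃ homSubmodule X Y where
  toFun f := ⟨f.mat, f.supp⟩
  invFun f := ⟨f.1, f.2⟩

instance : AddCommGroup (X ⟶ Y) := (homEquiv X Y).addCommGroup

instance : Module ℂ (X ⟶ Y) := (homEquiv X Y).module ℂ

theorem add_mat {X Y : FusionObj D} (f g : X ⟶ Y) (s : X.ι) (t : Y.ι) :
    Hom.mat (f + g) s t = f.mat s t + g.mat s t := rfl

theorem smul_mat {X Y : FusionObj D} (c : ℂ) (f : X ⟶ Y) (s : X.ι) (t : Y.ι) :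
    Hom.mat (c • f) s t = c * f.mat s t := rfl

end Linear

instance : Preadditive (FusionObj D) where
  add_comp _ _ _ f f' g := hom_ext fun s t => by
    simp [comp_mat, add_mat, add_mul, Finset.sum_add_distrib]
  comp_add _ _ _ f g g' := hom_ext fun s t => by
    simp [comp_mat, add_mat, mul_add, Finset.sum_add_distrib]

instance : Linear ℂ (FusionObj D) where
  smul_comp _ _ _ r f g := hom_ext fun s t => by
    simp [comp_mat, smul_mat, mul_assoc, Finset.mul_sum]
  comp_smul _ _ _ f r g := hom_ext fun s t => by
    simp [comp_mat, smul_mat, mul_left_comm, Finset.mul_sum]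

/-- The simple summands of `X ⊗ Y`, given by distributivity and the fusion rules: they are indexed
by a summand `fst` of `X`, a summand `snd` of `Y`, and a summand `out` of the tensor product of the
two corresponding simple objects. -/
structure TensorIdx (X Y : FusionObj D) where
  fst : X.ι
  snd : Y.ι
  out : I
  adm : D.N (X.label fst) (Y.label snd) out

/-- Indices for `X ⊗ Y` as a subtype of a product. -/
def tensorIdxEquiv (X Y : FusionObj D) :
    TensorIdx X Y ≃ {p : X.ι × Y.ι × I // D.N (X.label p.1) (Y.label p.2.1) p.2.2} where
  toFun p := ⟨(p.fst, p.snd, p.out), p.adm⟩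
  invFun p := ⟨p.1.1, p.1.2.1, p.1.2.2, p.2⟩

instance (X Y : FusionObj D) : Fintype (TensorIdx X Y) :=
  Fintype.ofEquiv _ (tensorIdxEquiv X Y).symm

instance (X Y : FusionObj D) : DecidableEq (TensorIdx X Y) := (tensorIdxEquiv X Y).decidableEq

/-- The tensor product of formal direct sums of simple objects. -/
abbrev tensor (X Y : FusionObj D) : FusionObj D where
  ι := TensorIdx X Y
  label p := p.out

/-- The tensor product of morphisms. -/
def tensorMap {X X' Y Y' : FusionObj D} (f : X ⟶ X') (g : Y ⟶ Y') : tensor X Y ⟶ tensor X' Y' where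
  mat p q := if p.out = q.out then f.mat p.fst q.fst * g.mat p.snd q.snd else 0
  supp _ _ h := if_neg h

/-- The unit object. -/
def unit (D : FusionData I) : FusionObj D where
  ι := Unit
  label _ := D.one

/-- The associator, with coefficients the F-symbols. -/
def assocHom (X Y Z : FusionObj D) : tensor (tensor X Y) Z ⟶ tensor X (tensor Y Z) where
  mat p q :=
    if p.fst.fst = q.fst ∧ p.fst.snd = q.snd.fst ∧ p.snd = q.snd.snd ∧
      p.out = q.out then
      D.F (X.label p.fst.fst) (Y.label p.fst.snd) (Z.label p.snd) p.out
        p.fst.out q.snd.out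
    else 0
  supp _ _ h := if_neg fun h' => h h'.2.2.2

/-- The inverse of the associator. -/
def assocInv (X Y Z : FusionObj D) : tensor X (tensor Y Z) ⟶ tensor (tensor X Y) Z where
  mat q p :=
    if p.fst.fst = q.fst ∧ p.fst.snd = q.snd.fst ∧ p.snd = q.snd.snd ∧
      p.out = q.out then
      D.F' (X.label p.fst.fst) (Y.label p.fst.snd) (Z.label p.snd) p.out
        q.snd.out p.fst.out
    else 0
  supp _ _ h := if_neg fun h' => h h'.2.2.2.symm

/-- The left unitor. -/
def lunitHom (X : FusionObj D) : tensor (unit D) X ⟶ X where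
  mat p s := if p.snd = s then 1 else 0
  supp p s h := if_neg fun h' => h (by subst h'; exact (D.one_N _ _).1 p.adm)

/-- The inverse of the left unitor. -/
def lunitInv (X : FusionObj D) : X ⟶ tensor (unit D) X where
  mat s p := if p.snd = s then 1 else 0
  supp s p h := if_neg fun h' => h (by subst h'; exact ((D.one_N _ _).1 p.adm).symm)

/-- The right unitor. -/
def runitHom (X : FusionObj D) : tensor X (unit D) ⟶ X where
  mat p s := if p.fst = s then 1 else 0
  supp p s h := if_neg fun h' => h (by subst h'; exact (D.N_one _ _).1 p.adm)

/-- The inverse of the right unitor. -/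
def runitInv (X : FusionObj D) : X ⟶ tensor X (unit D) where
  mat s p := if p.fst = s then 1 else 0
  supp s p h := if_neg fun h' => h (by subst h'; exact ((D.N_one _ _).1 p.adm).symm)

section Proofs

/-- The action of a morphism on column vectors, a device for the proofs below. -/
def app {X Y : FusionObj D} (f : X ⟶ Y) (v : Y.ι → ℂ) (s : X.ι) : ℂ := ∑ t, f.mat s t * v t

theorem app_id (X : FusionObj D) (v : X.ι → ℂ) : app (𝟙 X) v = v := by
  ext s; simp [app, id_mat]

theorem app_comp {X Y Z : FusionObj D} (f : X ⟶ Y) (g : Y ⟶ Z) (v : Z.ι → ℂ) :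
    app (f ≫ g) v = app f (app g v) := by
  ext s
  simp only [app, comp_mat, Finset.sum_mul, Finset.mul_sum, mul_assoc]
  exact Finset.sum_comm

theorem ext_app {X Y : FusionObj D} {f g : X ⟶ Y} (h : ∀ v s, app f v s = app g v s) : f = g :=
  hom_ext fun s t => by simpa [app] using h (fun u => if u = t then 1 else 0) s

/-- Extension by zero of a vector indexed by the summands of `X ⊗ Y`. -/
def hat {X Y : FusionObj D} (v : TensorIdx X Y → ℂ) (s : X.ι) (t : Y.ι) (k : I) : ℂ :=
  if h : D.N (X.label s) (Y.label t) k then v ⟨s, t, k, h⟩ else 0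

theorem hat_val {X Y : FusionObj D} (v : TensorIdx X Y → ℂ) (p : TensorIdx X Y) :
    hat v p.fst p.snd p.out = v p := dif_pos p.adm

theorem hat_eq_ite {X Y : FusionObj D} (v : TensorIdx X Y → ℂ) (w : X.ι → Y.ι → I → ℂ)
    (h : ∀ p, v p = w p.fst p.snd p.out) (s : X.ι) (t : Y.ι) (k : I) :
    hat v s t k = if D.N (X.label s) (Y.label t) k then w s t k else 0 := by
  unfold hat
  split_ifs with h'
  · rw [h]
  · rfl

theorem sum_tensor {X Y : FusionObj D} (w : TensorIdx X Y → ℂ) (v : TensorIdx X Y → ℂ)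
    (u : X.ι → Y.ι → I → ℂ) (h : ∀ p, w p = u p.fst p.snd p.out) :
    ∑ p, w p * v p = ∑ s, ∑ t, ∑ k, u s t k * hat v s t k := by
  have h1 : ∀ p : TensorIdx X Y, w p * v p =
      u p.fst p.snd p.out * hat v p.fst p.snd p.out := fun p => by rw [h, hat_val]
  rw [Finset.sum_congr rfl fun p _ => h1 p]
  have h2 := (Finset.sum_subtype (F := inferInstance) (p := fun p : X.ι × Y.ι × I =>
      D.N (X.label p.1) (Y.label p.2.1) p.2.2) (Finset.univ.filter
    fun p : X.ι × Y.ι × I => D.N (X.label p.1) (Y.label p.2.1) p.2.2)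
    (fun p => by simp) (fun p => u p.1 p.2.1 p.2.2 * hat v p.1 p.2.1 p.2.2)).symm
  refine (Eq.trans ?_ h2).trans ?_
  · exact Fintype.sum_equiv (tensorIdxEquiv X Y) _ _ fun p => rfl
  · rw [Finset.sum_filter, Fintype.sum_prod_type]
    refine Finset.sum_congr rfl fun s _ => ?_
    rw [Fintype.sum_prod_type]
    refine Finset.sum_congr rfl fun t _ => Finset.sum_congr rfl fun k _ => ?_
    split_ifs with h'
    · rfl
    · rw [hat, dif_neg h', mul_zero]

theorem app_tensorMap {X X' Y Y' : FusionObj D} (f : X ⟶ X') (g : Y ⟶ Y')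
    (v : TensorIdx X' Y' → ℂ) (p : TensorIdx X Y) :
    app (tensorMap f g) v p =
      ∑ s, ∑ t, f.mat p.fst s * g.mat p.snd t * hat v s t p.out := by
  refine (sum_tensor (fun q => (tensorMap f g).mat p q) v
    (fun s t k => if p.out = k then f.mat p.fst s * g.mat p.snd t else 0) fun q => rfl).trans ?_
  simp

theorem app_assocHom {X Y Z : FusionObj D} (v : TensorIdx X (tensor Y Z) → ℂ)
    (p : TensorIdx (tensor X Y) Z) :
    app (assocHom X Y Z) v p = ∑ f,
      D.F (X.label p.fst.fst) (Y.label p.fst.snd) (Z.label p.snd) p.out p.fst.out f *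
        hat (fun y => hat v p.fst.fst y p.out) p.fst.snd p.snd f := by
  refine (sum_tensor (fun q => (assocHom X Y Z).mat p q) v (fun s (y : TensorIdx Y Z) d => if p.fst.fst = s ∧ p.fst.snd = y.fst ∧ p.snd = y.snd ∧
      p.out = d then
      D.F (X.label p.fst.fst) (Y.label p.fst.snd) (Z.label p.snd) p.out
        p.fst.out y.out else 0) fun q => rfl).trans ?_
  rw [Finset.sum_eq_single p.fst.fst (fun s _ hs => by simp [hs.symm]) (by simp)]
  have : ∀ y : TensorIdx Y Z, (∑ d, (if p.fst.fst = p.fst.fst ∧ p.fst.snd = y.fst ∧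
      p.snd = y.snd ∧ p.out = d then
      D.F (X.label p.fst.fst) (Y.label p.fst.snd) (Z.label p.snd) p.out
        p.fst.out y.out else 0) * hat v p.fst.fst y d) =
      (if p.fst.snd = y.fst ∧ p.snd = y.snd then
      D.F (X.label p.fst.fst) (Y.label p.fst.snd) (Z.label p.snd) p.out
        p.fst.out y.out else 0) * hat v p.fst.fst y p.out := fun y => by
    rw [Finset.sum_eq_single p.out (fun d _ hd => by simp [hd.symm]) (by simp)]
    simp
  rw [Finset.sum_congr rfl fun y _ => this y]
  rw [sum_tensor _ _ (fun t u f => if p.fst.snd = t ∧ p.snd = u then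
      D.F (X.label p.fst.fst) (Y.label p.fst.snd) (Z.label p.snd) p.out
        p.fst.out f else 0) fun q => rfl]
  rw [Finset.sum_eq_single p.fst.snd (fun s _ hs => by simp [hs.symm]) (by simp)]
  rw [Finset.sum_eq_single p.snd (fun s _ hs => by simp [hs.symm]) (by simp)]
  simp

theorem app_assocInv {X Y Z : FusionObj D} (v : TensorIdx (tensor X Y) Z → ℂ)
    (q : TensorIdx X (tensor Y Z)) :
    app (assocInv X Y Z) v q = ∑ e,
      D.F' (X.label q.fst) (Y.label q.snd.fst) (Z.label q.snd.snd) q.out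
        q.snd.out e *
        hat (fun y => hat v y q.snd.snd q.out) q.fst q.snd.fst e := by
  refine (sum_tensor (fun p => (assocInv X Y Z).mat q p) v (fun (y : TensorIdx X Y) u d => if y.fst = q.fst ∧ y.snd = q.snd.fst ∧
      u = q.snd.snd ∧ d = q.out then
      D.F' (X.label y.fst) (Y.label y.snd) (Z.label u) d q.snd.out y.out else 0)
      fun p => rfl).trans ?_
  have : ∀ y : TensorIdx X Y, (∑ u, ∑ d, (if y.fst = q.fst ∧ y.snd = q.snd.fst ∧
      u = q.snd.snd ∧ d = q.out then
      D.F' (X.label y.fst) (Y.label y.snd) (Z.label u) d q.snd.out y.out else 0) *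
        hat v y u d) =
      (if y.fst = q.fst ∧ y.snd = q.snd.fst then
      D.F' (X.label y.fst) (Y.label y.snd) (Z.label q.snd.snd) q.out q.snd.out
        y.out else 0) * hat v y q.snd.snd q.out := fun y => by
    rw [Finset.sum_eq_single q.snd.snd (fun u _ hu => by simp [hu]) (by simp)]
    rw [Finset.sum_eq_single q.out (fun d _ hd => by simp [hd]) (by simp)]
    simp
  rw [Finset.sum_congr rfl fun y _ => this y]
  rw [sum_tensor _ _ (fun s t e => if s = q.fst ∧ t = q.snd.fst then
      D.F' (X.label s) (Y.label t) (Z.label q.snd.snd) q.out q.snd.out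
        e else 0) fun q => rfl]
  rw [Finset.sum_eq_single q.fst (fun s _ hs => by simp [hs]) (by simp)]
  rw [Finset.sum_eq_single q.snd.fst (fun s _ hs => by simp [hs]) (by simp)]
  simp

theorem app_whiskerRight {X X' Y : FusionObj D} (f : X ⟶ X') (v : TensorIdx X' Y → ℂ)
    (p : TensorIdx X Y) :
    app (tensorMap f (𝟙 Y)) v p = app f (fun r => hat v r p.snd p.out) p.fst := by
  rw [app_tensorMap]
  simp [app, id_mat]

theorem app_whiskerLeft {X Y Y' : FusionObj D} (g : Y ⟶ Y') (v : TensorIdx X Y' → ℂ)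
    (p : TensorIdx X Y) :
    app (tensorMap (𝟙 X) g) v p = app g (fun r => hat v p.fst r p.out) p.snd := by
  rw [app_tensorMap, Finset.sum_eq_single p.fst (fun s _ hs => by simp [id_mat, hs.symm]) (by simp)]
  simp [app, id_mat]

theorem hat_congr {X Y : FusionObj D} {v w : TensorIdx X Y → ℂ} {s : X.ι} {t : Y.ι} {k : I}
    (h : ∀ p, p.fst = s → p.snd = t → p.out = k → v p = w p) : hat v s t k = hat w s t k := by
  unfold hat
  split_ifs with h'
  · exact h _ rfl rfl rfl
  · rfl

theorem hat_sum {X Y : FusionObj D} {K : Type} [Fintype K] (c : K → ℂ)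
    (v : K → TensorIdx X Y → ℂ) (s : X.ι) (t : Y.ι) (k : I) :
    hat (fun p => ∑ l, c l * v l p) s t k = ∑ l, c l * hat (v l) s t k := by
  unfold hat
  split_ifs with h'
  · rfl
  · simp

theorem hat_zero {X Y : FusionObj D} (v : TensorIdx X Y → ℂ) {s : X.ι} {t : Y.ι} {k : I}
    (h : ¬ D.N (X.label s) (Y.label t) k) : hat v s t k = 0 := dif_neg h

theorem hat_zero' {X Y : FusionObj D} {v : TensorIdx X Y → ℂ} (hv : ∀ p, v p = 0) (s : X.ι)
    (t : Y.ι) (k : I) : hat v s t k = 0 := by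
  unfold hat
  split_ifs with h
  · exact hv _
  · rfl

theorem app_lunitHom (X : FusionObj D) (v : X.ι → ℂ) (p : TensorIdx (unit D) X) :
    app (lunitHom X) v p = v p.snd := by
  simp [app, lunitHom]

theorem app_runitHom (X : FusionObj D) (v : X.ι → ℂ) (p : TensorIdx X (unit D)) :
    app (runitHom X) v p = v p.fst := by
  simp [app, runitHom]

theorem app_lunitInv (X : FusionObj D) (v : TensorIdx (unit D) X → ℂ) (s : X.ι) :
    app (lunitInv X) v s = hat v () s (X.label s) := by
  have h : D.N D.one (X.label s) (X.label s) := (D.one_N _ _).2 rfl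
  have h' : hat v () s (X.label s) = v ⟨(), s, X.label s, h⟩ := dif_pos h
  rw [h']
  unfold app
  rw [Finset.sum_eq_single (⟨(), s, X.label s, h⟩ : TensorIdx (unit D) X)]
  · simp [lunitInv]
  · rintro ⟨⟨⟩, t, k, hk⟩ _ hne
    have : t ≠ s := by
      rintro rfl
      obtain rfl := (D.one_N _ _).1 hk
      exact hne rfl
    simp [lunitInv, this]
  · simp

theorem app_runitInv (X : FusionObj D) (v : TensorIdx X (unit D) → ℂ) (s : X.ι) :
    app (runitInv X) v s = hat v s () (X.label s) := by
  have h : D.N (X.label s) D.one (X.label s) := (D.N_one _ _).2 rfl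
  have h' : hat v s () (X.label s) = v ⟨s, (), X.label s, h⟩ := dif_pos h
  rw [h']
  unfold app
  rw [Finset.sum_eq_single (⟨s, (), X.label s, h⟩ : TensorIdx X (unit D))]
  · simp [runitInv]
  · rintro ⟨t, ⟨⟩, k, hk⟩ _ hne
    have : t ≠ s := by
      rintro rfl
      obtain rfl := (D.N_one _ _).1 hk
      exact hne rfl
    simp [runitInv, this]
  · simp

theorem hatR_eq {X Y Z : FusionObj D} {v : TensorIdx X (tensor Y Z) → ℂ}
    (w : X.ι → Y.ι → Z.ι → I → I → ℂ) (h : ∀ q, v q = w q.fst q.snd.fst q.snd.snd q.snd.out q.out)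
    (s : X.ι) (t : Y.ι) (u : Z.ι) (f d : I) :
    hat (fun y => hat v s y d) t u f =
      if D.N (Y.label t) (Z.label u) f ∧ D.N (X.label s) f d then w s t u f d else 0 := by
  by_cases h1 : D.N (Y.label t) (Z.label u) f
  · by_cases h2 : D.N (X.label s) f d
    · rw [if_pos ⟨h1, h2⟩]
      exact (dif_pos h1).trans ((dif_pos h2).trans (h _))
    · rw [if_neg fun h => h2 h.2]
      exact (dif_pos h1).trans (dif_neg h2)
  · rw [if_neg fun h => h1 h.1]
    exact dif_neg h1

theorem hatL_eq {X Y Z : FusionObj D} {v : TensorIdx (tensor X Y) Z → ℂ}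
    (w : X.ι → Y.ι → Z.ι → I → I → ℂ) (h : ∀ q, v q = w q.fst.fst q.fst.snd q.snd q.fst.out q.out)
    (s : X.ι) (t : Y.ι) (u : Z.ι) (e d : I) :
    hat (fun y => hat v y u d) s t e =
      if D.N (X.label s) (Y.label t) e ∧ D.N e (Z.label u) d then w s t u e d else 0 := by
  by_cases h1 : D.N (X.label s) (Y.label t) e
  · by_cases h2 : D.N e (Z.label u) d
    · rw [if_pos ⟨h1, h2⟩]
      exact (dif_pos h1).trans ((dif_pos h2).trans (h _))
    · rw [if_neg fun h => h2 h.2]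
      exact (dif_pos h1).trans (dif_neg h2)
  · rw [if_neg fun h => h1 h.1]
    exact dif_neg h1

theorem hatR_val {X Y Z : FusionObj D} (v : TensorIdx X (tensor Y Z) → ℂ)
    (q : TensorIdx X (tensor Y Z)) :
    hat (fun y => hat v q.fst y q.out) q.snd.fst q.snd.snd q.snd.out = v q :=
  (hat_val _ q.snd).trans (hat_val v q)

theorem hatL_val {X Y Z : FusionObj D} (v : TensorIdx (tensor X Y) Z → ℂ)
    (q : TensorIdx (tensor X Y) Z) :
    hat (fun y => hat v y q.snd q.out) q.fst.fst q.fst.snd q.fst.out = v q :=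
  (hat_val _ q.fst).trans (hat_val v q)

theorem sum_ite_sum {I : Type} [Fintype I] (c : I → ℂ) (P : I → Prop) [DecidablePred P] (c' : I → I → ℂ) (T : I → ℂ) :
    (∑ f, c f * if P f then ∑ e, c' f e * T e else 0) =
      ∑ e, (∑ f, if P f then c f * c' f e else 0) * T e := by
  simp only [Finset.sum_mul]
  rw [Finset.sum_comm]
  refine Finset.sum_congr rfl fun f _ => ?_
  split_ifs
  · rw [Finset.mul_sum]
    exact Finset.sum_congr rfl fun e _ => (mul_assoc _ _ _).symm
  · simp

theorem assoc_hom_inv (X Y Z : FusionObj D) : assocHom X Y Z ≫ assocInv X Y Z = 𝟙 _ := by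
  refine ext_app fun v p => ?_
  rw [app_comp, app_assocHom, app_id]
  have h := fun f => hatR_eq (v := app (assocInv X Y Z) v)
    (fun s t u f d => ∑ e, D.F' (X.label s) (Y.label t) (Z.label u) d f e *
      hat (fun y => hat v y u d) s t e) (app_assocInv v) p.fst.fst p.fst.snd p.snd f p.out
  simp only [h]
  rw [sum_ite_sum (fun f => D.F _ _ _ _ _ f), Finset.sum_eq_single p.fst.out]
  · rw [D.F_F' _ _ _ _ _ _ p.fst.adm p.adm p.fst.adm p.adm, if_pos rfl, one_mul, hatL_val]
  · intro e _ he
    by_cases h1 : D.N (X.label p.fst.fst) (Y.label p.fst.snd) e ∧ D.N e (Z.label p.snd) p.out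
    · rw [D.F_F' _ _ _ _ _ _ p.fst.adm p.adm h1.1 h1.2, if_neg he.symm, zero_mul]
    · rw [hatL_eq (fun s t u e d => hat (fun y => hat v y u d) s t e)
        (fun q => (hatL_val v q).symm), if_neg h1, mul_zero]
  · simp

theorem assoc_inv_hom (X Y Z : FusionObj D) : assocInv X Y Z ≫ assocHom X Y Z = 𝟙 _ := by
  refine ext_app fun v p => ?_
  rw [app_comp, app_assocInv, app_id]
  have h := fun e => hatL_eq (v := app (assocHom X Y Z) v)
    (fun s t u e d => ∑ f, D.F (X.label s) (Y.label t) (Z.label u) d e f *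
      hat (fun y => hat v s y d) t u f) (app_assocHom v) p.fst p.snd.fst p.snd.snd e p.out
  simp only [h]
  rw [sum_ite_sum (fun e => D.F' _ _ _ _ _ e), Finset.sum_eq_single p.snd.out]
  · rw [D.F'_F _ _ _ _ _ _ p.snd.adm p.adm p.snd.adm p.adm, if_pos rfl, one_mul, hatR_val]
  · intro f _ hf
    by_cases h1 : D.N (Y.label p.snd.fst) (Z.label p.snd.snd) f ∧ D.N (X.label p.fst) f p.out
    · rw [D.F'_F _ _ _ _ _ _ p.snd.adm p.adm h1.1 h1.2, if_neg hf.symm, zero_mul]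
    · rw [hatR_eq (fun s t u f d => hat (fun y => hat v s y d) t u f)
        (fun q => (hatR_val v q).symm), if_neg h1, mul_zero]
  · simp

theorem lunit_hom_inv (X : FusionObj D) : lunitHom X ≫ lunitInv X = 𝟙 _ := by
  refine ext_app fun v p => ?_
  rw [app_comp, app_lunitHom, app_lunitInv, app_id, ← (D.one_N _ _).1 p.adm]
  exact hat_val v p

theorem lunit_inv_hom (X : FusionObj D) : lunitInv X ≫ lunitHom X = 𝟙 _ := by
  refine ext_app fun v s => ?_
  rw [app_comp, app_lunitInv, app_id,
    funext (app_lunitHom X v)]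
  exact dif_pos ((D.one_N _ _).2 rfl)

theorem runit_hom_inv (X : FusionObj D) : runitHom X ≫ runitInv X = 𝟙 _ := by
  refine ext_app fun v p => ?_
  rw [app_comp, app_runitHom, app_runitInv, app_id, ← (D.N_one _ _).1 p.adm]
  exact hat_val v p

theorem runit_inv_hom (X : FusionObj D) : runitInv X ≫ runitHom X = 𝟙 _ := by
  refine ext_app fun v s => ?_
  rw [app_comp, app_runitInv, app_id,
    funext (app_runitHom X v)]
  exact dif_pos ((D.N_one _ _).2 rfl)

theorem tensorMap_id (X Y : FusionObj D) : tensorMap (𝟙 X) (𝟙 Y) = 𝟙 (tensor X Y) := by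
  refine ext_app fun v p => ?_
  rw [app_whiskerRight, app_id, app_id, hat_val]

theorem tensorMap_comp {X₁ Y₁ Z₁ X₂ Y₂ Z₂ : FusionObj D} (f₁ : X₁ ⟶ Y₁) (f₂ : X₂ ⟶ Y₂)
    (g₁ : Y₁ ⟶ Z₁) (g₂ : Y₂ ⟶ Z₂) :
    tensorMap f₁ f₂ ≫ tensorMap g₁ g₂ = tensorMap (f₁ ≫ g₁) (f₂ ≫ g₂) := by
  refine ext_app fun v p => ?_
  rw [app_comp, app_tensorMap, app_tensorMap]
  have h := fun s t => hat_eq_ite (app (tensorMap g₁ g₂) v)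
    (fun s t k => ∑ s', ∑ t', g₁.mat s s' * g₂.mat t t' * hat v s' t' k)
    (fun q => app_tensorMap _ _ _ q) s t p.out
  have h' : ∀ s t, f₁.mat p.fst s * f₂.mat p.snd t * hat (app (tensorMap g₁ g₂) v) s t p.out =
      ∑ s', ∑ t', f₁.mat p.fst s * f₂.mat p.snd t *
        (g₁.mat s s' * g₂.mat t t' * hat v s' t' p.out) := by
    intro s t
    rw [h]
    by_cases h1 : X₁.label p.fst = Y₁.label s
    · by_cases h2 : X₂.label p.snd = Y₂.label t
      · rw [← h1, ← h2, if_pos p.adm]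
        simp only [Finset.mul_sum]
      · simp [f₂.supp _ _ h2]
    · simp [f₁.supp _ _ h1]
  simp only [h', comp_mat]
  have e1 : ∀ (A B A' B' : Type) [Fintype A] [Fintype B] [Fintype A'] [Fintype B']
      (k : A → B → A' → B' → ℂ), ∑ a, ∑ b, ∑ a', ∑ b', k a b a' b' =
        ∑ a', ∑ b', ∑ a, ∑ b, k a b a' b' := by
    intro A B A' B' _ _ _ _ k
    exact (Finset.sum_congr rfl fun a _ => Finset.sum_comm).trans (Finset.sum_comm.trans
      (Finset.sum_congr rfl fun a' _ =>
        (Finset.sum_congr rfl fun a _ => Finset.sum_comm).trans Finset.sum_comm))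
  rw [e1]
  refine Finset.sum_congr rfl fun s' _ => Finset.sum_congr rfl fun t' _ =>
    ?_
  rw [Finset.sum_mul_sum, Finset.sum_mul]
  refine Finset.sum_congr rfl fun s _ => ?_
  rw [Finset.sum_mul]
  exact Finset.sum_congr rfl fun t _ => by ring

theorem triangle_aux (X Y : FusionObj D) :
    assocHom X (unit D) Y ≫ tensorMap (𝟙 X) (lunitHom Y) = tensorMap (runitHom X) (𝟙 Y) := by
  refine ext_app fun v p => ?_
  rw [app_comp, app_assocHom, app_whiskerRight, app_runitHom]
  have h := fun f => hatR_eq (v := app (tensorMap (𝟙 X) (lunitHom Y)) v)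
    (fun s _ u _ d => hat v s u d)
    (fun q => (app_whiskerLeft _ _ _).trans (app_lunitHom _ _ _)) p.fst.fst p.fst.snd p.snd f p.out
  simp only [h]
  have h1 := (D.N_one _ _).1 p.fst.adm
  have h2 := p.adm
  change D.N p.fst.out _ _ at h2
  rw [h1] at h2
  rw [Finset.sum_eq_single (Y.label p.snd)]
  · rw [if_pos ⟨(D.one_N _ _).2 rfl, h2⟩, h1]
    change D.F (X.label p.fst.fst) D.one (Y.label p.snd) p.out (X.label p.fst.fst)
      (Y.label p.snd) * _ = _
    rw [D.triangle _ _ _ h2, one_mul]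
  · intro f _ hf
    rw [if_neg fun h3 => hf ((D.one_N _ _).1 h3.1), mul_zero]
  · simp

theorem hatR_zero {X Y Z : FusionObj D} (v : TensorIdx X (tensor Y Z) → ℂ) (s : X.ι) (t : Y.ι)
    (u : Z.ι) (f d : I) (h : ¬ (D.N (Y.label t) (Z.label u) f ∧ D.N (X.label s) f d)) :
    hat (fun y => hat v s y d) t u f = 0 := by
  rw [hatR_eq (fun s t u f d => hat (fun y => hat v s y d) t u f)
        (fun q => (hatR_val v q).symm), if_neg h]

theorem app_tensorR {X₁ X₂ X₃ Y₁ Y₂ Y₃ : FusionObj D} (f₁ : X₁ ⟶ Y₁) (f₂ : X₂ ⟶ Y₂)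
    (f₃ : X₃ ⟶ Y₃) (v : TensorIdx Y₁ (tensor Y₂ Y₃) → ℂ) (q : TensorIdx X₁ (tensor X₂ X₃)) :
    app (tensorMap f₁ (tensorMap f₂ f₃)) v q = ∑ a, ∑ b, ∑ c,
      f₁.mat q.fst a * f₂.mat q.snd.fst b * f₃.mat q.snd.snd c *
        hat (fun y => hat v a y q.out) b c q.snd.out := by
  rw [app_tensorMap]
  refine Finset.sum_congr rfl fun a _ => ?_
  simp only [mul_assoc, ← Finset.mul_sum]
  refine congrArg _ ?_
  refine (app_tensorMap f₂ f₃ (fun y => hat v a y q.out) q.snd).trans ?_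
  simp only [mul_assoc, ← Finset.mul_sum]

theorem app_tensorL {X₁ X₂ X₃ Y₁ Y₂ Y₃ : FusionObj D} (f₁ : X₁ ⟶ Y₁) (f₂ : X₂ ⟶ Y₂)
    (f₃ : X₃ ⟶ Y₃) (v : TensorIdx (tensor Y₁ Y₂) Y₃ → ℂ) (q : TensorIdx (tensor X₁ X₂) X₃) :
    app (tensorMap (tensorMap f₁ f₂) f₃) v q = ∑ a, ∑ b, ∑ c,
      f₁.mat q.fst.fst a * f₂.mat q.fst.snd b * f₃.mat q.snd c *
        hat (fun y => hat v y c q.out) a b q.fst.out := by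
  rw [app_tensorMap]
  simp only [mul_assoc, ← Finset.mul_sum]
  refine (app_tensorMap f₁ f₂ (fun y => ∑ c, f₃.mat q.snd c * hat v y c q.out) q.fst).trans ?_
  refine Finset.sum_congr rfl fun a _ => ?_
  simp only [mul_assoc, ← Finset.mul_sum]
  refine congrArg _ (Finset.sum_congr rfl fun b _ => congrArg _ ?_)
  exact hat_sum _ _ _ _ _

theorem assoc_naturality {X₁ X₂ X₃ Y₁ Y₂ Y₃ : FusionObj D} (f₁ : X₁ ⟶ Y₁) (f₂ : X₂ ⟶ Y₂)
    (f₃ : X₃ ⟶ Y₃) :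
    tensorMap (tensorMap f₁ f₂) f₃ ≫ assocHom Y₁ Y₂ Y₃ =
      assocHom X₁ X₂ X₃ ≫ tensorMap f₁ (tensorMap f₂ f₃) := by
  refine ext_app fun v p => ?_
  rw [app_comp, app_comp, app_assocHom, app_tensorL]
  have h := fun f => hatR_eq (v := app (tensorMap f₁ (tensorMap f₂ f₃)) v) (fun s t u f d =>
    ∑ a, ∑ b, ∑ c, f₁.mat s a * f₂.mat t b * f₃.mat u c * hat (fun y => hat v a y d) b c f)
    (fun q => app_tensorR _ _ _ _ q) p.fst.fst p.fst.snd p.snd f p.out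
  have h' := fun a b c => hatL_eq (v := app (assocHom Y₁ Y₂ Y₃) v) (fun s t u e d =>
    ∑ f, D.F (Y₁.label s) (Y₂.label t) (Y₃.label u) d e f *
      hat (fun y => hat v s y d) t u f) (app_assocHom v) a b c p.fst.out p.out
  simp only [h, h']
  have key : ∀ a b c, f₁.mat p.fst.fst a * f₂.mat p.fst.snd b * f₃.mat p.snd c = 0 ∨
      (X₁.label p.fst.fst = Y₁.label a ∧ X₂.label p.fst.snd = Y₂.label b ∧
        X₃.label p.snd = Y₃.label c) := fun a b c => by
    by_cases h1 : X₁.label p.fst.fst = Y₁.label a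
    · by_cases h2 : X₂.label p.fst.snd = Y₂.label b
      · by_cases h3 : X₃.label p.snd = Y₃.label c
        · exact Or.inr ⟨h1, h2, h3⟩
        · exact Or.inl (by rw [f₃.supp _ _ h3, mul_zero])
      · exact Or.inl (by rw [f₂.supp _ _ h2, mul_zero, zero_mul])
    · exact Or.inl (by rw [f₁.supp _ _ h1, zero_mul, zero_mul])
  have hR : ∀ f, (D.F (X₁.label p.fst.fst) (X₂.label p.fst.snd) (X₃.label p.snd) p.out
      p.fst.out f * if D.N (X₂.label p.fst.snd) (X₃.label p.snd) f ∧
        D.N (X₁.label p.fst.fst) f p.out then ∑ a, ∑ b, ∑ c, f₁.mat p.fst.fst a *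
          f₂.mat p.fst.snd b * f₃.mat p.snd c * hat (fun y => hat v a y p.out) b c f else 0) =
      ∑ a, ∑ b, ∑ c, D.F (X₁.label p.fst.fst) (X₂.label p.fst.snd) (X₃.label p.snd) p.out
      p.fst.out f * (f₁.mat p.fst.fst a * f₂.mat p.fst.snd b * f₃.mat p.snd c *
        hat (fun y => hat v a y p.out) b c f) := fun f => by
    split_ifs with h1
    · simp only [Finset.mul_sum]
    · rw [mul_zero]
      symm
      refine Finset.sum_eq_zero fun a _ => Finset.sum_eq_zero fun b _ =>
        Finset.sum_eq_zero fun c _ => ?_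
      rcases key a b c with h0 | ⟨e1, e2, e3⟩
      · rw [h0, zero_mul, mul_zero]
      · rw [hatR_zero _ _ _ _ _ _ (by rwa [← e1, ← e2, ← e3]), mul_zero, mul_zero]
  simp only [hR]
  symm
  refine Finset.sum_comm.trans (Finset.sum_congr rfl fun a _ => ?_)
  refine Finset.sum_comm.trans (Finset.sum_congr rfl fun b _ => ?_)
  refine Finset.sum_comm.trans (Finset.sum_congr rfl fun c _ => ?_)
  symm
  rcases key a b c with h0 | ⟨e1, e2, e3⟩
  · simp [h0]
  · rw [← e1, ← e2, ← e3, if_pos ⟨p.fst.adm, p.adm⟩, Finset.mul_sum]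
    exact Finset.sum_congr rfl fun f _ => by ring

theorem pentagon_aux (W X Y Z : FusionObj D) :
    tensorMap (assocHom W X Y) (𝟙 Z) ≫ assocHom W (tensor X Y) Z ≫
      tensorMap (𝟙 W) (assocHom X Y Z) =
    assocHom (tensor W X) Y Z ≫ assocHom W X (tensor Y Z) := by
  refine ext_app fun v p => ?_
  obtain ⟨⟨⟨s, t, e, he⟩, u, f, hf⟩, w, g, hg⟩ := p
  change D.N e (Y.label u) f at hf
  change D.N f (Z.label w) g at hg
  -- the value of `v` at a summand of `W ⊗ (X ⊗ (Y ⊗ Z))`, extended by zero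
  let T : W.ι → X.ι → Y.ι → Z.ι → I → I → I → ℂ := fun s t u w l k g =>
    hat (fun z => hat (fun y => hat v s y g) t z k) u w l
  have hT : ∀ l k, ¬ (D.N (Y.label u) (Z.label w) l ∧ D.N (X.label t) l k ∧ D.N (W.label s) k g) →
      T s t u w l k g = 0 := by
    intro l k h
    by_cases h1 : D.N (Y.label u) (Z.label w) l
    · refine (dif_pos h1).trans ?_
      exact hatR_zero v s t ⟨u, w, l, h1⟩ k g fun h2 => h ⟨h1, h2.1, h2.2⟩
    · exact dif_neg h1
  simp only [app_comp]
  rw [app_whiskerRight, app_assocHom, app_assocHom]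
  dsimp only
  -- right-hand side
  have hr : ∀ l, hat (fun y => hat (app (assocHom W X (tensor Y Z)) v) ⟨s, t, e, he⟩ y g) u w l =
      ∑ k, (if D.N e l g then D.F (W.label s) (X.label t) l g e k else 0) * T s t u w l k g := by
    intro l
    by_cases h1 : D.N (Y.label u) (Z.label w) l
    · refine (dif_pos h1).trans ?_
      by_cases h2 : D.N e l g
      · refine (dif_pos h2).trans ?_
        rw [app_assocHom]
        refine Finset.sum_congr rfl fun k _ => ?_
        rw [if_pos h2]
        refine congrArg _ ?_
        have hz : T s t u w l k g = hat (fun y => hat v s y g) t (⟨u, w, l, h1⟩ : TensorIdx Y Z) k :=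
          dif_pos h1
        exact hz.symm
      · refine (dif_neg h2).trans ?_
        simp [h2]
    · refine (dif_neg h1).trans ?_
      symm
      refine Finset.sum_eq_zero fun k _ => ?_
      rw [hT l k fun h => h1 h.1, mul_zero]
  -- left-hand side
  have h3 : ∀ q : TensorIdx W (tensor (tensor X Y) Z),
      app (tensorMap (𝟙 W) (assocHom X Y Z)) v q = ∑ l,
        D.F (X.label q.snd.fst.fst) (Y.label q.snd.fst.snd) (Z.label q.snd.snd) q.snd.out
          q.snd.fst.out l *
        T q.fst q.snd.fst.fst q.snd.fst.snd q.snd.snd l q.snd.out q.out := by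
    intro q
    rw [app_whiskerLeft, app_assocHom]
  have hl : ∀ h, hat (fun y => hat (fun r => hat (app (assocHom W (tensor X Y) Z)
      (app (tensorMap (𝟙 W) (assocHom X Y Z)) v)) r w g) s y f) t u h =
      if D.N (X.label t) (Y.label u) h ∧ D.N (W.label s) h f then
        ∑ k, D.F (W.label s) h (Z.label w) g f k *
          (if D.N h (Z.label w) k ∧ D.N (W.label s) k g then
            ∑ l, D.F (X.label t) (Y.label u) (Z.label w) k h l * T s t u w l k g else 0)
      else 0 := by
    intro h
    by_cases h1 : D.N (X.label t) (Y.label u) h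
    · by_cases h2 : D.N (W.label s) h f
      · rw [if_pos ⟨h1, h2⟩]
        refine (dif_pos h1).trans ((dif_pos h2).trans ((dif_pos hg).trans ?_))
        rw [app_assocHom]
        refine Finset.sum_congr rfl fun k _ => congrArg _ ?_
        by_cases h4 : D.N h (Z.label w) k
        · by_cases h5 : D.N (W.label s) k g
          · rw [if_pos ⟨h4, h5⟩]
            refine (dif_pos h4).trans ((dif_pos h5).trans ?_)
            rw [h3]
          · rw [if_neg fun h => h5 h.2]
            exact (dif_pos h4).trans (dif_neg h5)
        · rw [if_neg fun h => h4 h.1]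
          exact dif_neg h4
      · rw [if_neg fun h => h2 h.2]
        exact (dif_pos h1).trans (dif_neg h2)
    · rw [if_neg fun h => h1 h.1]
      exact dif_neg h1
  have key : ∀ l k, (∑ h, if D.N (X.label t) (Y.label u) h ∧ D.N (W.label s) h f ∧
      D.N h (Z.label w) k then D.F (W.label s) (X.label t) (Y.label u) f e h *
        D.F (W.label s) h (Z.label w) g f k * D.F (X.label t) (Y.label u) (Z.label w) k h l
      else 0) * T s t u w l k g =
      (D.F e (Y.label u) (Z.label w) g f l *
        if D.N e l g then D.F (W.label s) (X.label t) l g e k else 0) * T s t u w l k g := by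
    intro l k
    by_cases h : D.N (Y.label u) (Z.label w) l ∧ D.N (X.label t) l k ∧ D.N (W.label s) k g
    · rw [D.pentagon _ _ _ _ _ _ _ _ _ he hf hg h.1 h.2.1 h.2.2]
      split_ifs <;> simp
    · rw [hT l k h, mul_zero, mul_zero]
  refine Eq.trans (b := ∑ l, ∑ k, (∑ h, if D.N (X.label t) (Y.label u) h ∧ D.N (W.label s) h f ∧
      D.N h (Z.label w) k then D.F (W.label s) (X.label t) (Y.label u) f e h *
        D.F (W.label s) h (Z.label w) g f k * D.F (X.label t) (Y.label u) (Z.label w) k h l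
      else 0) * T s t u w l k g) ?_ ?_
  · refine Eq.trans (b := ∑ h, ∑ k, ∑ l, (if D.N (X.label t) (Y.label u) h ∧ D.N (W.label s) h f ∧
      D.N h (Z.label w) k then D.F (W.label s) (X.label t) (Y.label u) f e h *
        D.F (W.label s) h (Z.label w) g f k * D.F (X.label t) (Y.label u) (Z.label w) k h l
      else 0) * T s t u w l k g) (Finset.sum_congr rfl fun h _ => ?_) ?_
    · refine (congrArg _ (hl h)).trans ?_
      by_cases h1 : D.N (X.label t) (Y.label u) h ∧ D.N (W.label s) h f
      · rw [if_pos h1, Finset.mul_sum]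
        refine Finset.sum_congr rfl fun k _ => ?_
        by_cases h4 : D.N h (Z.label w) k
        · by_cases h5 : D.N (W.label s) k g
          · simp only [h1.1, h1.2, h4, h5, and_self, if_true, Finset.mul_sum]
            exact Finset.sum_congr rfl fun l _ => by ring
          · rw [if_neg fun h => h5 h.2, mul_zero, mul_zero]
            symm
            refine Finset.sum_eq_zero fun l _ => ?_
            rw [hT l k fun h => h5 h.2.2, mul_zero]
        · simp [h4]
      · rw [if_neg h1, mul_zero]
        symm
        refine Finset.sum_eq_zero fun k _ => Finset.sum_eq_zero fun l _ => ?_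
        rw [if_neg fun h => h1 ⟨h.1, h.2.1⟩, zero_mul]
    · simp only [Finset.sum_mul]
      refine (Finset.sum_congr rfl fun h _ => Finset.sum_comm).trans ?_
      refine Finset.sum_comm.trans (Finset.sum_congr rfl fun l _ => ?_)
      exact Finset.sum_comm
  · refine Finset.sum_congr rfl fun l _ => ?_
    rw [Finset.sum_congr rfl fun k _ => key l k]
    refine Eq.trans ?_ (congrArg _ (hr l)).symm
    rw [Finset.mul_sum]
    exact Finset.sum_congr rfl fun k _ => mul_assoc _ _ _

theorem lunit_naturality {X Y : FusionObj D} (f : X ⟶ Y) :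
    tensorMap (𝟙 (unit D)) f ≫ lunitHom Y = lunitHom X ≫ f := by
  refine ext_app fun v p => ?_
  rw [app_comp, app_comp, app_whiskerLeft, app_lunitHom]
  refine Finset.sum_congr rfl fun t _ => ?_
  by_cases h : X.label p.snd = Y.label t
  · refine congrArg _ ?_
    refine (hat_eq_ite _ (fun _ t _ => v t) (fun p => app_lunitHom Y v p) _ _ _).trans (if_pos ?_)
    rw [← h]
    exact p.adm
  · rw [f.supp _ _ h, zero_mul, zero_mul]

theorem runit_naturality {X Y : FusionObj D} (f : X ⟶ Y) :
    tensorMap f (𝟙 (unit D)) ≫ runitHom Y = runitHom X ≫ f := by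
  refine ext_app fun v p => ?_
  rw [app_comp, app_comp, app_whiskerRight, app_runitHom]
  refine Finset.sum_congr rfl fun t _ => ?_
  by_cases h : X.label p.fst = Y.label t
  · refine congrArg _ ?_
    refine (hat_eq_ite _ (fun t _ _ => v t) (fun p => app_runitHom Y v p) _ _ _).trans (if_pos ?_)
    rw [← h]
    exact p.adm
  · rw [f.supp _ _ h, zero_mul, zero_mul]

end Proofs

/-- The monoidal category with fusion data `D`. -/
instance monoidalCategory (D : FusionData I) : MonoidalCategory (FusionObj D) :=
  letI : MonoidalCategoryStruct (FusionObj D) :=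
    { tensorObj := tensor
      tensorHom := tensorMap
      whiskerLeft := fun X _ _ f => tensorMap (𝟙 X) f
      whiskerRight := fun f Y => tensorMap f (𝟙 Y)
      tensorUnit := unit D
      associator := fun X Y Z =>
        ⟨assocHom X Y Z, assocInv X Y Z, assoc_hom_inv X Y Z, assoc_inv_hom X Y Z⟩
      leftUnitor := fun X => ⟨lunitHom X, lunitInv X, lunit_hom_inv X, lunit_inv_hom X⟩
      rightUnitor := fun X => ⟨runitHom X, runitInv X, runit_hom_inv X, runit_inv_hom X⟩ }
  MonoidalCategory.ofTensorHom
    (id_tensorHom_id := tensorMap_id)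
    (id_tensorHom := fun _ _ _ _ => rfl)
    (tensorHom_id := fun _ _ => rfl)
    (tensorHom_comp_tensorHom := tensorMap_comp)
    (associator_naturality := assoc_naturality)
    (leftUnitor_naturality := lunit_naturality)
    (rightUnitor_naturality := runit_naturality)
    (pentagon := pentagon_aux)
    (triangle := triangle_aux)

end FusionObj

/-! ### Tambara–Yamagami categories -/

/-- A nondegenerate symmetric bicharacter `A × A → ℂˣ` on an abelian group `A`. -/
structure SymmBicharacter (A : Type) [AddCommGroup A] where
  toFun : A → A → ℂ
  zero_left : ∀ b, toFun 0 b = 1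
  add_left : ∀ a a' b, toFun (a + a') b = toFun a b * toFun a' b
  symm : ∀ a b, toFun a b = toFun b a
  nondegenerate : ∀ a, (∀ b, toFun a b = 1) → a = 0

namespace SymmBicharacter

variable {A : Type} [AddCommGroup A] (χ : SymmBicharacter A)

instance : CoeFun (SymmBicharacter A) fun _ => A → A → ℂ := ⟨toFun⟩

theorem zero_right (a : A) : χ a 0 = 1 := by rw [χ.symm, χ.zero_left]

theorem add_right (a b b' : A) : χ a (b + b') = χ a b * χ a b' := by
  rw [χ.symm, χ.add_left, χ.symm b, χ.symm b']

theorem ne_zero (a b : A) : χ a b ≠ 0 := fun h => by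
  have := χ.add_left a (-a) b
  rw [add_neg_cancel, χ.zero_left, h, zero_mul] at this
  exact one_ne_zero this

theorem neg_left (a b : A) : χ (-a) b = (χ a b)⁻¹ := by
  have := χ.add_left a (-a) b
  rw [add_neg_cancel, χ.zero_left] at this
  exact eq_inv_of_mul_eq_one_right this.symm

theorem sub_right (a b b' : A) : χ a (b - b') = χ a b * (χ a b')⁻¹ := by
  rw [sub_eq_add_neg, χ.add_right, χ.symm a (-b'), χ.neg_left, χ.symm b']

variable [Fintype A] [DecidableEq A]

theorem sum_eq (a : A) : ∑ b, χ a b = if a = 0 then (Fintype.card A : ℂ) else 0 := by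
  split_ifs with h
  · simp [h, χ.zero_left]
  · have : ∃ b, χ a b ≠ 1 := by
      by_contra hc
      push Not at hc
      exact h (χ.nondegenerate a hc)
    obtain ⟨c, hc⟩ := this
    have h1 : ∑ b, χ a b = χ a c * ∑ b, χ a b := by
      rw [Finset.mul_sum, ← Equiv.sum_comp (Equiv.addLeft c)]
      exact Finset.sum_congr rfl fun b _ => χ.add_right a c b
    have h2 : (χ a c - 1) * ∑ b, χ a b = 0 := by linear_combination -h1
    exact (mul_eq_zero.1 h2).resolve_left (sub_ne_zero.2 hc)

end SymmBicharacter

namespace TambaraYamagami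

variable {A : Type} [AddCommGroup A] [Fintype A] [DecidableEq A]

/-- The Tambara–Yamagami fusion rules on `A ⊔ {σ}` (`some a` is the invertible object `a`, and `none`
is `σ`): `a ⊗ b = a + b`, `a ⊗ σ = σ = σ ⊗ a`, and `σ ⊗ σ = ⨁ a : A, a`. -/
def N : Option A → Option A → Option A → Prop
  | some a, some b, some c => c = a + b
  | some _, none, none => True
  | none, some _, none => True
  | none, none, some _ => True
  | _, _, _ => False

instance (a b c : Option A) : Decidable (N a b c) := by
  unfold N
  split <;> infer_instance

/-- The number `τ = ν / √|A|`. -/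
noncomputable def tau (A : Type) [Fintype A] (ν : ℤˣ) : ℂ :=
  ((ν : ℤ) : ℂ) / (Real.sqrt (Fintype.card A) : ℂ)

/-- The F-symbols of the Tambara–Yamagami category: those of `(a, σ, b)` and of
`(σ, a, σ)` with output `b` are `χ(a, b)`, those of `(σ, σ, σ)` are `τ χ(a, b)⁻¹`, and all others
are `1`. -/
noncomputable def F (χ : SymmBicharacter A) (ν : ℤˣ) :
    Option A → Option A → Option A → Option A → Option A → Option A → ℂ
  | some a, none, some b, _, _, _ => χ a b
  | none, some a, none, some b, _, _ => χ a b
  | none, none, none, _, some a, some b => tau A ν * (χ a b)⁻¹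
  | _, _, _, _, _, _ => 1

/-- The inverses of the F-symbols. -/
noncomputable def F' (χ : SymmBicharacter A) (ν : ℤˣ) :
    Option A → Option A → Option A → Option A → Option A → Option A → ℂ
  | some a, none, some b, _, _, _ => (χ a b)⁻¹
  | none, some a, none, some b, _, _ => (χ a b)⁻¹
  | none, none, none, _, some a, some b => tau A ν * χ a b
  | _, _, _, _, _, _ => 1

theorem tau_mul_tau (A : Type) [Fintype A] [Nonempty A] (ν : ℤˣ) :
    tau A ν * tau A ν * Fintype.card A = 1 := by
  have h1 : ((ν : ℤ) : ℂ) * ((ν : ℤ) : ℂ) = 1 := by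
    rcases Int.units_eq_one_or ν with rfl | rfl <;> simp
  have h2 : (Real.sqrt (Fintype.card A) : ℂ) * (Real.sqrt (Fintype.card A) : ℂ) =
      Fintype.card A := by
    rw [← Complex.ofReal_mul, Real.mul_self_sqrt (Nat.cast_nonneg _), Complex.ofReal_natCast]
  have h3 : (Fintype.card A : ℂ) ≠ 0 := Nat.cast_ne_zero.2 Fintype.card_ne_zero
  unfold tau
  rw [div_mul_div_comm, h1, h2, one_div, inv_mul_cancel₀ h3]

theorem orth (χ : SymmBicharacter A) (ν : ℤˣ) (a : A) :
    ∑ b, tau A ν * tau A ν * χ b a = if a = 0 then 1 else 0 := by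
  rw [← Finset.mul_sum, Finset.sum_congr rfl fun b _ => χ.symm b a, χ.sum_eq]
  split_ifs
  · exact tau_mul_tau A ν
  · rw [mul_zero]

theorem card_one {A : Type} [Fintype A] [DecidableEq A] {p : A → Prop} [DecidablePred p] (a : A) (h : ∀ x, p x ↔ x = a) :
    (Finset.univ.filter p).card = 1 :=
  Finset.card_eq_one.2 ⟨a, Finset.ext fun x => by simp [h]⟩

theorem F_F' (χ : SymmBicharacter A) (ν : ℤˣ) (a b c d e e' : Option A) (h1 : N a b e)
    (h2 : N e c d) (h3 : N a b e') (h4 : N e' c d) :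
    (∑ f, if N b c f ∧ N a f d then F χ ν a b c d e f * F' χ ν a b c d f e' else 0) =
      if e = e' then 1 else 0 := by
  have ho := orth χ ν
  have hne := χ.ne_zero
  rcases a with _ | a <;> rcases b with _ | b <;> rcases c with _ | c <;>
  rcases d with _ | d <;> rcases e with _ | e <;> rcases e' with _ | e' <;>
  simp only [N] at h1 h2 h3 h4 <;>
  simp [N, F, F', Fintype.sum_option, *]
  · rw [Finset.sum_congr rfl fun x _ => show _ = tau A ν * tau A ν * χ x (e' - e) by
      rw [χ.sub_right, χ.symm e x]; ring, ho]
    simp only [sub_eq_zero, eq_comm]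
  · exact add_right_cancel (h2.symm.trans h4)
  · exact card_one (d - a) fun x => ⟨fun h => by rw [h]; abel, fun h => by rw [h]; abel⟩
  · exact card_one (b + c) fun x => ⟨fun h => h.1, fun h => ⟨h, by rw [h]; abel⟩⟩

theorem F'_F (χ : SymmBicharacter A) (ν : ℤˣ) (a b c d f f' : Option A) (h1 : N b c f)
    (h2 : N a f d) (h3 : N b c f') (h4 : N a f' d) :
    (∑ e, if N a b e ∧ N e c d then F' χ ν a b c d f e * F χ ν a b c d e f' else 0) =
      if f = f' then 1 else 0 := by
  have ho := orth χ ν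
  have hne := χ.ne_zero
  rcases a with _ | a <;> rcases b with _ | b <;> rcases c with _ | c <;>
  rcases d with _ | d <;> rcases f with _ | f <;> rcases f' with _ | f' <;>
  simp only [N] at h1 h2 h3 h4 <;>
  simp [N, F, F', Fintype.sum_option, *]
  · rw [Finset.sum_congr rfl fun x _ => show _ = tau A ν * tau A ν * χ x (f - f') by
      rw [χ.sub_right, χ.symm f x]; ring, ho]
    simp only [sub_eq_zero]
  · exact card_one (d - c) fun x => ⟨fun h => by rw [h]; abel, fun h => by rw [h]; abel⟩
  · exact add_left_cancel (h2.symm.trans h4)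
  · exact card_one (a + b) fun x => ⟨fun h => h.1, fun h => ⟨h, by rw [h]; abel⟩⟩

theorem pentagon (χ : SymmBicharacter A) (ν : ℤˣ) (a b c d e f g k l : Option A) (h1 : N a b e)
    (h2 : N e c f) (h3 : N f d g) (h4 : N c d l) (h5 : N b l k) (h6 : N a k g) :
    (∑ h, if N b c h ∧ N a h f ∧ N h d k then
      F χ ν a b c f e h * F χ ν a h d g f k * F χ ν b c d k h l else 0) =
      if N e l g then F χ ν e c d g f l * F χ ν a b l g e k else 0 := by
  have ho := orth χ ν
  have hne := χ.ne_zero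
  rcases a with _ | a <;> rcases b with _ | b <;> rcases e with _ | e <;>
  simp only [N] at h1 <;>
  rcases c with _ | c <;> rcases f with _ | f <;> simp only [N] at h2 <;>
  rcases d with _ | d <;> rcases g with _ | g <;> simp only [N] at h3 <;>
  rcases l with _ | l <;> simp only [N] at h4 <;>
  rcases k with _ | k <;> simp only [N] at h5 h6 <;>
  simp [N, F, Fintype.sum_option, *]
  · rw [Finset.sum_congr rfl fun x _ => show _ = tau A ν * tau A ν * χ x (g - (e + l)) by
      rw [χ.sub_right, χ.add_right, χ.symm e x, mul_inv]; ring, ho]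
    simp only [sub_eq_zero]
  · rw [Finset.sum_eq_single (k - d) (fun x _ hx => if_neg fun h => hx (by rw [h]; abel))
      (by simp), if_pos (by abel), χ.sub_right, mul_inv, inv_inv]
    ring
  · rw [χ.add_left, mul_inv]
    field_simp [hne c k]
  · abel
  · rw [χ.add_right, χ.symm f b, mul_inv]
    field_simp [hne b f]
  · rw [χ.add_right]
  · rw [χ.add_left, mul_comm]
  · exact card_one (b + c) fun x => ⟨fun h => h.1, fun h => ⟨h, by rw [h]; abel⟩⟩
  · rw [Finset.sum_eq_single (f - a) (fun x _ hx => if_neg fun h => hx (by rw [h]; abel))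
      (by simp), if_pos (by abel), χ.symm, χ.sub_right, mul_inv, inv_inv, χ.symm l, χ.symm l]
    ring
  · refine card_one (f - a) fun x => ⟨fun h => by rw [h.1]; abel, fun h => ⟨by rw [h]; abel, ?_⟩⟩
    rw [h3] at h6
    rw [h, ← sub_eq_zero, ← sub_eq_zero.2 h6.symm]
    abel
  · rw [χ.add_right, χ.symm a c]
  · rw [χ.add_right]
  · abel
  · rw [χ.add_left]
  · exact card_one (b + c) fun x => ⟨fun h => h.1, fun h => ⟨h, by rw [h]; abel⟩⟩
  · rw [if_pos (by abel), card_one (b + c) fun x =>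
      ⟨fun h => h.1, fun h => ⟨h, by rw [h]; abel, by rw [h]; abel⟩⟩, Nat.cast_one]

end TambaraYamagami

/-- The fusion rules and F-symbols of the Tambara–Yamagami category of `(A, χ, ν)`, with unit object
`0 : A`. -/
noncomputable def tyData {A : Type} [AddCommGroup A] [Fintype A] [DecidableEq A]
    (χ : SymmBicharacter A) (ν : ℤˣ) : FusionData (Option A) where
  one := some 0
  N := TambaraYamagami.N
  one_N a c := by rcases a with _ | a <;> rcases c with _ | c <;> simp [TambaraYamagami.N]
  N_one a c := by rcases a with _ | a <;> rcases c with _ | c <;> simp [TambaraYamagami.N]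
  F := TambaraYamagami.F χ ν
  F' := TambaraYamagami.F' χ ν
  F_F' := TambaraYamagami.F_F' χ ν
  F'_F := TambaraYamagami.F'_F χ ν
  triangle a b c h := by
    rcases a with _ | a <;> rcases b with _ | b <;> rcases c with _ | c <;>
    simp [TambaraYamagami.F, χ.zero_left]
  pentagon := TambaraYamagami.pentagon χ ν

/-- The Tambara–Yamagami category `TY(A, χ, ν)`. -/
abbrev TY {A : Type} [AddCommGroup A] [Fintype A] [DecidableEq A]
    (χ : SymmBicharacter A) (ν : ℤˣ) : Type 1 :=
  FusionObj (tyData χ ν)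

/-! ### The group `ℤ/3 × S₃`, its module category `Q₈`, and the bicharacter -/

namespace GrVect

/-- The action of `Vec(G)` on `X`-graded vector spaces is bilinear. -/
instance isBilinearAction (G : Type) [Group G] [Finite G] (X : Type) [Finite X]
    [MulAction G X] : IsBilinearAction (GrVect G) (GrVect X) where
  add_actionHomLeft f g _ := hom_ext (TensorProduct.map_add_left f.lin g.lin LinearMap.id)
  smul_actionHomLeft r f _ := hom_ext (TensorProduct.map_smul_left r f.lin LinearMap.id)
  actionHomRight_add _ _ _ f g := hom_ext (TensorProduct.map_add_right LinearMap.id f.lin g.lin)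
  actionHomRight_smul _ _ _ r f := hom_ext (TensorProduct.map_smul_right r LinearMap.id f.lin)

end GrVect

/-- The group `ℤ/3 × S₃`. -/
abbrev Z3S3 : Type := Multiplicative (ZMod 3) × Equiv.Perm (Fin 3)

/-- The subgroup of order `3` generated by `(1, r)`, where `r` is a `3`-cycle. -/
abbrev diagonalZ3 : Subgroup Z3S3 :=
  Subgroup.zpowers (Multiplicative.ofAdd 1, finRotate 3)

/-- The `Vec(ℤ/3 × S₃)`-module category `Q₈`, associated to the subgroup generated by `(1, r)` with
trivial cocycle: the category of vector spaces graded by the cosets of this subgroup. -/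
abbrev Q8 : Type 1 := GrVect (Z3S3 ⧸ diagonalZ3)

/-- The root of unity `ω = exp(2πi/3)`. -/
noncomputable def omega : ℂ := Complex.exp (2 * Real.pi * Complex.I / 3)

theorem omega_isPrimitiveRoot : IsPrimitiveRoot omega 3 :=
  Complex.isPrimitiveRoot_exp 3 (by norm_num)

theorem omega_pow_val_add (a b : ZMod 3) :
    omega ^ (a + b).val = omega ^ a.val * omega ^ b.val := by
  rw [ZMod.val_add, ← pow_add, ← pow_mod_orderOf _ (a.val + b.val),
    ← omega_isPrimitiveRoot.eq_orderOf]

/-- The symmetric bicharacter `χ((g₀, h₀), (g₁, h₁)) = ω ^ (g₀ h₁ + h₀ g₁)` on `ℤ/3 × ℤ/3`. -/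
noncomputable def hyperbolicChar : SymmBicharacter (ZMod 3 × ZMod 3) where
  toFun p q := omega ^ (p.1 * q.2 + p.2 * q.1).val
  zero_left b := by simp
  add_left a a' b := by
    rw [← omega_pow_val_add]
    congr 2
    simp only [Prod.fst_add, Prod.snd_add]
    ring
  symm a b := by
    congr 2
    ring
  nondegenerate a h := by
    have key : ∀ c : ZMod 3, omega ^ c.val = 1 → c = 0 := fun c hc => by
      have h3 := (omega_isPrimitiveRoot.pow_eq_one_iff_dvd _).1 hc
      exact (ZMod.val_eq_zero c).1 (Nat.eq_zero_of_dvd_of_lt h3 (ZMod.val_lt c))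
    refine Prod.ext (key _ ?_) (key _ ?_)
    · simpa using h (0, 1)
    · simpa using h (1, 0)

/-!
The `Vec(G)`-module endofunctors of the category of `X`-graded vector spaces, for a finite
transitive `G`-set `X`, are given by equivariant kernels. The permutation module `ℂ[X]`
(`GrVect.reg`) carries translations `g ⊗ ℂ[X] ⟶ ℂ[X]`, and every simple object is a summand of it,
so that an endofunctor `F` is determined by the space `F(ℂ[X])`, which is graded by pairs `(x, y)`
of points of `X` and on which `G` acts. A simple endofunctor thus corresponds to an orbit of `G` on
`X × X` together with an irreducible representation of the stabilizer of a pair. For `Q₈` the set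
`X = G/H` has six points, the stabilizers of pairs are abelian, and the representations in question
are restrictions of characters of `G`.

This makes it possible to write down the equivalence in coordinates. A `KernelData` consists, for
each simple object `i` of a category with given fusion rules and F-symbols, of the relation `adm i`
which is the orbit of `i`, of a character `char i` of `G`, and of numbers `T` by which the kernels
are composed. The equations on `T` say that it is equivariant (`T_smul`), invertible (`T'_T`,
`T_T'`), normalized, and compatible with the F-symbols (`T_assoc`), and they amount to the
statement that the resulting functor `KernelData.toModEnd` to the module endofunctors is monoidal
(`KernelData.monoidal`).

The functor is an equivalence (`KernelData.isEquivalence`) when the pairs of orbits and characters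
are a complete list (`KernelData.IsComplete`). A section of `F` of type `i` is an equivariant
family of elements of `F(ℂ[X])`, on the pairs in the orbit of `i`, on which `G` acts by `char i`.
The functor is essentially surjective because every element of `F(ℂ[X])` is a sum of values of
sections: they are obtained by averaging over `G`, weighted by the inverse of `char i`, and by
`sum_char` only the neutral element contributes to the sum of the averages of all types. It is full
and faithful because a natural transformation is determined by its values on such sections, where
equivariance along an orbit and the separation of characters leave one number for each pair of
equal simple summands.

For `Q₈`, a coset has the coordinates `sgn = ± 1` and `pos ∈ ℤ/3`. The object `(n, k)` of the
Tambara–Yamagami category corresponds to the pairs with equal `sgn` whose `pos` differ by `n`, and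
to the character `ω ^ (-k w)` of the factor `ℤ/3`; the object `σ` corresponds to the pairs with
opposite `sgn`. The structure constants are the powers of `ω` in `Z3S3.mulExp`; for `σ ⊗ σ ⊗ σ` the
compatibility with the F-symbols is the Fourier transform on `ℤ/3`.

Finite semisimplicity of all categories involved comes from a family of simple objects of which all
objects are direct sums (`IsSimpleBasis.isFiniteSemisimple`), and duals are written down
explicitly.
-/

/-! ### A criterion for semisimplicity -/

/-- A family of objects `S i` such that `Hom(S i, S j)` is `ℂ` for `i = j` and zero
otherwise, such that every finite family of them has a direct sum and every object is such a direct
sum. -/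
structure IsSimpleBasis {C : Type*} [Category* C] [Preadditive C] [Linear ℂ C] {I : Type}
    (S : I → C) : Prop where
  id_ne_zero : ∀ i, 𝟙 (S i) ≠ 0
  schur : ∀ i (f : S i ⟶ S i), ∃ c : ℂ, f = c • 𝟙 (S i)
  orthogonal : ∀ i j (f : S i ⟶ S j), i ≠ j → f = 0
  hasSum : ∀ {J : Type} [Finite J] (k : J → I),
    ∃ b : Limits.Bicone (fun j => S (k j)), Nonempty b.IsBilimit
  isSum : ∀ X : C, ∃ (J : Type) (_ : Finite J) (k : J → I) (b : Limits.Bicone fun j => S (k j)),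
    Nonempty b.IsBilimit ∧ Nonempty (X ≅ b.pt)

namespace IsSimpleBasis

variable {C : Type*} [Category.{0} C] [Preadditive C] [Linear ℂ C] {I : Type} {S : I → C}

section

variable (h : IsSimpleBasis S)
include h

theorem exists_decomposition (X : C) : ∃ (J : Type) (_ : Fintype J) (k : J → I)
    (ι : ∀ j, S (k j) ⟶ X) (π : ∀ j, X ⟶ S (k j)), (∀ j, ι j ≫ π j = 𝟙 _) ∧
      (∀ j j', j ≠ j' → ι j ≫ π j' = 0) ∧ ∑ j, π j ≫ ι j = 𝟙 X := by
  obtain ⟨J, _, k, b, ⟨hb⟩, ⟨e⟩⟩ := h.isSum X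
  have := Fintype.ofFinite J
  refine ⟨J, inferInstance, k, fun j => b.ι j ≫ e.inv, fun j => e.hom ≫ b.π j, by simp,
    fun j j' hj => by simp [Limits.bicone_ι_π_ne b hj], ?_⟩
  have := Limits.IsBilimit.total hb
  calc ∑ j, (e.hom ≫ b.π j) ≫ b.ι j ≫ e.inv = e.hom ≫ (∑ j, b.π j ≫ b.ι j) ≫ e.inv := by
        simp [Preadditive.comp_sum, Preadditive.sum_comp]
    _ = 𝟙 X := by simp [this]

theorem simple (i : I) : Simple (S i) where
  mono_isIso_iff_nonzero {Y} f _ := by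
    constructor
    · rintro _ rfl
      exact h.id_ne_zero i (by rw [← IsIso.inv_hom_id (0 : Y ⟶ S i), Limits.comp_zero])
    · intro hf
      obtain ⟨J, _, k, ι, π, -, -, htot⟩ := h.exists_decomposition Y
      have : ∃ j, ι j ≫ f ≠ 0 := by
        by_contra hc
        push Not at hc
        refine hf ?_
        rw [← Category.id_comp f, ← htot, Preadditive.sum_comp]
        exact Finset.sum_eq_zero fun j _ => by rw [Category.assoc, hc, Limits.comp_zero]
      obtain ⟨j, hj⟩ := this
      have hk : k j = i := by
        by_contra hk
        exact hj (h.orthogonal _ _ _ hk)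
      subst hk
      obtain ⟨c, hc⟩ := h.schur _ (ι j ≫ f)
      have hc0 : c ≠ 0 := by
        rintro rfl
        exact hj (by rw [hc, zero_smul])
      have hs : (c⁻¹ • ι j) ≫ f = 𝟙 _ := by
        rw [Linear.smul_comp, hc, smul_smul, inv_mul_cancel₀ hc0, one_smul]
      have : IsSplitEpi f := ⟨⟨⟨_, hs⟩⟩⟩
      exact isIso_of_mono_of_isSplitEpi f

theorem exists_iso_of_simple (X : C) (hX : Simple X) : ∃ i, Nonempty (X ≅ S i) := by
  obtain ⟨J, _, k, ι, π, h1, -, htot⟩ := h.exists_decomposition X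
  have : Nonempty J := by
    by_contra hJ
    rw [not_nonempty_iff] at hJ
    rw [Finset.univ_eq_empty, Finset.sum_empty] at htot
    exact id_nonzero X htot.symm
  obtain ⟨j⟩ := this
  have : Mono (ι j) := (SplitMono.mk (π j) (h1 j)).mono
  have hne : ι j ≠ 0 := fun h0 => h.id_ne_zero (k j) (by rw [← h1 j, h0, Limits.zero_comp])
  have := isIso_of_mono_of_nonzero hne
  exact ⟨k j, ⟨(asIso (ι j)).symm⟩⟩

theorem finite_hom_simple (i j : I) : Module.Finite ℂ (S i ⟶ S j) := by
  by_cases hij : i = j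
  · subst hij
    refine Module.Finite.of_surjective (LinearMap.toSpanSingleton ℂ _ (𝟙 (S i))) fun f => ?_
    obtain ⟨c, hc⟩ := h.schur i f
    exact ⟨c, by rw [hc, LinearMap.toSpanSingleton_apply]⟩
  · have : Subsingleton (S i ⟶ S j) :=
      ⟨fun f g => by rw [h.orthogonal i j f hij, h.orthogonal i j g hij]⟩
    infer_instance

theorem finite_hom (X Y : C) : Module.Finite ℂ (X ⟶ Y) := by
  obtain ⟨J, _, k, ι, π, -, -, htot⟩ := h.exists_decomposition X
  obtain ⟨J', _, k', ι', π', -, -, htot'⟩ := h.exists_decomposition Y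
  have := fun i j => h.finite_hom_simple i j
  let L : (X ⟶ Y) →ₗ[ℂ] (∀ j j', S (k j) ⟶ S (k' j')) :=
    LinearMap.pi fun j => LinearMap.pi fun j' =>
      (Linear.rightComp ℂ _ (π' j')).comp (Linear.leftComp ℂ _ (ι j))
  refine Module.Finite.of_injective L fun f g hfg => ?_
  have hfg' : ∀ j j', (ι j ≫ f) ≫ π' j' = (ι j ≫ g) ≫ π' j' := fun j j' =>
    congrFun (congrFun hfg j) j'
  have key : ∀ f : X ⟶ Y, f = ∑ j, ∑ j', π j ≫ ((ι j ≫ f) ≫ π' j') ≫ ι' j' := fun f => by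
    calc f = (∑ j, π j ≫ ι j) ≫ f ≫ (∑ j', π' j' ≫ ι' j') := by simp [htot, htot']
      _ = _ := by
        simp only [Preadditive.sum_comp, Preadditive.comp_sum, Category.assoc]
        exact Finset.sum_comm
  rw [key f, key g]
  simp only [hfg']

end

/-- The functor `X ↦ (Hom(S i, X))_i` of multiplicity spaces. -/
noncomputable def multiplicity (h : IsSimpleBasis S) : C ⥤ (Discrete I ⥤ FGModuleCat.{0} ℂ) :=
  haveI := h.finite_hom
  { obj := fun X => Discrete.functor fun i => FGModuleCat.of ℂ (S i ⟶ X)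
    map := fun f => Discrete.natTrans fun i => FGModuleCat.ofHom (Linear.rightComp ℂ (S i.as) f)
    map_id := fun X => by
      ext i g
      exact Category.comp_id _
    map_comp := fun f g => by
      ext i t
      exact (Category.assoc _ _ _).symm }

/-- The morphism with given effect on all morphisms from the `S i`. -/
theorem exists_hom (h : IsSimpleBasis S) {X Y : C} (φ : ∀ i, (S i ⟶ X) →ₗ[ℂ] (S i ⟶ Y)) :
    ∃ f : X ⟶ Y, ∀ i (s : S i ⟶ X), s ≫ f = φ i s := by
  obtain ⟨J, _, k, ι, π, -, -, htot⟩ := h.exists_decomposition X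
  refine ⟨∑ j, π j ≫ φ (k j) (ι j), fun i s => ?_⟩
  have hs : s = ∑ j, (s ≫ π j) ≫ ι j := by
    simp only [Category.assoc, ← Preadditive.comp_sum, htot, Category.comp_id]
  conv_rhs => rw [hs, map_sum]
  rw [Preadditive.comp_sum]
  refine Finset.sum_congr rfl fun j _ => ?_
  rw [← Category.assoc]
  generalize s ≫ π j = t
  by_cases hij : i = k j
  · subst hij
    obtain ⟨c, rfl⟩ := h.schur _ t
    simp
  · rw [h.orthogonal _ _ t hij]
    simp

theorem hom_ext (h : IsSimpleBasis S) {X Y : C} {f g : X ⟶ Y}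
    (hfg : ∀ i (s : S i ⟶ X), s ≫ f = s ≫ g) : f = g := by
  obtain ⟨J, _, k, ι, π, -, -, htot⟩ := h.exists_decomposition X
  rw [← Category.id_comp f, ← Category.id_comp g, ← htot]
  simp only [Preadditive.sum_comp, Category.assoc, hfg]

/-- The multiplicity spaces determine objects and morphisms, and all finite-dimensional multiplicity
spaces occur. -/
theorem multiplicity_isEquivalence [Finite I] (h : IsSimpleBasis S) :
    h.multiplicity.IsEquivalence := by
  have := Fintype.ofFinite I
  have hfin := h.finite_hom
  have : h.multiplicity.Faithful := ⟨fun {X Y f g} hfg => h.hom_ext fun i s => by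
    have := congrArg (fun t => (t.app ⟨i⟩).hom.hom s) hfg
    exact this⟩
  have : h.multiplicity.Full := ⟨fun {X Y} t => by
    obtain ⟨f, hf⟩ := h.exists_hom (X := X) (Y := Y) fun i => (t.app ⟨i⟩).hom.hom
    refine ⟨f, ?_⟩
    ext i s
    exact hf i.as s⟩
  have : h.multiplicity.EssSurj := ⟨fun V => by
    obtain ⟨b, ⟨hb⟩⟩ := h.hasSum (J := Σ i, Fin (Module.finrank ℂ (V.obj ⟨i⟩))) Sigma.fst
    have key : ∀ i, Nonempty (V.obj ⟨i⟩ ≃ₗ[ℂ] (S i ⟶ b.pt)) := fun i => by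
      let B := Module.finBasis ℂ (V.obj ⟨i⟩)
      let L : V.obj ⟨i⟩ →ₗ[ℂ] (S i ⟶ b.pt) := B.constr ℂ fun r => b.ι ⟨i, r⟩
      have hL : ∀ v, L v = ∑ r, B.repr v r • b.ι ⟨i, r⟩ := fun v => by
        simp [L, Module.Basis.constr_apply_fintype, Module.Basis.equivFun_apply]
      refine ⟨LinearEquiv.ofBijective L ⟨?_, fun f => ?_⟩⟩
      · refine (injective_iff_map_eq_zero L).2 fun v hv => B.repr.map_eq_zero_iff.1 ?_
        ext r
        have h1 : L v ≫ b.π ⟨i, r⟩ = B.repr v r • 𝟙 (S i) := by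
          rw [hL, Preadditive.sum_comp, Finset.sum_eq_single r]
          · rw [Linear.smul_comp, Limits.bicone_ι_π_self]
          · intro r' _ hr
            rw [Linear.smul_comp, Limits.bicone_ι_π_ne, smul_zero]
            simpa using hr
          · simp
        rw [hv, Limits.zero_comp] at h1
        exact (smul_eq_zero.1 h1.symm).resolve_right (h.id_ne_zero i)
      · have h1 : f = ∑ j, (f ≫ b.π j) ≫ b.ι j := by
          simp only [Category.assoc, ← Preadditive.comp_sum, Limits.IsBilimit.total hb,
            Category.comp_id]
        rw [← LinearMap.mem_range, h1]
        refine Submodule.sum_mem _ fun j _ => ?_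
        generalize f ≫ b.π j = t
        obtain ⟨i', r⟩ := j
        by_cases hi : i = i'
        · subst hi
          obtain ⟨c, rfl⟩ := h.schur _ t
          refine ⟨c • B r, ?_⟩
          simp [L]
        · rw [h.orthogonal _ _ t hi, Limits.zero_comp]
          exact zero_mem _
    refine ⟨b.pt, ⟨Discrete.natIso fun i => ?_⟩⟩
    exact LinearEquiv.toFGModuleCatIso (key i.as).some.symm⟩
  exact { }

/-- The category is abelian because it is equivalent to a category of families of vector spaces, and
its simple objects are the `S i` up to isomorphism. -/
theorem isFiniteSemisimple [Finite I] (h : IsSimpleBasis S) : IsFiniteSemisimple C := by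
  have := h.multiplicity_isEquivalence
  have : Limits.HasFiniteProducts C :=
    ⟨fun n => Adjunction.hasLimitsOfShape_of_equivalence h.multiplicity⟩
  let : Abelian C := abelianOfEquivalence h.multiplicity
  refine ⟨Limits.HasFiniteBiproducts.of_hasFiniteProducts, inferInstance, inferInstance,
    inferInstance, inferInstance, h.finite_hom, fun X => ?_, ?_⟩
  · obtain ⟨J, _, k, b, ⟨hb⟩, e⟩ := h.isSum X
    obtain ⟨n, ⟨r⟩⟩ := Finite.exists_equiv_fin J
    exact ⟨n, fun j => S (k (r.symm j)), b.whisker r.symm, fun _ => h.simple _,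
      ⟨(b.whiskerIsBilimitIff r.symm).symm hb⟩, e⟩
  · obtain ⟨n, ⟨r⟩⟩ := Finite.exists_equiv_fin I
    refine ⟨n, fun j => S (r.symm j), fun X hX => ?_⟩
    obtain ⟨i, hi⟩ := h.exists_iso_of_simple X hX
    exact ⟨r i, by simpa using hi⟩

end IsSimpleBasis

/-! ### Homogeneous components of graded vector spaces -/

namespace GrVect

section Proj

variable {X : Type} (V W : GrVect X)

/-- The projection of a graded vector space onto its homogeneous component of degree `x`. -/
noncomputable def proj (x : X) : V →ₗ[ℂ] V := V.exists_proj.choose x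

variable {V W}

theorem proj_of_mem {x : X} {v : V} (hv : v ∈ V.gr x) : V.proj x v = v :=
  V.exists_proj.choose_spec.1 x v hv

theorem proj_of_mem_ne {x y : X} (h : x ≠ y) {v : V} (hv : v ∈ V.gr y) : V.proj x v = 0 :=
  V.exists_proj.choose_spec.2 x y h v hv

/-- A property of vectors which is stable under addition may be checked on homogeneous vectors. -/
theorem induction_homogeneous {p : V → Prop} (v : V) (hz : p 0)
    (hadd : ∀ v w, p v → p w → p (v + w))
    (hmem : ∀ x, ∀ v ∈ V.gr x, p v) : p v := by
  have hv : v ∈ iSup V.gr := V.iSup_eq ▸ Submodule.mem_top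
  induction hv using Submodule.iSup_induction' with
  | mem x v hv => exact hmem x v hv
  | zero => exact hz
  | add v w _ _ h h' => exact hadd v w h h'

theorem proj_mem (x : X) (v : V) : V.proj x v ∈ V.gr x := by
  induction v using induction_homogeneous with
  | hz => simp
  | hadd v w hv hw => rw [map_add]; exact add_mem hv hw
  | hmem y v hv =>
    by_cases h : x = y
    · subst h; rwa [proj_of_mem hv]
    · rw [proj_of_mem_ne h hv]; exact zero_mem _

theorem sum_proj [Fintype X] (v : V) : ∑ x, V.proj x v = v := by
  induction v using induction_homogeneous with
  | hz => simp
  | hadd v w hv hw => simp only [map_add, Finset.sum_add_distrib, hv, hw]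
  | hmem y v hv =>
    rw [Finset.sum_eq_single y (fun x _ h => proj_of_mem_ne h hv) (by simp), proj_of_mem hv]

theorem lin_proj (f : V ⟶ W) (x : X) (v : V) : f.lin (V.proj x v) = W.proj x (f.lin v) := by
  induction v using induction_homogeneous with
  | hz => simp
  | hadd v w hv hw => simp only [map_add, hv, hw]
  | hmem y v hv =>
    by_cases h : x = y
    · subst h; rw [proj_of_mem hv, proj_of_mem (f.map_gr _ _ hv)]
    · rw [proj_of_mem_ne h hv, proj_of_mem_ne h (f.map_gr _ _ hv), map_zero]

theorem linearMap_ext_homogeneous {E : Type*} [AddCommMonoid E] [Module ℂ E] {f g : V →ₗ[ℂ] E}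
    (h : ∀ x, ∀ v ∈ V.gr x, f v = g v) : f = g := by
  ext v
  induction v using induction_homogeneous with
  | hz => simp
  | hadd v w hv hw => simp only [map_add, hv, hw]
  | hmem y v hv => exact h y v hv

/-- A bijective morphism of graded vector spaces is an isomorphism. -/
theorem isIso_of_bijective (f : V ⟶ W) (hf : Function.Bijective f.lin) : IsIso f := by
  let e := LinearEquiv.ofBijective f.lin hf
  refine ⟨⟨⟨e.symm.toLinearMap, fun x w hw => ?_⟩, ?_, ?_⟩⟩
  · have : e.symm w = V.proj x (e.symm w) := by
      refine hf.1 ?_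
      rw [lin_proj]
      have h : f.lin (e.symm w) = w := e.apply_symm_apply w
      rw [h, proj_of_mem hw]
    change e.symm w ∈ _
    rw [this]
    exact proj_mem x _
  · exact hom_ext (LinearMap.ext fun v => e.symm_apply_apply v)
  · exact hom_ext (LinearMap.ext fun v => e.apply_symm_apply v)

end Proj

/-! ### Graded vector spaces with a homogeneous basis -/

section Free

variable {X : Type}

/-- The graded vector space with a basis indexed by `J`, the basis vector `j` being of degree
`k j`. -/
noncomputable def free {J : Type} [Finite J] (k : J → X) : GrVect X where
  carrier := J → ℂ
  gr x := ⨅ j : {j // k j ≠ x}, LinearMap.ker (LinearMap.proj (R := ℂ) (φ := fun _ : J => ℂ) j.1)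
  indep := by
    classical
    refine indep_of_proj _ (fun x => LinearMap.pi fun j =>
      if k j = x then LinearMap.proj j else 0) ?_ ?_
    · intro x v hv
      ext j
      by_cases h : k j = x
      · simp [h]
      · simp only [Submodule.mem_iInf, LinearMap.mem_ker, LinearMap.proj_apply] at hv
        simp [h, hv ⟨j, h⟩]
    · intro x y hxy v hv
      ext j
      by_cases h : k j = x
      · simp only [Submodule.mem_iInf, LinearMap.mem_ker, LinearMap.proj_apply] at hv
        simp [h, hv ⟨j, fun h' => hxy (h.symm.trans h')⟩]
      · simp [h]
  iSup_eq := by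
    classical
    have := Fintype.ofFinite J
    refine eq_top_iff.2 fun v _ => ?_
    rw [← Finset.univ_sum_single v]
    refine Submodule.sum_mem _ fun j _ => Submodule.mem_iSup_of_mem (k j) ?_
    simp only [Submodule.mem_iInf, LinearMap.mem_ker, LinearMap.proj_apply]
    rintro ⟨i, hi⟩
    exact Pi.single_eq_of_ne (fun h : i = j => hi (by rw [← h])) _

theorem mem_free {J : Type} [Finite J] {k : J → X} {x : X} {v : J → ℂ} :
    v ∈ (free k).gr x ↔ ∀ j, k j ≠ x → v j = 0 := by
  refine (Submodule.mem_iInf _).trans ?_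
  simp only [LinearMap.mem_ker, LinearMap.proj_apply]
  exact ⟨fun h j hj => h ⟨j, hj⟩, fun h j => h j.1 j.2⟩

/-- The morphism from `ℂ` in degree `x` given by a vector of degree `x`. -/
noncomputable def ofMem {V : GrVect X} {x : X} (v : V) (hv : v ∈ V.gr x) : single x ⟶ V :=
  ⟨LinearMap.toSpanSingleton ℂ V v, fun y c hc => by
    by_cases h : y = x
    · subst h
      exact (V.gr y).smul_mem (show ℂ from c) hv
    · rw [mem_single hc h]
      exact (map_zero (LinearMap.toSpanSingleton ℂ V v)).symm ▸ zero_mem _⟩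

theorem single_hom_ext {V : GrVect X} {x : X} {f g : single x ⟶ V}
    (h : f.lin (1 : ℂ) = g.lin (1 : ℂ)) : f = g :=
  hom_ext (LinearMap.ext_ring (R := ℂ) (M₃ := V) (f := f.lin) (g := g.lin) h)

theorem single_hom_eq_zero {x y : X} (h : x ≠ y) (f : single x ⟶ single y) : f = 0 :=
  single_hom_ext (mem_single (f.map_gr x _ (mem_single_self x 1)) h)

theorem sum_lin {V W : GrVect X} {J : Type*} (s : Finset J) (f : J → (V ⟶ W)) :
    Hom.lin (∑ j ∈ s, f j : V ⟶ W) = ∑ j ∈ s, (f j).lin :=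
  map_sum (G := (V ⟶ W) →+ (V →ₗ[ℂ] W))
    { toFun := fun f => f.lin, map_zero' := rfl, map_add' := fun _ _ => rfl } f s

theorem isSimpleBasis_single [Finite X] : IsSimpleBasis (single (X := X)) where
  id_ne_zero x h := by
    have : (1 : ℂ) = 0 := congrArg (fun f : single x ⟶ single x => f.lin (1 : ℂ)) h
    exact one_ne_zero this
  schur x f := ⟨f.lin (1 : ℂ), single_hom_ext (mul_one (show ℂ from f.lin (1 : ℂ))).symm⟩
  orthogonal x y f h := single_hom_eq_zero h f
  hasSum {J} _ k := by
    classical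
    have := Fintype.ofFinite J
    let b : Limits.Bicone fun j => single (k j) :=
      { pt := free k
        π := fun j => ⟨LinearMap.proj (R := ℂ) (φ := fun _ : J => ℂ) j, fun x v hv => by
          by_cases h : k j = x
          · subst h
            exact mem_single_self _ _
          · have : LinearMap.proj (R := ℂ) (φ := fun _ : J => ℂ) j v = 0 := mem_free.1 hv j h
            exact this ▸ zero_mem _⟩
        ι := fun j => ofMem (V := free k) (Pi.single j 1 : J → ℂ) (mem_free.2 fun i hi =>
          Pi.single_eq_of_ne (fun h => hi (by rw [h])) _)
        ι_π := fun j j' => by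
          by_cases h : j = j'
          · subst h
            rw [dif_pos rfl]
            refine single_hom_ext ?_
            change ((1 : ℂ) • (Pi.single j 1 : J → ℂ)) j = 1
            simp
          · rw [dif_neg h]
            refine single_hom_ext ?_
            change ((1 : ℂ) • (Pi.single j 1 : J → ℂ)) j' = 0
            simp [Ne.symm h] }
    refine ⟨b, ⟨Limits.isBilimitOfTotal b (hom_ext (LinearMap.ext fun v => ?_))⟩⟩
    rw [sum_lin, LinearMap.sum_apply]
    have h : ∑ j, (v : J → ℂ) j • (Pi.single j 1 : J → ℂ) = v := by
      ext i
      simp only [Finset.sum_apply, Pi.smul_apply, Pi.single_apply, smul_eq_mul, mul_ite, mul_one,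
        mul_zero]
      exact (Finset.sum_ite_eq Finset.univ i (v : J → ℂ)).trans (if_pos (Finset.mem_univ i))
    exact h
  isSum V := by
    classical
    have := Fintype.ofFinite X
    let B := fun x => Module.finBasis ℂ (V.gr x)
    let b : Limits.Bicone fun j : Σ x, Fin (Module.finrank ℂ (V.gr x)) => single j.1 :=
      { pt := V
        π := fun j => ⟨(B j.1).coord j.2 ∘ₗ (V.proj j.1).codRestrict _ (proj_mem j.1),
          fun x v hv => by
            by_cases h : j.1 = x
            · subst h
              exact mem_single_self _ _
            · have h0 : (V.proj j.1).codRestrict _ (proj_mem j.1) v = 0 :=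
                Subtype.ext (proj_of_mem_ne h hv)
              have h1 : (B j.1).coord j.2 ((V.proj j.1).codRestrict _ (proj_mem j.1) v) = 0 := by
                rw [h0, map_zero]
              exact h1 ▸ zero_mem _⟩
        ι := fun j => ofMem (B j.1 j.2).1 (B j.1 j.2).2
        ι_π := by
          rintro ⟨x, r⟩ ⟨y, s⟩
          by_cases h : x = y
          · subst h
            have h1 : (V.proj x).codRestrict _ (proj_mem x) (B x r).1 = B x r :=
              Subtype.ext (proj_of_mem (B x r).2)
            by_cases hr : r = s
            · subst hr
              rw [dif_pos rfl]
              refine single_hom_ext ?_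
              change (B x).coord r ((V.proj x).codRestrict _ (proj_mem x)
                ((1 : ℂ) • (B x r).1)) = (1 : ℂ)
              rw [one_smul, h1]
              simp
            · rw [dif_neg (by simpa using hr)]
              refine single_hom_ext ?_
              change (B x).coord s ((V.proj x).codRestrict _ (proj_mem x)
                ((1 : ℂ) • (B x r).1)) = (0 : ℂ)
              rw [one_smul, h1]
              simp [hr]
          · rw [dif_neg (by simp [h])]
            exact single_hom_eq_zero h _ }
    refine ⟨_, inferInstance, _, b,
      ⟨Limits.isBilimitOfTotal b (hom_ext (LinearMap.ext fun v => ?_))⟩,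
      ⟨Iso.refl V⟩⟩
    rw [sum_lin, LinearMap.sum_apply]
    refine Eq.trans ?_ (sum_proj (V := V) v)
    rw [← Finset.univ_sigma_univ, Finset.sum_sigma]
    refine Finset.sum_congr rfl fun x _ => ?_
    have h := congrArg Subtype.val
      ((B x).sum_repr ((V.proj x).codRestrict _ (proj_mem x) v))
    rw [AddSubmonoidClass.coe_finsetSum] at h
    exact h

end Free
end GrVect

/-- A monoidal category is rigid if every object `X` has a right dual `d X` and is isomorphic to its
bidual. -/
theorem nonempty_rigidCategory {C : Type*} [Category* C] [MonoidalCategory C] (d : C → C)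
    (h : ∀ X, Nonempty (ExactPairing X (d X))) (h' : ∀ X, Nonempty (X ≅ d (d X))) :
    Nonempty (RigidCategory C) :=
  ⟨{ rightDual := fun X =>
      have := (h X).some
      ⟨d X⟩
     leftDual := fun X =>
      have := (h (d X)).some
      have : ExactPairing (d X) X := exactPairingCongrRight (h' X).some
      ⟨d X⟩ }⟩

/-! ### Graded vector spaces form a fusion category -/

namespace GrVect

section Dual

variable {G : Type} [Group G] [Finite G]

theorem contractLeft_assoc_sum_basis {E J : Type} [AddCommGroup E] [Module ℂ E] [Fintype J]
    (b : Module.Basis J ℂ E) (f : Module.Dual ℂ E) (c : ℂ) :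
    TensorProduct.map (contractLeft ℂ E) LinearMap.id
      ((TensorProduct.assoc ℂ (Module.Dual ℂ E) E (Module.Dual ℂ E)).symm
        (f ⊗ₜ[ℂ] (c • ∑ j, b j ⊗ₜ[ℂ] b.coord j))) = (1 : ℂ) ⊗ₜ[ℂ] (c • f) := by
  simp only [TensorProduct.tmul_smul, TensorProduct.tmul_sum, map_smul, map_sum,
    TensorProduct.assoc_symm_tmul, TensorProduct.map_tmul, LinearMap.id_apply,
    contractLeft_apply]
  refine congrArg _ ?_
  conv_rhs => rw [← b.sum_dual_apply_smul_coord f]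
  rw [TensorProduct.tmul_sum]
  refine Finset.sum_congr rfl fun j _ => ?_
  rw [TensorProduct.tmul_smul, TensorProduct.smul_tmul', smul_eq_mul, mul_one]

theorem assoc_contractLeft_sum_basis {E J : Type} [AddCommGroup E] [Module ℂ E] [Fintype J]
    (b : Module.Basis J ℂ E) (c : ℂ) (v : E) :
    TensorProduct.map LinearMap.id (contractLeft ℂ E)
      (TensorProduct.assoc ℂ E (Module.Dual ℂ E) E
        ((c • ∑ j, b j ⊗ₜ[ℂ] b.coord j) ⊗ₜ[ℂ] v)) = (c • v) ⊗ₜ[ℂ] (1 : ℂ) := by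
  simp only [← TensorProduct.smul_tmul', TensorProduct.sum_tmul, map_smul, map_sum,
    TensorProduct.assoc_tmul, TensorProduct.map_tmul, LinearMap.id_apply, contractLeft_apply]
  refine congrArg _ ?_
  conv_rhs => rw [← b.sum_repr v]
  rw [TensorProduct.sum_tmul]
  refine Finset.sum_congr rfl fun j _ => ?_
  rw [TensorProduct.smul_tmul, smul_eq_mul, mul_one, Module.Basis.coord_apply]

theorem exists_homogeneous_basis {X : Type} [Finite X] (V : GrVect X) :
    ∃ (J : Type) (_ : Fintype J) (k : J → X) (b : Module.Basis J ℂ V), ∀ j, b j ∈ V.gr (k j) := by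
  classical
  have := Fintype.ofFinite X
  have h := (DirectSum.isInternal_submodule_iff_iSupIndep_and_iSup_eq_top V.gr).2
    ⟨V.indep, V.iSup_eq⟩
  exact ⟨_, inferInstance, Sigma.fst, h.collectedBasis fun x => Module.finBasis ℂ (V.gr x),
    fun j => h.collectedBasis_mem _ j⟩

theorem coord_eq_zero {X : Type} {V : GrVect X} {J : Type} {k : J → X}
    {b : Module.Basis J ℂ V} (hb : ∀ j, b j ∈ V.gr (k j)) {j : J} {x : X} (h : x ≠ k j) {v : V}
    (hv : v ∈ V.gr x) : b.coord j v = 0 := by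
  have h1 : b.coord j ∘ₗ V.proj x = 0 := b.ext fun i => by
    by_cases hi : i = j
    · subst hi
      simp [proj_of_mem_ne h (hb i)]
    · by_cases hx : x = k i
      · subst hx
        simp [proj_of_mem (hb i), hi]
      · simp [proj_of_mem_ne hx (hb i)]
  have h2 := LinearMap.congr_fun h1 v
  rwa [LinearMap.comp_apply, proj_of_mem hv] at h2

/-- The dual of a `G`-graded vector space: functionals of degree `g` vanish on the vectors of degree
different from `g⁻¹`. -/
noncomputable def dual (V : GrVect G) : GrVect G where
  carrier := Module.Dual ℂ V
  gr g :=
    { carrier := {f | ∀ h, h ≠ g⁻¹ → ∀ v ∈ V.gr h, f v = 0}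
      add_mem' := fun hf hf' h hg v hv => by simp [hf h hg v hv, hf' h hg v hv]
      zero_mem' := fun _ _ _ _ => rfl
      smul_mem' := fun c f hf h hg v hv => by simp [hf h hg v hv] }
  indep := by
    refine indep_of_proj _ (fun g => (V.proj g⁻¹).dualMap) ?_ ?_
    · intro g f hf
      refine linearMap_ext_homogeneous fun h v hv => ?_
      by_cases hg : h = g⁻¹
      · subst hg
        simp [proj_of_mem hv]
      · simp [proj_of_mem_ne (Ne.symm hg) hv, hf h hg v hv]
    · intro g h hgh f hf
      refine LinearMap.ext fun v => ?_
      exact hf _ (fun hc => hgh (inv_injective hc)) _ (proj_mem _ v)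
  iSup_eq := by
    have := Fintype.ofFinite G
    refine eq_top_iff.2 fun f _ => ?_
    have h1 : f = ∑ g, f ∘ₗ V.proj g⁻¹ := LinearMap.ext fun v => by
      rw [LinearMap.sum_apply]
      simp only [LinearMap.comp_apply, ← map_sum]
      exact congrArg f ((Equiv.sum_comp (Equiv.inv G) fun g => V.proj g v).trans (sum_proj v)).symm
    rw [h1]
    refine Submodule.sum_mem _ fun g _ => Submodule.mem_iSup_of_mem g fun h hg v hv => ?_
    rw [LinearMap.comp_apply, proj_of_mem_ne (Ne.symm hg) hv, map_zero]

/-- A graded vector space is paired with its dual by evaluation. -/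
theorem exists_exactPairing_dual (V : GrVect G) : Nonempty (ExactPairing V (dual V)) := by
  classical
  obtain ⟨J, _, k, b, hb⟩ := V.exists_homogeneous_basis
  let t : V ⊗[ℂ] Module.Dual ℂ V := ∑ j, b j ⊗ₜ b.coord j
  have ht : t ∈ (V ⊗ dual V : GrVect G).gr 1 := Submodule.sum_mem _ fun j _ =>
    tmul_mem (V := V) (W := dual V) (mul_inv_cancel (k j)) (hb j) fun h hh v hv =>
      coord_eq_zero hb (by rwa [inv_inv] at hh) hv
  refine ⟨{
    coevaluation' := ofMem (V := (V ⊗ dual V : GrVect G)) t ht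
    evaluation' := ⟨contractLeft ℂ V, fun z => map_gr_of_tmul (V := dual V) (W := V) _ _ z
      fun g h hgh f hf v hv => ?_⟩
    coevaluation_evaluation' := hom_ext (TensorProduct.ext' fun f c => ?_)
    evaluation_coevaluation' := hom_ext (TensorProduct.ext' fun c v => ?_) }⟩
  · by_cases hz : z = 1
    · subst hz
      exact mem_single_self _ _
    · have h0 : contractLeft ℂ V (f ⊗ₜ v) = 0 := by
        refine hf h (fun hc => hz ?_) v hv
        rw [← hgh, hc, mul_inv_cancel]
      exact h0 ▸ zero_mem _
  · exact contractLeft_assoc_sum_basis b f c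
  · exact assoc_contractLeft_sum_basis b c v

/-- A graded vector space is isomorphic to its bidual. -/
theorem exists_iso_dual_dual (V : GrVect G) : Nonempty (V ≅ dual (dual V)) := by
  let f : V ⟶ dual (dual V) := ⟨(Module.evalEquiv ℂ V).toLinearMap, fun g v hv h hh φ hφ => by
    refine hφ g (fun hc => hh ?_) v hv
    rw [hc, inv_inv]⟩
  have := isIso_of_bijective f (Module.evalEquiv ℂ V).bijective
  exact ⟨asIso f⟩

instance monoidalPreadditive : MonoidalPreadditive (GrVect G) where
  whiskerLeft_zero := hom_ext (TensorProduct.map_zero_right _)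
  zero_whiskerRight := hom_ext (TensorProduct.map_zero_left _)
  whiskerLeft_add f g := hom_ext (TensorProduct.map_add_right _ f.lin g.lin)
  add_whiskerRight f g := hom_ext (TensorProduct.map_add_left f.lin g.lin _)

theorem isFusionCategory : IsFusionCategory (GrVect G) where
  finiteSemisimple := isSimpleBasis_single.isFiniteSemisimple
  monoidalPreadditive := inferInstance
  monoidalLinear :=
    { whiskerLeft_smul := fun _ _ _ r f => hom_ext (TensorProduct.map_smul_right r _ f.lin)
      smul_whiskerRight := fun r _ _ f _ => hom_ext (TensorProduct.map_smul_left r f.lin _) }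
  rigid := nonempty_rigidCategory dual exists_exactPairing_dual exists_iso_dual_dual
  simple_unit := isSimpleBasis_single.simple 1

end Dual

section Module

variable {X : Type}

theorem exists_ne_zero_of_not_isZero {V : GrVect X} (h : ¬ Limits.IsZero V) :
    ∃ x, ∃ v ∈ V.gr x, v ≠ 0 := by
  by_contra hc
  push Not at hc
  refine h ((Limits.IsZero.iff_id_eq_zero V).2 (hom_ext (linearMap_ext_homogeneous ?_)))
  exact fun x v hv => hc x v hv

theorem not_isZero_single [Finite X] (x : X) : ¬ Limits.IsZero (single x) := fun h =>
  isSimpleBasis_single.id_ne_zero x ((Limits.IsZero.iff_id_eq_zero _).1 h)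

/-- Vector spaces graded by a transitive `G`-set form an indecomposable module category. -/
theorem isIndecomposableModule {G : Type} [Group G] [Finite G] [Finite X] [MulAction G X]
    [MulAction.IsPretransitive G X] [Nonempty X] :
    IsIndecomposableModule (GrVect G) (GrVect X) := by
  refine ⟨⟨_, not_isZero_single (Classical.arbitrary X)⟩, fun P Q hP _ hPQ _ => ?_⟩
  by_contra hc
  push Not at hc
  obtain ⟨⟨V, hV, hV0⟩, W, hW, hW0⟩ := hc
  obtain ⟨x, v, hv, hv0⟩ := exists_ne_zero_of_not_isZero hV0
  obtain ⟨y, w, hw, hw0⟩ := exists_ne_zero_of_not_isZero hW0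
  obtain ⟨g, rfl⟩ := MulAction.exists_smul_eq G x y
  obtain ⟨ψ, hψ⟩ : ∃ ψ : Module.Dual ℂ V, ψ v ≠ 0 := by
    by_contra hc
    push Not at hc
    exact hv0 ((Module.forall_dual_apply_eq_zero_iff ℂ v).1 hc)
  -- the component of degree `x` of `V`, moved to degree `g • x`, maps onto the line through `w`
  let L : ℂ ⊗[ℂ] V →ₗ[ℂ] W := LinearMap.toSpanSingleton ℂ W w ∘ₗ ψ ∘ₗ V.proj x ∘ₗ
    (TensorProduct.lid ℂ V).toLinearMap
  let f : single g ⊙ₗ V ⟶ W := ⟨L, fun z => map_gr_of_tmul (V := single g) (W := V) L _ z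
    fun a b hab (c : ℂ) hc u hu => by
      change ψ (V.proj x (c • u)) • w ∈ W.gr z
      by_cases ha : a = g
      · by_cases hb : x = b
        · subst ha hb hab
          exact Submodule.smul_mem _ _ hw
        · rw [map_smul, proj_of_mem_ne hb hu, smul_zero, map_zero, zero_smul]
          exact zero_mem _
      · rw [mem_single hc ha, zero_smul, map_zero, map_zero, zero_smul]
        exact zero_mem _⟩
  have hf : f = 0 := (hPQ _ _ (hP (single g) V hV) hW).1 f
  have h0 : ψ (V.proj x ((1 : ℂ) • v)) • w = 0 := congrArg (fun f : single g ⊙ₗ V ⟶ W =>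
    f.lin (show (single g ⊙ₗ V : GrVect X) from (1 : ℂ) ⊗ₜ[ℂ] v)) hf
  rw [one_smul, proj_of_mem hv] at h0
  exact hw0 ((smul_eq_zero.1 h0).resolve_left hψ)

end Module
end GrVect

/-! ### Categories with given fusion rules are fusion categories -/

namespace FusionObj

variable {I : Type} [Fintype I] [DecidableEq I] {D : FusionData I}

/-- The object `i`, as a formal direct sum with one summand. -/
def simple (D : FusionData I) (i : I) : FusionObj D where
  ι := Unit
  label _ := i

theorem sum_mat {X Y : FusionObj D} {J : Type*} (r : Finset J) (f : J → (X ⟶ Y)) (s : X.ι)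
    (t : Y.ι) : Hom.mat (∑ j ∈ r, f j : X ⟶ Y) s t = ∑ j ∈ r, (f j).mat s t :=
  map_sum (G := (X ⟶ Y) →+ ℂ)
    { toFun := fun f => f.mat s t, map_zero' := rfl, map_add' := fun _ _ => rfl } f r

/-- The object `X` as the direct sum of its simple summands. -/
def bicone (X : FusionObj D) : Limits.Bicone fun s : X.ι => simple D (X.label s) where
  pt := X
  π j := ⟨fun i _ => if i = j then 1 else 0, fun i _ h => if_neg fun h' => h (congrArg X.label h')⟩
  ι j := ⟨fun _ i => if i = j then 1 else 0,
    fun _ i h => if_neg fun h' => h (congrArg X.label h').symm⟩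
  ι_π j j' := by
    by_cases h : j = j'
    · subst h
      rw [dif_pos rfl, eqToHom_refl]
      refine hom_ext fun ⟨⟩ ⟨⟩ => ?_
      refine (comp_mat _ _ _ _).trans (Eq.trans ?_ (id_mat (simple D (X.label j)) () ()).symm)
      simp
      rfl
    · rw [dif_neg h]
      refine hom_ext fun _ _ => ?_
      simp only [comp_mat, mul_ite, mul_one, mul_zero, Finset.sum_ite_eq', Finset.mem_univ,
        if_true]
      exact if_neg (Ne.symm h)

/-- An object is the direct sum of its simple summands. -/
def isBilimitBicone (X : FusionObj D) : (bicone X).IsBilimit :=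
  Limits.isBilimitOfTotal _ <| hom_ext fun (i j : X.ι) => by
    refine (sum_mat _ _ _ _).trans (Eq.trans ?_ (id_mat X i j).symm)
    have h : ∀ s, ((bicone X).π s ≫ (bicone X).ι s).mat i j =
        (if i = s then 1 else 0) * (if j = s then 1 else 0) := fun s =>
      Fintype.sum_unique (ι := Unit) fun _ => (if i = s then 1 else 0) * (if j = s then 1 else 0)
    rw [Finset.sum_congr rfl fun s _ => h s]
    simp

theorem isSimpleBasis_simple : IsSimpleBasis (simple D) where
  id_ne_zero i h := by
    have : (1 : ℂ) = 0 := congrArg (fun f : simple D i ⟶ simple D i => f.mat () ()) h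
    exact one_ne_zero this
  schur i f := ⟨f.mat () (), hom_ext fun _ _ => (mul_one _).symm⟩
  orthogonal i j f h := hom_ext fun _ _ => f.supp _ _ h
  hasSum {J} _ k := by
    classical
    have := Fintype.ofFinite J
    exact ⟨bicone ⟨J, k⟩, ⟨isBilimitBicone ⟨J, k⟩⟩⟩
  isSum X := ⟨_, inferInstance, _, bicone X, ⟨isBilimitBicone X⟩, ⟨Iso.refl X⟩⟩

theorem tensorMap_add_right {X X' Y Y' : FusionObj D} (f : X ⟶ X') (g g' : Y ⟶ Y') :
    tensorMap f (g + g') = tensorMap f g + tensorMap f g' := hom_ext fun p q => by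
  simp only [tensorMap, add_mat]
  split_ifs <;> simp [mul_add]

theorem tensorMap_add_left {X X' Y Y' : FusionObj D} (f f' : X ⟶ X') (g : Y ⟶ Y') :
    tensorMap (f + f') g = tensorMap f g + tensorMap f' g := hom_ext fun p q => by
  simp only [tensorMap, add_mat]
  split_ifs <;> simp [add_mul]

theorem tensorMap_smul_right {X X' Y Y' : FusionObj D} (f : X ⟶ X') (r : ℂ) (g : Y ⟶ Y') :
    tensorMap f (r • g) = r • tensorMap f g := hom_ext fun p q => by
  simp only [tensorMap, smul_mat]
  split_ifs <;> simp [mul_left_comm]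

theorem tensorMap_smul_left {X X' Y Y' : FusionObj D} (r : ℂ) (f : X ⟶ X') (g : Y ⟶ Y') :
    tensorMap (r • f) g = r • tensorMap f g := hom_ext fun p q => by
  simp only [tensorMap, smul_mat]
  split_ifs <;> simp [mul_assoc]

instance monoidalPreadditive : MonoidalPreadditive (FusionObj D) where
  whiskerLeft_zero {X Y Z} := by
    have h := tensorMap_smul_right (𝟙 X) (0 : ℂ) (0 : Y ⟶ Z)
    rwa [zero_smul, zero_smul] at h
  zero_whiskerRight {X Y Z} := by
    have h := tensorMap_smul_left (0 : ℂ) (0 : Y ⟶ Z) (𝟙 X)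
    rwa [zero_smul, zero_smul] at h
  whiskerLeft_add f g := tensorMap_add_right _ f g
  add_whiskerRight f g := tensorMap_add_left f g _

/-- The dual object, for an involution `d` of the set of simple objects. -/
abbrev dual (d : I → I) (X : FusionObj D) : FusionObj D where
  ι := X.ι
  label s := d (X.label s)

section Rigid

variable (d : I → I) (c : I → ℂ)

/-- The coevaluation of `X`, the sum of the canonical ones of the simple summands. -/
def coev (X : FusionObj D) : unit D ⟶ tensor X (dual d X) where
  mat _ p := if p.fst = p.snd ∧ p.out = D.one then 1 else 0
  supp _ _ h := if_neg fun h' => h h'.2.symm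

/-- The evaluation of `X`, the sum of those of the simple summands, rescaled by `c`. -/
def ev (X : FusionObj D) : tensor (dual d X) X ⟶ unit D where
  mat p _ := if p.fst = p.snd ∧ p.out = D.one then c (X.label p.snd) else 0
  supp _ _ h := if_neg fun h' => h h'.2

theorem app_coev (X : FusionObj D) (v : TensorIdx X (dual d X) → ℂ) (u : Unit) :
    app (coev d X) v u = ∑ s, hat v s s D.one := by
  refine (sum_tensor (fun p => (coev d X).mat u p) v
    (fun s t k => if s = t ∧ k = D.one then 1 else 0) fun q => rfl).trans ?_
  refine Finset.sum_congr rfl fun s _ => ?_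
  rw [Finset.sum_eq_single s (fun t _ ht => by simp [Ne.symm ht]) (by simp),
    Finset.sum_eq_single D.one (fun k _ hk => by simp [hk]) (by simp)]
  simp

theorem app_ev (X : FusionObj D) (v : Unit → ℂ) (p : TensorIdx (dual d X) X) :
    app (ev d c X) v p = if p.fst = p.snd ∧ p.out = D.one then c (X.label p.snd) * v () else 0 := by
  refine (Fintype.sum_unique (ι := Unit) _).trans ?_
  exact ite_mul _ _ _ _ |>.trans (if_congr Iff.rfl rfl (zero_mul _))

variable (hd : ∀ i j, D.N i j D.one ↔ j = d i) (hd' : ∀ i j, D.N (d i) j D.one ↔ j = i)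
include hd hd'

/-- The first zigzag identity. Of the associator, only the F-symbol of `(i, d i, i)` with the unit as
both intermediate objects contributes, and it is cancelled by the factor `c i`. -/
theorem coev_ev (hc : ∀ i, D.F i (d i) i i D.one D.one * c i = 1) (X : FusionObj D) :
    tensorMap (coev d X) (𝟙 X) ≫ assocHom X (dual d X) X ≫ tensorMap (𝟙 X) (ev d c X) =
      lunitHom X ≫ runitInv X := by
  refine ext_app fun v p => ?_
  obtain ⟨⟨⟩, t, k, hk⟩ := p
  have hkt : k = X.label t := (D.one_N _ _).1 hk
  subst hkt
  rw [app_comp, app_comp, app_comp, app_whiskerRight, app_coev, app_lunitHom, app_runitInv]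
  have h1 := fun s => hatL_eq
    (v := app (assocHom X (dual d X) X) (app (tensorMap (𝟙 X) (ev d c X)) v))
    (fun s t u e k => ∑ f, D.F (X.label s) (d (X.label t)) (X.label u) k e f *
      hat (fun y => hat (app (tensorMap (𝟙 X) (ev d c X)) v) s y k) t u f)
    (app_assocHom _) s s t D.one (X.label t)
  have h2 := fun s f => hatR_eq (v := app (tensorMap (𝟙 X) (ev d c X)) v)
    (fun s (t : X.ι) t' f k => if t = t' ∧ f = D.one then c (X.label t') * hat v s () k else 0)
    (fun q => (app_whiskerLeft _ _ _).trans (app_ev d c X _ _)) s s t f (X.label t)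
  refine Eq.trans (Finset.sum_congr rfl fun s _ => (h1 s).trans ?_)
    ((Finset.sum_ite_eq' Finset.univ t fun s => hat v s () (X.label s)).trans
      (if_pos (Finset.mem_univ t)))
  rw [if_pos ⟨(hd _ _).2 rfl, hk⟩]
  simp only [h2]
  by_cases hs : s = t
  · subst hs
    rw [if_pos rfl, Finset.sum_eq_single D.one (fun f _ hf => by simp [hf]) (by simp),
      if_pos ⟨(hd' _ _).2 rfl, (D.N_one _ _).2 rfl⟩, if_pos ⟨rfl, rfl⟩, ← mul_assoc, hc, one_mul]
  · rw [if_neg hs]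
    exact Finset.sum_eq_zero fun f _ => by simp [hs]

/-- The second zigzag identity, where only the inverse F-symbol of `(d i, i, d i)` with the unit as
both intermediate objects contributes. -/
theorem ev_coev (hc : ∀ i, D.F' (d i) i (d i) (d i) D.one D.one * c i = 1) (X : FusionObj D) :
    tensorMap (𝟙 (dual d X)) (coev d X) ≫ assocInv (dual d X) X (dual d X) ≫
      tensorMap (ev d c X) (𝟙 (dual d X)) = runitHom (dual d X) ≫ lunitInv (dual d X) := by
  refine ext_app fun v p => ?_
  obtain ⟨t, ⟨⟩, k, hk⟩ := p
  have hkt : k = d (X.label t) := (D.N_one _ _).1 hk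
  subst hkt
  rw [app_comp, app_comp, app_comp, app_whiskerLeft, app_coev, app_runitHom, app_lunitInv]
  have h1 := fun s => hatR_eq
    (v := app (assocInv (dual d X) X (dual d X)) (app (tensorMap (ev d c X) (𝟙 (dual d X))) v))
    (fun s t u f k => ∑ e, D.F' (d (X.label s)) (X.label t) (d (X.label u)) k f e *
      hat (fun y => hat (app (tensorMap (ev d c X) (𝟙 (dual d X))) v) y u k) s t e)
    (app_assocInv _) t s s D.one (d (X.label t))
  have h2 := fun s e => hatL_eq (v := app (tensorMap (ev d c X) (𝟙 (dual d X))) v)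
    (fun (t : X.ι) t' s e k => if t = t' ∧ e = D.one then c (X.label t') * hat v () s k else 0)
    (fun q => (app_whiskerRight _ _ _).trans (app_ev d c X _ _)) t s s e (d (X.label t))
  refine Eq.trans (Finset.sum_congr rfl fun s _ => (h1 s).trans ?_)
    ((Finset.sum_ite_eq' Finset.univ t fun s => hat v () s (d (X.label s))).trans
      (if_pos (Finset.mem_univ t)))
  rw [if_pos ⟨(hd _ _).2 rfl, hk⟩]
  simp only [h2]
  by_cases hs : s = t
  · subst hs
    rw [if_pos rfl, Finset.sum_eq_single D.one (fun f _ hf => by simp [hf]) (by simp),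
      if_pos ⟨(hd' _ _).2 rfl, (D.one_N _ _).2 rfl⟩, if_pos ⟨rfl, rfl⟩, ← mul_assoc, hc, one_mul]
  · rw [if_neg hs]
    exact Finset.sum_eq_zero fun f _ => by simp [Ne.symm hs]

end Rigid

/-- A category with fusion data `D` is a fusion category if every simple object `i` has a dual `d i`
such that the unit occurs in `i ⊗ j` only for `j = d i`, and the two F-symbols governing the
associativity of `i ⊗ d i ⊗ i` and `d i ⊗ i ⊗ d i` on the unit are inverse to a common scalar. -/
theorem isFusionCategory (d : I → I) (c : I → ℂ) (hd : ∀ i j, D.N i j D.one ↔ j = d i)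
    (hdd : ∀ i, d (d i) = i) (hc : ∀ i, D.F i (d i) i i D.one D.one * c i = 1)
    (hc' : ∀ i, D.F' (d i) i (d i) (d i) D.one D.one * c i = 1) :
    IsFusionCategory (FusionObj D) where
  finiteSemisimple := isSimpleBasis_simple.isFiniteSemisimple
  monoidalPreadditive := inferInstance
  monoidalLinear :=
    { whiskerLeft_smul := fun _ _ _ r f => tensorMap_smul_right _ r f
      smul_whiskerRight := fun r _ _ f _ => tensorMap_smul_left r f _ }
  rigid := nonempty_rigidCategory (dual d)
    (fun X => ⟨{
      coevaluation' := coev d X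
      evaluation' := ev d c X
      coevaluation_evaluation' := ev_coev d c hd (fun i j => by rw [hd, hdd]) hc' X
      evaluation_coevaluation' := coev_ev d c hd (fun i j => by rw [hd, hdd]) hc X }⟩)
    (fun X => by
      have h : X = dual d (dual d X) := by
        obtain ⟨ι, label⟩ := X
        simp [dual, hdd]
      exact ⟨eqToIso h⟩)
  simple_unit := isSimpleBasis_simple.simple D.one

end FusionObj

theorem TY.isFusionCategory {A : Type} [AddCommGroup A] [Fintype A] [DecidableEq A]
    (χ : SymmBicharacter A) (ν : ℤˣ) : IsFusionCategory (TY χ ν) := by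
  have hτ : TambaraYamagami.tau A ν ≠ 0 := fun h => by
    simpa [h] using TambaraYamagami.tau_mul_tau A ν
  refine FusionObj.isFusionCategory (D := tyData χ ν) (Option.map Neg.neg)
    (fun i => i.elim (TambaraYamagami.tau A ν)⁻¹ fun _ => 1) ?_ ?_ ?_ ?_
  · rintro (_ | a) (_ | b) <;> simp [tyData, TambaraYamagami.N]
    rw [eq_comm, add_comm, ← eq_neg_iff_add_eq_zero]
  · rintro (_ | a) <;> simp
  -- for `σ` both F-symbols are `τ`, which is why the evaluation of `σ` is rescaled by `τ⁻¹`
  · rintro (_ | a) <;> simp [tyData, TambaraYamagami.F, χ.zero_left, hτ]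
  · rintro (_ | a) <;> simp [tyData, TambaraYamagami.F', χ.zero_left, hτ]

/-! ### Module functors given by equivariant kernels -/

/-- A module functor structure whose structure morphisms are isomorphisms is a strong one. -/
@[reducible]
noncomputable def leftLinearOfIsIso {C M : Type*} [Category* C] [MonoidalCategory C] [Category* M]
    [MonoidalLeftAction C M] (F : M ⥤ M) [F.LaxLeftLinear C]
    (h : ∀ (c : C) (m : M), IsIso (Functor.LaxLeftLinear.μₗ F c m)) : F.LeftLinear C where
  δₗ c m := inv (Functor.LaxLeftLinear.μₗ F c m)
  δₗ_naturality_left f m := by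
    rw [IsIso.comp_inv_eq, Category.assoc, Functor.LaxLeftLinear.μₗ_naturality_left,
      IsIso.inv_hom_id_assoc]
  δₗ_naturality_right c _ _ f := by
    rw [IsIso.comp_inv_eq, Category.assoc, Functor.LaxLeftLinear.μₗ_naturality_right,
      IsIso.inv_hom_id_assoc]
  δₗ_associativity c c' m := by
    rw [IsIso.inv_comp_eq, Functor.LaxLeftLinear.μₗ_associativity_assoc, IsIso.hom_inv_id_assoc,
      ← MonoidalLeftAction.actionHomRight_comp, IsIso.hom_inv_id,
      MonoidalLeftAction.actionHomRight_id, Category.comp_id]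
  δₗ_unitality_inv m := by
    rw [← cancel_mono (Functor.LaxLeftLinear.μₗ F (𝟙_ C) m)]
    simp
  μₗ_comp_δₗ c m := IsIso.hom_inv_id _
  δₗ_comp_μₗ c m := IsIso.inv_hom_id _

/-- Data which make the vector spaces graded by a finite `G`-set `X` into a module category over the
category with fusion data `D`, compatibly with the action of the graded vector spaces `Vec(G)`.

* `adm i x y` says that the simple object `i` sends the simple object `x` to a sum which contains
  `y` (with multiplicity one).
* `char i` is a character by which `G` acts on the kernel of `i`.
* `T i j k x y z` is the coefficient of the module associativity constraint, from the path
  `x → y → z` given by `i` and `j` to the edge `x → z` given by a summand `k` of `i ⊗ j`; its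
  inverse has coefficients `T'`. -/
structure KernelData {I : Type} [Fintype I] [DecidableEq I] (D : FusionData I) (G X : Type)
    [Group G] [MulAction G X] [Fintype X] [DecidableEq X] where
  adm : I → X → X → Prop
  [decAdm : ∀ i x y, Decidable (adm i x y)]
  char : I → G →* ℂ
  T : I → I → I → X → X → X → ℂ
  T' : I → I → I → X → X → X → ℂ
  adm_smul : ∀ (g : G) i x y, adm i x y → adm i (g • x) (g • y)
  adm_one : ∀ x y, adm D.one x y ↔ x = y
  char_one : char D.one = 1
  T_smul : ∀ (g : G) i j k x y z, D.N i j k → adm i x y → adm j y z → adm k x z →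
    char k g * T i j k x y z = char i g * char j g * T i j k (g • x) (g • y) (g • z)
  T'_T : ∀ i j x y y' z, adm i x y → adm j y z → adm i x y' → adm j y' z →
    (∑ k, if D.N i j k ∧ adm k x z then T' i j k x y z * T i j k x y' z else 0) =
      if y = y' then 1 else 0
  T_T' : ∀ i j k k' x z, D.N i j k → adm k x z → D.N i j k' → adm k' x z →
    (∑ y, if adm i x y ∧ adm j y z then T i j k x y z * T' i j k' x y z else 0) =
      if k = k' then 1 else 0
  T_one_left : ∀ j x z, adm j x z → T D.one j j x x z = 1
  T_one_right : ∀ i x z, adm i x z → T i D.one i x z z = 1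
  T_assoc : ∀ i j k f d x y z w, adm i x y → adm j y z → adm k z w → D.N j k f → D.N i f d →
    adm d x w →
    (∑ e, if D.N i j e ∧ D.N e k d ∧ adm e x z then
      D.F i j k d e f * T i j e x y z * T e k d x z w else 0) =
      if adm f y w then T j k f y z w * T i f d x y w else 0

namespace KernelData

attribute [instance] KernelData.decAdm

open GrVect

variable {I : Type} [Fintype I] [DecidableEq I] {D : FusionData I} {G X : Type} [Group G]
  [MulAction G X] [Fintype X] [DecidableEq X] (K : KernelData D G X)

theorem adm_smul_iff (g : G) (i : I) (x y : X) : K.adm i (g • x) (g • y) ↔ K.adm i x y :=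
  ⟨fun h => by simpa using K.adm_smul g⁻¹ i _ _ h, K.adm_smul g i x y⟩

theorem char_ne_zero (i : I) (g : G) : K.char i g ≠ 0 := fun h => by
  have := map_mul (K.char i) g g⁻¹
  rw [mul_inv_cancel, map_one, h, zero_mul] at this
  exact one_ne_zero this

section Objects

variable (A : FusionObj D) (M : GrVect X)

/-- The families `f x y s` of vectors of `M`, of degree `x`, for the pairs `(x, y)` which are
admissible for the summand `s` of `A`. -/
def sub : Submodule ℂ (X → X → A.ι → M) where
  carrier := {f | ∀ x y s, f x y s ∈ M.gr x ∧ (¬ K.adm (A.label s) x y → f x y s = 0)}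
  add_mem' hf hg x y s := ⟨add_mem (hf x y s).1 (hg x y s).1, fun h => by
    simp [(hf x y s).2 h, (hg x y s).2 h]⟩
  zero_mem' x _ _ := ⟨zero_mem _, fun _ => rfl⟩
  smul_mem' c f hf x y s := ⟨(M.gr x).smul_mem c (hf x y s).1, fun h => by
    simp [(hf x y s).2 h]⟩

/-- The value at `M` of the functor attached to `A`: the family `f x y s` has degree `y`. -/
noncomputable def obj : GrVect X where
  carrier := K.sub A M
  gr y₀ :=
    { carrier := {f | ∀ x y s, y ≠ y₀ → f.1 x y s = 0}
      add_mem' := fun {f f'} hf hf' x y s h => by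
        have := congrArg₂ (· + ·) (hf x y s h) (hf' x y s h)
        simpa using this
      zero_mem' := fun _ _ _ _ => rfl
      smul_mem' := fun c f hf x y s h => by
        have := congrArg (c • ·) (hf x y s h)
        simpa using this }
  indep := by
    refine indep_of_proj _ (fun y₀ =>
      { toFun := fun f => ⟨fun x y s => if y = y₀ then f.1 x y s else 0, fun x y s => ⟨by
          dsimp only
          split_ifs
          · exact (f.2 x y s).1
          · exact zero_mem _, fun h => by simp [(f.2 x y s).2 h]⟩⟩
        map_add' := fun f f' => by ext; dsimp; split_ifs <;> simp
        map_smul' := fun f f' => by ext; dsimp; split_ifs <;> simp }) ?_ ?_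
    · intro y₀ f hf
      refine Subtype.ext (funext fun x => funext fun y => funext fun s => ?_)
      change (if y = y₀ then f.1 x y s else 0) = f.1 x y s
      split_ifs with h
      · rfl
      · exact (hf x y s h).symm
    · intro y₀ y₁ hy f hf
      refine Subtype.ext (funext fun x => funext fun y => funext fun s => ?_)
      change (if y = y₀ then f.1 x y s else 0) = 0
      split_ifs with h
      · exact hf x y s (h.trans_ne hy)
      · rfl
  iSup_eq := by
    refine eq_top_iff.2 fun f _ => ?_
    have h1 : f = ∑ y₀, ⟨fun x y s => if y = y₀ then f.1 x y s else 0, fun x y s => ⟨by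
          dsimp only
          split_ifs
          · exact (f.2 x y s).1
          · exact zero_mem _, fun h => by simp [(f.2 x y s).2 h]⟩⟩ := by
      refine Subtype.ext (funext fun x => funext fun y => funext fun s => ?_)
      simp [Finset.sum_apply]
    rw [h1]
    refine Submodule.sum_mem _ fun y₀ _ => Submodule.mem_iSup_of_mem y₀ fun x y s h => if_neg h

variable {K A M}

/-- The components of an element of `K.obj A M`. -/
def val (f : K.obj A M) : X → X → A.ι → M := Subtype.val (p := (· ∈ K.sub A M)) f

theorem val_mem (f : K.obj A M) (x y : X) (s : A.ι) : val f x y s ∈ M.gr x :=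
  (Subtype.property (p := (· ∈ K.sub A M)) f x y s).1

theorem val_eq_zero (f : K.obj A M) {x y : X} {s : A.ι} (h : ¬ K.adm (A.label s) x y) :
    val f x y s = 0 :=
  (Subtype.property (p := (· ∈ K.sub A M)) f x y s).2 h

theorem obj_ext {f f' : K.obj A M} (h : ∀ x y s, val f x y s = val f' x y s) : f = f' :=
  Subtype.ext (p := (· ∈ K.sub A M)) (funext fun x => funext fun y => funext fun s => h x y s)

theorem val_of_mem {f : K.obj A M} {y₀ : X} (h : f ∈ (K.obj A M).gr y₀) {x y : X} (s : A.ι)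
    (hy : y ≠ y₀) : val f x y s = 0 := h x y s hy

theorem mem_gr {f : K.obj A M} {y₀ : X} (h : ∀ x y s, y ≠ y₀ → val f x y s = 0) :
    f ∈ (K.obj A M).gr y₀ := h

@[simp] theorem val_add (f f' : K.obj A M) (x y : X) (s : A.ι) :
    val (f + f') x y s = val f x y s + val f' x y s := rfl

@[simp] theorem val_smul (c : ℂ) (f : K.obj A M) (x y : X) (s : A.ι) :
    val (c • f) x y s = c • val f x y s := rfl

@[simp] theorem val_zero (x y : X) (s : A.ι) : val (0 : K.obj A M) x y s = 0 := rfl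

theorem val_sum {J : Type*} (r : Finset J) (f : J → K.obj A M) (x y : X) (s : A.ι) :
    val (∑ j ∈ r, f j) x y s = ∑ j ∈ r, val (f j) x y s :=
  map_sum (G := K.obj A M →+ M)
    { toFun := fun f => val f x y s, map_zero' := rfl, map_add' := fun _ _ => rfl } f r

/-- A linear map to `K.obj A M`, given by its components. -/
def mkLin {E : Type} [AddCommGroup E] [Module ℂ E] (F : E → X → X → A.ι → M)
    (hadd : ∀ e e' x y s, F (e + e') x y s = F e x y s + F e' x y s)
    (hsmul : ∀ (c : ℂ) e x y s, F (c • e) x y s = c • F e x y s)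
    (hmem : ∀ e x y s, F e x y s ∈ M.gr x)
    (hadm : ∀ e x y s, ¬ K.adm (A.label s) x y → F e x y s = 0) : E →ₗ[ℂ] K.obj A M where
  toFun e := (⟨F e, fun x y s => ⟨hmem e x y s, hadm e x y s⟩⟩ : K.sub A M)
  map_add' e e' := obj_ext (hadd e e')
  map_smul' c e := obj_ext (hsmul c e)

/-- The components of an element of `K.obj A M`, as linear maps. -/
def valₗ (x y : X) (s : A.ι) : K.obj A M →ₗ[ℂ] M where
  toFun f := val f x y s
  map_add' _ _ := rfl
  map_smul' _ _ := rfl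

@[simp] theorem valₗ_apply (x y : X) (s : A.ι) (f : K.obj A M) : valₗ x y s f = val f x y s := rfl

variable (K A M) in
/-- The family with the single component `m` (projected to degree `x`) at `(x, y, s)`, or zero if
`(x, y)` is not admissible. -/
noncomputable def incl (x y : X) (s : A.ι) : M →ₗ[ℂ] K.obj A M :=
  mkLin (fun m x' y' s' =>
      if x' = x ∧ y' = y ∧ s' = s ∧ K.adm (A.label s) x y then M.proj x m else 0)
    (fun m m' x' y' s' => by split_ifs <;> simp)
    (fun c m x' y' s' => by split_ifs <;> simp)
    (fun m x' y' s' => by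
      split_ifs with h
      · rw [h.1]; exact proj_mem x m
      · exact zero_mem _)
    (fun m x' y' s' h => if_neg <| by
      rintro ⟨rfl, rfl, rfl, h'⟩
      exact h h')

theorem val_incl (x y : X) (s : A.ι) (m : M) (x' y' : X) (s' : A.ι) :
    val (K.incl A M x y s m) x' y' s' =
      if x' = x ∧ y' = y ∧ s' = s ∧ K.adm (A.label s) x y then M.proj x m else 0 := rfl

theorem incl_mem (x y : X) (s : A.ι) (m : M) : K.incl A M x y s m ∈ (K.obj A M).gr y :=
  mem_gr fun x' y' s' h => by rw [val_incl, if_neg fun h' => h h'.2.1]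

/-- An element of `K.obj A M` is the sum of its components. -/
theorem sum_incl (f : K.obj A M) : ∑ x, ∑ y, ∑ s, K.incl A M x y s (val f x y s) = f := by
  refine obj_ext fun x y s => ?_
  simp only [val_sum, val_incl]
  rw [Finset.sum_eq_single x (fun x' _ h => ?_) (by simp),
    Finset.sum_eq_single y (fun x' _ h => ?_) (by simp),
    Finset.sum_eq_single s (fun x' _ h => ?_) (by simp)]
  · by_cases h : K.adm (A.label s) x y
    · rw [if_pos ⟨rfl, rfl, rfl, h⟩, proj_of_mem (val_mem f x y s)]
    · rw [if_neg fun h' => h h'.2.2.2, val_eq_zero f h]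
  · exact if_neg fun h' => h h'.2.2.1.symm
  · exact Finset.sum_eq_zero fun _ _ => if_neg fun h' => h h'.2.1.symm
  · exact Finset.sum_eq_zero fun _ _ => Finset.sum_eq_zero fun _ _ => if_neg fun h' => h h'.1.symm

end Objects

section Functor

variable {K} {A B : FusionObj D} {M N : GrVect X}

/-- The functor attached to `A`, on morphisms. -/
noncomputable def map (A : FusionObj D) (φ : M ⟶ N) : K.obj A M ⟶ K.obj A N where
  lin := mkLin (fun f x y s => φ.lin (val f x y s)) (fun _ _ _ _ _ => map_add φ.lin _ _)
    (fun _ _ _ _ _ => map_smul φ.lin _ _) (fun f x y s => φ.map_gr x _ (val_mem f x y s))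
    (fun f _ _ _ h => (congrArg φ.lin (val_eq_zero f h)).trans (map_zero _))
  map_gr _ _ hf := mem_gr fun _ _ s h =>
    (congrArg φ.lin (val_of_mem hf s h)).trans (map_zero _)

@[simp] theorem val_map (φ : M ⟶ N) (f : K.obj A M) (x y : X) (s : A.ι) :
    val ((map A φ).lin f) x y s = φ.lin (val f x y s) := rfl

theorem gr_hom_ext {f g : M ⟶ K.obj A N}
    (h : ∀ m x y s, val (f.lin m) x y s = val (g.lin m) x y s) :
    f = g := GrVect.hom_ext (LinearMap.ext fun m => obj_ext (h m))

variable (K A) in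
/-- The functor attached to `A`. -/
noncomputable def functor : GrVect X ⥤ GrVect X where
  obj := K.obj A
  map := map A
  map_id _ := gr_hom_ext fun _ _ _ _ => rfl
  map_comp _ _ := gr_hom_ext fun _ _ _ _ => rfl

instance : (K.functor A).Additive where
  map_add := gr_hom_ext fun _ _ _ _ => rfl

instance : (K.functor A).Linear ℂ where
  map_smul _ _ := gr_hom_ext fun _ _ _ _ => rfl

/-- The components of the natural transformation attached to a morphism `h : A ⟶ B`. -/
noncomputable def natApp (h : A ⟶ B) (M : GrVect X) : K.obj A M ⟶ K.obj B M where
  lin := mkLin (fun f x y t => ∑ s, h.mat s t • val f x y s)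
    (fun f f' x y t => by simp [Finset.sum_add_distrib])
    (fun c f x y t => by simp [Finset.smul_sum, smul_comm c])
    (fun f x y t => Submodule.sum_mem _ fun s _ => Submodule.smul_mem _ _ (val_mem f x y s))
    (fun f x y t hf => by
      refine Finset.sum_eq_zero fun s _ => ?_
      by_cases hst : A.label s = B.label t
      · rw [val_eq_zero f (by rwa [hst]), smul_zero]
      · rw [h.supp s t hst, zero_smul])
  map_gr y₀ f hf := mem_gr fun x y t hy => Finset.sum_eq_zero fun s _ => by
    rw [val_of_mem hf s hy, smul_zero]

theorem val_natApp (h : A ⟶ B) (f : K.obj A M) (x y : X) (t : B.ι) :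
    val ((natApp h M).lin f) x y t = ∑ s, h.mat s t • val f x y s := rfl

/-- The natural transformation attached to a morphism `h : A ⟶ B`. -/
noncomputable def natTrans (h : A ⟶ B) : K.functor A ⟶ K.functor B where
  app := natApp h
  naturality M N φ := gr_hom_ext fun f x y t => by
    refine ((map_sum φ.lin _ _).trans ?_).symm
    exact Finset.sum_congr rfl fun s _ => map_smul φ.lin _ _

end Functor

section Tmul

variable {E E' F F' H : Type} [AddCommGroup E] [Module ℂ E] [AddCommGroup E'] [Module ℂ E']
  [AddCommGroup F] [Module ℂ F] [AddCommGroup F'] [Module ℂ F'] [AddCommGroup H] [Module ℂ H]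

theorem map_smul_tmul (f : E →ₗ[ℂ] E') (g : F →ₗ[ℂ] F') (c : ℂ) (e : E) (x : F) :
    TensorProduct.map f g (c • (e ⊗ₜ x)) = c • (f e ⊗ₜ g x) := by
  rw [map_smul, TensorProduct.map_tmul]

theorem assoc_smul_tmul (a b : ℂ) (e : E) (x : F) (m : H) :
    TensorProduct.assoc ℂ E F H ((a * b) • ((e ⊗ₜ x) ⊗ₜ m)) =
      a • (e ⊗ₜ[ℂ] (b • (x ⊗ₜ[ℂ] m))) := by
  rw [map_smul, TensorProduct.assoc_tmul, TensorProduct.tmul_smul, smul_smul]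

theorem lid_smul_tmul (a c : ℂ) (e : E) : TensorProduct.lid ℂ E (a • (c ⊗ₜ e)) = a • c • e := by
  rw [map_smul, TensorProduct.lid_tmul]

end Tmul

section Action

variable [Fintype G]

variable (A : FusionObj D) (V : GrVect G) (M : GrVect X)

/-- The module structure of the functor attached to `A`, as a linear map. -/
noncomputable def lineatorLin : V ⊗[ℂ] K.obj A M →ₗ[ℂ] K.obj A (V ⊙ₗ M) :=
  mkLin (fun t x y s => ∑ g, K.char (A.label s) g •
      (TensorProduct.map (V.proj g) (valₗ (g⁻¹ • x) (g⁻¹ • y) s) t : V ⊗[ℂ] M))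
    (fun t t' x y s => by
      simp only [map_add, smul_add]
      exact Finset.sum_add_distrib)
    (fun c t x y s => by
      simp only [map_smul, smul_comm _ c]
      exact Finset.smul_sum.symm)
    (fun t x y s => by
      refine Submodule.sum_mem _ fun g _ => Submodule.smul_mem _ _ ?_
      induction t with
      | zero => rw [map_zero]; exact zero_mem _
      | add t t' h h' => rw [map_add]; exact add_mem h h'
      | tmul v f => exact tmul_mem (smul_inv_smul g x) (proj_mem g v) (val_mem f _ _ s))
    (fun t x y s h => by
      refine Finset.sum_eq_zero fun g _ => ?_
      refine Eq.trans (congrArg _ ?_) (smul_zero _)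
      induction t with
      | zero => exact map_zero _
      | add t t' h h' => exact (map_add _ _ _).trans ((congrArg₂ _ h h').trans (add_zero _))
      | tmul v f =>
        rw [TensorProduct.map_tmul, valₗ_apply, val_eq_zero f, TensorProduct.tmul_zero]
        · rfl
        · rwa [K.adm_smul_iff])

variable {A V M}

theorem val_lineatorLin {g : G} {v : V} (hv : v ∈ V.gr g) (f : K.obj A M) (x y : X) (s : A.ι) :
    val (K.lineatorLin A V M (v ⊗ₜ f)) x y s =
      K.char (A.label s) g • (v ⊗ₜ[ℂ] val f (g⁻¹ • x) (g⁻¹ • y) s : V ⊗[ℂ] M) := by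
  refine (Finset.sum_eq_single g (fun h _ hg => ?_) (by simp)).trans ?_
  · rw [TensorProduct.map_tmul, proj_of_mem_ne hg hv, TensorProduct.zero_tmul]
    exact smul_zero (A := V ⊗[ℂ] M) _
  · rw [TensorProduct.map_tmul, proj_of_mem hv, valₗ_apply]

/-- Linear maps from a tensor product with a graded vector space are determined by their values on
the tensors with a homogeneous first factor. -/
theorem tensor_ext {Y : Type} {U : GrVect Y} {E E' : Type*} [AddCommGroup E] [Module ℂ E]
    [AddCommGroup E'] [Module ℂ E'] {L L' : U ⊗[ℂ] E →ₗ[ℂ] E'}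
    (h : ∀ y, ∀ u ∈ U.gr y, ∀ e, L (u ⊗ₜ e) = L' (u ⊗ₜ e)) : L = L' :=
  TensorProduct.ext (linearMap_ext_homogeneous fun y u hu => LinearMap.ext (h y u hu))

theorem tensor_ext₂ {Y : Type} {U W : GrVect Y} {E E' : Type*} [AddCommGroup E] [Module ℂ E]
    [AddCommGroup E'] [Module ℂ E'] {L L' : (U ⊗[ℂ] W) ⊗[ℂ] E →ₗ[ℂ] E'}
    (h : ∀ y, ∀ u ∈ U.gr y, ∀ z, ∀ w ∈ W.gr z, ∀ e, L ((u ⊗ₜ w) ⊗ₜ e) = L' ((u ⊗ₜ w) ⊗ₜ e)) :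
    L = L' :=
  TensorProduct.ext (TensorProduct.ext (linearMap_ext_homogeneous fun y u hu =>
    linearMap_ext_homogeneous fun z w hw => LinearMap.ext (h y u hu z w hw)))

variable (A V M) in
/-- The module structure of the functor attached to `A`. -/
noncomputable def lineator : V ⊙ₗ K.obj A M ⟶ K.obj A (V ⊙ₗ M) where
  lin := K.lineatorLin A V M
  map_gr y₀ := map_gr_of_tmul (K.lineatorLin A V M) _ y₀ fun g y₁ h v hv f hf =>
    mem_gr fun x y s hy => by
      rw [val_lineatorLin _ hv, val_of_mem hf s, TensorProduct.tmul_zero]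
      · exact smul_zero (A := V ⊗[ℂ] M) _
      · rintro rfl
        exact hy (by rw [← h, smul_inv_smul])

end Action

section Action2

variable [Fintype G] {A B : FusionObj D}

theorem assoc_val_lineatorLin {V W : GrVect G} {M : GrVect X} {g h : G} {v : V} (hv : v ∈ V.gr g)
    {w : W} (hw : w ∈ W.gr h) (f : K.obj A M) (x y : X) (s : A.ι) :
    TensorProduct.assoc ℂ V W M
        (val (K.lineatorLin A (V ⊗ W) M ((v ⊗ₜ[ℂ] w : V ⊗[ℂ] W) ⊗ₜ f)) x y s) =
      val (K.lineatorLin A V (W ⊙ₗ M) (v ⊗ₜ K.lineatorLin A W M (w ⊗ₜ f))) x y s := by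
  have h1 : val (K.lineatorLin A (V ⊗ W) M ((v ⊗ₜ[ℂ] w : V ⊗[ℂ] W) ⊗ₜ f)) x y s =
      ((K.char (A.label s) g * K.char (A.label s) h) • ((v ⊗ₜ[ℂ] w) ⊗ₜ[ℂ]
        val f (h⁻¹ • g⁻¹ • x) (h⁻¹ • g⁻¹ • y) s) : (V ⊗[ℂ] W) ⊗[ℂ] M) := by
    rw [← map_mul, ← mul_smul, ← mul_smul, ← mul_inv_rev]
    exact K.val_lineatorLin (V := V ⊗ W) (tmul_mem (m := (· * ·)) rfl hv hw) f x y s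
  have h2 := K.val_lineatorLin hw f (g⁻¹ • x) (g⁻¹ • y) s
  have h3 := K.val_lineatorLin (M := W ⊙ₗ M) hv (K.lineatorLin A W M (w ⊗ₜ f)) x y s
  rw [h3, h2]
  exact (congrArg _ h1).trans (assoc_smul_tmul _ _ _ _ _)

noncomputable instance laxLeftLinear : (K.functor A).LaxLeftLinear (GrVect G) where
  μₗ V M := K.lineator A V M
  μₗ_naturality_left f M := GrVect.hom_ext <| tensor_ext fun g v hv t => obj_ext fun x y s => by
    refine (K.val_lineatorLin (f.map_gr g v hv) t x y s).trans ?_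
    refine Eq.trans ?_ (congrArg (TensorProduct.map f.lin (LinearMap.id (M := M) (R := ℂ)))
      (K.val_lineatorLin hv t x y s)).symm
    exact (map_smul_tmul f.lin (LinearMap.id (M := M) (R := ℂ)) _ _ _).symm
  μₗ_naturality_right V M N f := GrVect.hom_ext <| tensor_ext fun g v hv t =>
    obj_ext fun x y s => by
    refine (K.val_lineatorLin hv _ x y s).trans ?_
    refine Eq.trans ?_ (congrArg (TensorProduct.map LinearMap.id f.lin)
      (K.val_lineatorLin hv t x y s)).symm
    exact (map_smul_tmul (LinearMap.id (M := V) (R := ℂ)) f.lin _ _ _).symm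
  μₗ_associativity V W M := GrVect.hom_ext <| tensor_ext₂ fun g v hv h w hw f =>
      obj_ext fun x y s => by
    exact K.assoc_val_lineatorLin hv hw f x y s
  μₗ_unitality M := GrVect.hom_ext <| tensor_ext fun g (c : ℂ) hc f => obj_ext fun x y s => by
    refine Eq.trans ?_ (congrArg (TensorProduct.lid ℂ M)
      (K.val_lineatorLin (V := single 1) hc f x y s)).symm
    refine Eq.trans ?_ (lid_smul_tmul _ c _).symm
    by_cases hg : g = 1
    · subst hg
      rw [map_one, one_smul, inv_one, one_smul, one_smul]
      rfl
    · refine Eq.trans (b := c • val f x y s) rfl ?_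
      rw [mem_single hc hg, zero_smul, zero_smul, smul_zero]

end Action2

end KernelData

namespace KernelData

open GrVect

section Strong

variable {I : Type} [Fintype I] [DecidableEq I] {D : FusionData I} {G X : Type} [Group G]
  [MulAction G X] [Fintype X] [DecidableEq X] (K : KernelData D G X) [Fintype G] {A B : FusionObj D}

theorem lineatorLin_injective (A : FusionObj D) (V : GrVect G) (M : GrVect X) :
    Function.Injective (K.lineatorLin A V M) := by
  -- the left inverse splits a vector of `V ⊙ M` into its components, and moves them back
  let δ : K.obj A (V ⊙ₗ M) →ₗ[ℂ] V ⊗[ℂ] K.obj A M := ∑ x, ∑ y, ∑ s, ∑ g,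
    (K.char (A.label s) g)⁻¹ • (TensorProduct.map (V.proj g)
      (K.incl A M (g⁻¹ • x) (g⁻¹ • y) s) : V ⊗[ℂ] M →ₗ[ℂ] V ⊗[ℂ] K.obj A M) ∘ₗ
        (valₗ (M := V ⊙ₗ M) x y s)
  have hδ : δ ∘ₗ K.lineatorLin A V M = LinearMap.id := tensor_ext fun g v hv f => by
    have h1 : ∀ x y s, (∑ h, (K.char (A.label s) h)⁻¹ • (TensorProduct.map (V.proj h)
        (K.incl A M (h⁻¹ • x) (h⁻¹ • y) s) : V ⊗[ℂ] M →ₗ[ℂ] V ⊗[ℂ] K.obj A M)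
          (val (K.lineatorLin A V M (v ⊗ₜ f)) x y s)) = v ⊗ₜ[ℂ] K.incl A M (g⁻¹ • x) (g⁻¹ • y) s
            (val f (g⁻¹ • x) (g⁻¹ • y) s) := fun x y s => by
      rw [K.val_lineatorLin hv]
      refine (Finset.sum_eq_single g (fun h _ hg => ?_) (by simp)).trans ?_
      · rw [map_smul_tmul, proj_of_mem_ne hg hv, TensorProduct.zero_tmul, smul_zero, smul_zero]
      · rw [map_smul_tmul, proj_of_mem hv, smul_smul, inv_mul_cancel₀ (K.char_ne_zero _ g),
          one_smul]
    refine Eq.trans (b := ∑ x, ∑ y, ∑ s, ∑ h, (K.char (A.label s) h)⁻¹ • (TensorProduct.map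
      (V.proj h) (K.incl A M (h⁻¹ • x) (h⁻¹ • y) s) : V ⊗[ℂ] M →ₗ[ℂ] V ⊗[ℂ] K.obj A M)
          (val (K.lineatorLin A V M (v ⊗ₜ f)) x y s)) ?_ ?_
    · simp only [δ, LinearMap.comp_apply, LinearMap.sum_apply]
      rfl
    · simp only [h1, ← TensorProduct.tmul_sum]
      refine congrArg (v ⊗ₜ[ℂ] ·) (Eq.trans ?_ (sum_incl f))
      refine Eq.trans (Finset.sum_congr rfl fun x _ => ?_) (Equiv.sum_comp (MulAction.toPerm g⁻¹)
        fun x => ∑ y, ∑ s, K.incl A M x y s (val f x y s))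
      exact Equiv.sum_comp (MulAction.toPerm g⁻¹)
        fun y => ∑ s, K.incl A M (g⁻¹ • x) y s (val f (g⁻¹ • x) y s)
  exact Function.LeftInverse.injective (g := δ) (LinearMap.congr_fun hδ)

theorem lineatorLin_surjective (A : FusionObj D) (V : GrVect G) (M : GrVect X) :
    Function.Surjective (K.lineatorLin A V M) := by
  have key : ∀ x y s (m : (V ⊙ₗ M : GrVect X)), m ∈ (V ⊙ₗ M : GrVect X).gr x →
      K.incl A (V ⊙ₗ M) x y s m ∈ LinearMap.range (K.lineatorLin A V M) := fun x y s =>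
    map_gr_of_tmul (V := V) (W := M) (K.incl A (V ⊙ₗ M) x y s) _ x fun g x₀ hx v hv m hm => by
      refine ⟨(K.char (A.label s) g)⁻¹ • (v ⊗ₜ K.incl A M x₀ (g⁻¹ • y) s m),
        obj_ext fun x' y' s' => ?_⟩
      rw [map_smul, val_smul, K.val_lineatorLin hv, val_incl]
      refine Eq.trans ?_ (val_incl (M := V ⊙ₗ M) x y s _ x' y' s').symm
      have hx' : x₀ = g⁻¹ • x := by rw [← hx]; exact (inv_smul_smul g x₀).symm
      subst hx'
      have hiff : (g⁻¹ • x' = g⁻¹ • x ∧ g⁻¹ • y' = g⁻¹ • y ∧ s' = s ∧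
          K.adm (A.label s) (g⁻¹ • x) (g⁻¹ • y)) ↔
          (x' = x ∧ y' = y ∧ s' = s ∧ K.adm (A.label s) x y) := by
        simp only [K.adm_smul_iff, smul_left_cancel_iff]
      by_cases h : x' = x ∧ y' = y ∧ s' = s ∧ K.adm (A.label s) x y
      · rw [if_pos (hiff.2 h), if_pos h, h.2.2.1, proj_of_mem hm]
        refine (smul_smul (M := ℂ) (α := V ⊗[ℂ] M) _ _ _).trans ?_
        rw [inv_mul_cancel₀ (K.char_ne_zero _ g), one_smul]
        exact (proj_of_mem (V := V ⊙ₗ M) (tmul_mem (m := (· • ·)) hx hv hm)).symm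
      · rw [if_neg fun h' => h (hiff.1 h'), if_neg h, TensorProduct.tmul_zero]
        exact ((congrArg _ (smul_zero (A := V ⊗[ℂ] M) _)).trans (smul_zero (A := V ⊗[ℂ] M) _))
  intro h
  rw [← LinearMap.mem_range, ← sum_incl h]
  exact Submodule.sum_mem _ fun x _ => Submodule.sum_mem _ fun y _ => Submodule.sum_mem _ fun s _ =>
    key x y s _ (val_mem h x y s)

noncomputable instance leftLinear : (K.functor A).LeftLinear (GrVect G) :=
  leftLinearOfIsIso (K.functor A) fun V M =>
    isIso_of_bijective (K.lineator A V M)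
      ⟨K.lineatorLin_injective A V M, K.lineatorLin_surjective A V M⟩

variable (A) in
/-- The module endofunctor attached to `A`. -/
noncomputable def modEnd : ModEnd (GrVect G) (GrVect X) := ⟨K.functor A⟩

theorem tmul_sum_smul_smul {E F J : Type} [AddCommGroup E] [Module ℂ E] [AddCommGroup F]
    [Module ℂ F] [Fintype J] (e : E) (c : J → ℂ) (d : J → ℂ) (x : J → F) (k : ℂ)
    (h : ∀ j, d j * c j = k * d j) :
    ∑ j, d j • c j • (e ⊗ₜ[ℂ] x j) = k • (e ⊗ₜ[ℂ] ∑ j, d j • x j) := by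
  rw [TensorProduct.tmul_sum, Finset.smul_sum]
  refine Finset.sum_congr rfl fun j _ => ?_
  rw [smul_smul, h, TensorProduct.tmul_smul, smul_smul]

/-- The morphism of module endofunctors attached to a morphism `h : A ⟶ B`. -/
noncomputable def modEndHom (h : A ⟶ B) : K.modEnd A ⟶ K.modEnd B where
  nat := natTrans h
  comm V M := GrVect.hom_ext <| tensor_ext fun g v hv f => obj_ext fun x y t => by
    refine (Finset.sum_congr rfl fun s _ =>
      congrArg (h.mat s t • ·) (K.val_lineatorLin hv f x y s)).trans ?_
    refine Eq.trans ?_ (K.val_lineatorLin hv _ x y t).symm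
    refine tmul_sum_smul_smul v _ _ _ _ fun s => ?_
    by_cases hst : A.label s = B.label t
    · rw [hst, mul_comm]
    · rw [h.supp s t hst, zero_mul, mul_zero]

/-- The functor from the category with fusion data `D` to the module endofunctors. -/
noncomputable def toModEnd : FusionObj D ⥤ ModEnd (GrVect G) (GrVect X) where
  obj := K.modEnd
  map := K.modEndHom
  map_id A := ModEnd.hom_ext fun M => gr_hom_ext fun f x y t => by
    refine (val_natApp (𝟙 A) f x y t).trans ?_
    simp only [FusionObj.id_mat, ite_smul, one_smul, zero_smul, Finset.sum_ite_eq',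
      Finset.mem_univ, if_true]
    rfl
  map_comp h h' := ModEnd.hom_ext fun M => gr_hom_ext fun f x y t => by
    refine (val_natApp (h ≫ h') f x y t).trans ?_
    refine Eq.trans ?_ (val_natApp h' ((natApp h M).lin f) x y t).symm
    refine Eq.trans ?_ (Finset.sum_congr rfl fun s _ =>
      congrArg (h'.mat s t • ·) (val_natApp h f x y s)).symm
    simp only [FusionObj.comp_mat, Finset.sum_smul, Finset.smul_sum, smul_smul]
    rw [Finset.sum_comm]
    simp only [mul_comm]

instance : K.toModEnd.Additive where
  map_add {A B h h'} := ModEnd.hom_ext fun M => gr_hom_ext fun f x y t => by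
    refine (val_natApp (h + h') f x y t).trans ?_
    simp only [FusionObj.add_mat, add_smul, Finset.sum_add_distrib]
    rfl

instance : K.toModEnd.Linear ℂ where
  map_smul h c := ModEnd.hom_ext fun M => gr_hom_ext fun f x y t => by
    refine (val_natApp (c • h) f x y t).trans ?_
    simp only [FusionObj.smul_mat, mul_smul, ← Finset.smul_sum]
    rfl

end Strong

end KernelData

/-! ### The monoidal structure of the functor to module endofunctors -/

/-- Sums over the summands of `A ⊗ B` are sums over the pairs of summands and the simple objects of
their products. -/
theorem FusionObj.sum_tensorIdx {I : Type} [Fintype I] [DecidableEq I] {D : FusionData I}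
    (A B : FusionObj D) {E : Type*} [AddCommMonoid E] (f : A.ι → B.ι → I → E) :
    ∑ p : TensorIdx A B, f p.fst p.snd p.out =
      ∑ s, ∑ t, ∑ k, if D.N (A.label s) (B.label t) k then f s t k else 0 := by
  have h := (Finset.sum_subtype (F := inferInstance) (p := fun p : A.ι × B.ι × I =>
      D.N (A.label p.1) (B.label p.2.1) p.2.2) (Finset.univ.filter
    fun p : A.ι × B.ι × I => D.N (A.label p.1) (B.label p.2.1) p.2.2)
    (fun p => by simp) (fun p => f p.1 p.2.1 p.2.2)).symm
  refine (Eq.trans (Fintype.sum_equiv (tensorIdxEquiv A B) _ _ fun p => rfl) h).trans ?_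
  simp only [Finset.sum_filter, Fintype.sum_prod_type]

/-- A column of the associator is a sum over one intermediate simple object, weighted by the
F-symbols. -/
theorem FusionObj.sum_assocHom {I : Type} [Fintype I] [DecidableEq I] {D : FusionData I}
    (A B C : FusionObj D) {E : Type*} [AddCommGroup E] [Module ℂ E]
    (p : TensorIdx A (tensor B C)) (g : A.ι → B.ι → C.ι → I → I → E) :
    ∑ q : TensorIdx (tensor A B) C,
      (assocHom A B C).mat q p • g q.fst.fst q.fst.snd q.snd q.fst.out q.out =
      ∑ e, if D.N (A.label p.fst) (B.label p.snd.fst) e ∧ D.N e (C.label p.snd.snd) p.out then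
        D.F (A.label p.fst) (B.label p.snd.fst) (C.label p.snd.snd) p.out e p.snd.out •
          g p.fst p.snd.fst p.snd.snd e p.out else 0 := by
  let c : A.ι → B.ι → C.ι → I → I → E := fun s t u e d =>
    (if s = p.fst ∧ t = p.snd.fst ∧ u = p.snd.snd ∧ d = p.out then
      D.F (A.label s) (B.label t) (C.label u) d e p.snd.out else 0) • g s t u e d
  have h1 : ∀ r : TensorIdx A B, (∑ u, ∑ d, if D.N r.out (C.label u) d then
      c r.fst r.snd u r.out d else 0) = if D.N r.out (C.label p.snd.snd) p.out then
        c r.fst r.snd p.snd.snd r.out p.out else 0 := fun r => by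
    rw [Finset.sum_eq_single p.snd.snd (fun u _ hu => Finset.sum_eq_zero fun d _ => ?_) (by simp),
      Finset.sum_eq_single p.out (fun d _ hd => ?_) (by simp)]
    · simp [c, hd]
    · simp [c, hu]
  refine (sum_tensorIdx (tensor A B) C fun r u d => c r.fst r.snd u r.out d).trans ?_
  rw [Finset.sum_congr rfl fun r _ => h1 r]
  refine (sum_tensorIdx A B fun s t e => if D.N e (C.label p.snd.snd) p.out then
    c s t p.snd.snd e p.out else 0).trans ?_
  rw [Finset.sum_eq_single p.fst (fun s _ hs => Finset.sum_eq_zero fun t _ =>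
      Finset.sum_eq_zero fun e _ => ?_) (by simp),
    Finset.sum_eq_single p.snd.fst (fun t _ ht => Finset.sum_eq_zero fun e _ => ?_) (by simp)]
  · refine Finset.sum_congr rfl fun e _ => ?_
    simp only [c, and_self, if_true]
    rw [ite_and]
  · simp [c, ht]
  · simp [c, hs]

namespace KernelData

open GrVect

/-- The comparison of two sums over intermediate points, of which one is moved by a permutation `σ`,
from the comparison of their coefficients. -/
theorem ite_sum_smul_tmul {E F : Type} [AddCommGroup E] [Module ℂ E] [AddCommGroup F]
    [Module ℂ F] {P Q : Prop} [Decidable P] [Decidable Q] (hPQ : P ↔ Q) {J : Type}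
    [Fintype J] (σ : J ≃ J) (a b : J → ℂ)
    (c k : ℂ) (v : E) (u : J → F) (w : J → E ⊗[ℂ] F) (hw : ∀ y, w y = c • (v ⊗ₜ[ℂ] u (σ y)))
    (h : P → ∀ y, u (σ y) ≠ 0 → a y * c = k * b (σ y)) :
    (if P then ∑ y, a y • w y else 0) = k • (v ⊗ₜ[ℂ] if Q then ∑ y, b y • u y else 0) := by
  by_cases hP : P
  · rw [if_pos hP, if_pos (hPQ.1 hP), ← Equiv.sum_comp σ fun y => b y • u y,
      TensorProduct.tmul_sum, Finset.smul_sum]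
    refine Finset.sum_congr rfl fun y _ => ?_
    rw [hw]
    by_cases hu : u (σ y) = 0
    · simp [hu]
    · rw [smul_smul, h hP y hu, TensorProduct.tmul_smul, smul_smul]
  · rw [if_neg hP, if_neg fun h => hP (hPQ.2 h), TensorProduct.tmul_zero, smul_zero]

section Monoidal

variable {I : Type} [Fintype I] [DecidableEq I] {D : FusionData I} {G X : Type} [Group G]
  [MulAction G X] [Fintype X] [DecidableEq X] (K : KernelData D G X)

section Tensorator

variable {K} {A B C : FusionObj D} {M N : GrVect X}

/-- An element of `K.obj A M`, given by its components. -/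
def ofVal (F : X → X → A.ι → M) (hmem : ∀ x y s, F x y s ∈ M.gr x)
    (hadm : ∀ x y s, ¬ K.adm (A.label s) x y → F x y s = 0) : K.obj A M :=
  (⟨F, fun x y s => ⟨hmem x y s, hadm x y s⟩⟩ : K.sub A M)

@[simp] theorem val_ofVal (F : X → X → A.ι → M) (hmem : ∀ x y s, F x y s ∈ M.gr x)
    (hadm : ∀ x y s, ¬ K.adm (A.label s) x y → F x y s = 0) (x y : X) (s : A.ι) :
    val (ofVal (K := K) F hmem hadm) x y s = F x y s := rfl

/-- The components of an element of the value at `M` of the composite of two functors. -/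
noncomputable def val₂ (F : K.obj B (K.obj A M)) (x y z : X) (s : A.ι) (t : B.ι) : M :=
  val (val F y z t) x y s

theorem val₂_mem (F : K.obj B (K.obj A M)) (x y z : X) (s : A.ι) (t : B.ι) :
    val₂ F x y z s t ∈ M.gr x := val_mem _ _ _ _

theorem val₂_eq_zero_left (F : K.obj B (K.obj A M)) {x y : X} (z : X) {s : A.ι} (t : B.ι)
    (h : ¬ K.adm (A.label s) x y) : val₂ F x y z s t = 0 := val_eq_zero _ h

theorem val₂_eq_zero_right (F : K.obj B (K.obj A M)) (x : X) {y z : X} (s : A.ι) {t : B.ι}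
    (h : ¬ K.adm (B.label t) y z) : val₂ F x y z s t = 0 := by
  unfold val₂
  rw [val_eq_zero F h, val_zero]

theorem obj_ext₂ {F F' : K.obj B (K.obj A M)}
    (h : ∀ x y z s t, val₂ F x y z s t = val₂ F' x y z s t) : F = F' :=
  obj_ext fun y z t => obj_ext fun x y' s => by
    by_cases hy : y' = y
    · rw [hy]
      exact h x y z s t
    · rw [val_of_mem (val_mem F y z t) s hy, val_of_mem (val_mem F' y z t) s hy]

variable (K A B M) in
/-- The tensorator, as a linear map: it contracts the paths `x → y → z` to edges `x → z`, with
coefficients the associativity constraints `K.T`. -/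
noncomputable def tensoratorLin : K.obj B (K.obj A M) →ₗ[ℂ] K.obj (FusionObj.tensor A B) M :=
  mkLin (fun F x z p => if K.adm p.out x z then
      ∑ y, K.T (A.label p.fst) (B.label p.snd) p.out x y z • val₂ F x y z p.fst p.snd else 0)
    (fun F F' x z p => by
      split_ifs
      · rw [← Finset.sum_add_distrib]
        exact Finset.sum_congr rfl fun y _ => smul_add _ _ _
      · rw [add_zero])
    (fun c F x z p => by
      split_ifs
      · rw [Finset.smul_sum]
        exact Finset.sum_congr rfl fun y _ => smul_comm _ _ _
      · rw [smul_zero])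
    (fun F x z p => by
      split_ifs
      · exact Submodule.sum_mem _ fun y _ => Submodule.smul_mem _ _ (val₂_mem F _ _ _ _ _)
      · exact zero_mem _)
    (fun F x z p h => if_neg h)

theorem val_tensoratorLin (F : K.obj B (K.obj A M)) (x z : X) (p : FusionObj.TensorIdx A B) :
    val (K.tensoratorLin A B M F) x z p = if K.adm p.out x z then
      ∑ y, K.T (A.label p.fst) (B.label p.snd) p.out x y z • val₂ F x y z p.fst p.snd else 0 := rfl

variable (K A B M) in
/-- The tensorator at `M`. -/
noncomputable def tensorator : K.obj B (K.obj A M) ⟶ K.obj (FusionObj.tensor A B) M where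
  lin := K.tensoratorLin A B M
  map_gr z₀ F hF := mem_gr fun x z p hz => by
    rw [val_tensoratorLin]
    split_ifs
    · refine Finset.sum_eq_zero fun y _ => ?_
      unfold val₂
      rw [val_of_mem hF p.snd hz, val_zero, smul_zero]
    · rfl

variable (K A B M) in
theorem tensoratorLin_injective : Function.Injective (K.tensoratorLin A B M) := by
  rw [injective_iff_map_eq_zero]
  intro F hF
  refine obj_ext₂ fun x y z s t => ?_
  change val₂ F x y z s t = 0
  by_cases h1 : K.adm (A.label s) x y
  · by_cases h2 : K.adm (B.label t) y z
    · have h3 : ∀ k, D.N (A.label s) (B.label t) k → K.adm k x z →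
          ∑ y', K.T (A.label s) (B.label t) k x y' z • val₂ F x y' z s t = 0 := fun k hk hxz => by
        have := val_tensoratorLin F x z ⟨s, t, k, hk⟩
        rw [hF, val_zero, if_pos hxz] at this
        exact this.symm
      calc val₂ F x y z s t = ∑ y', (∑ k, if D.N (A.label s) (B.label t) k ∧ K.adm k x z then
            K.T' (A.label s) (B.label t) k x y z * K.T (A.label s) (B.label t) k x y' z else 0) •
              val₂ F x y' z s t := by
            rw [Finset.sum_eq_single y (fun y' _ hy => ?_) (by simp), K.T'_T _ _ _ _ _ _ h1 h2 h1 h2,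
              if_pos rfl, one_smul]
            by_cases h1' : K.adm (A.label s) x y'
            · by_cases h2' : K.adm (B.label t) y' z
              · rw [K.T'_T _ _ _ _ _ _ h1 h2 h1' h2', if_neg hy.symm, zero_smul]
              · rw [val₂_eq_zero_right F x s h2', smul_zero]
            · rw [val₂_eq_zero_left F z t h1', smul_zero]
        _ = ∑ k, ∑ y', (if D.N (A.label s) (B.label t) k ∧ K.adm k x z then
            K.T' (A.label s) (B.label t) k x y z * K.T (A.label s) (B.label t) k x y' z else 0) •
              val₂ F x y' z s t := by
            simp only [Finset.sum_smul]
            exact Finset.sum_comm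
        _ = 0 := Finset.sum_eq_zero fun k _ => by
            split_ifs with hk
            · simp only [mul_smul, ← Finset.smul_sum]
              rw [h3 k hk.1 hk.2, smul_zero]
            · simp
    · exact val₂_eq_zero_right F x s h2
  · exact val₂_eq_zero_left F z t h1

/-- The components of an element of the value of the functor attached to a tensor product, extended
by zero. -/
def valHat (f : K.obj (FusionObj.tensor A B) M) (x z : X) (s : A.ι) (t : B.ι) (k : I) : M :=
  if h : D.N (A.label s) (B.label t) k then val f x z ⟨s, t, k, h⟩ else 0

theorem valHat_mem (f : K.obj (FusionObj.tensor A B) M) (x z : X) (s : A.ι) (t : B.ι) (k : I) :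
    valHat f x z s t k ∈ M.gr x := by
  unfold valHat
  split_ifs
  · exact val_mem _ _ _ _
  · exact zero_mem _

variable (K A B M) in
theorem tensoratorLin_surjective : Function.Surjective (K.tensoratorLin A B M) := by
  intro f
  -- the preimage of `f` has the component `∑ k, T' f_k` on the path `x → y → z`
  let c : X → X → X → A.ι → B.ι → M := fun x y z s t =>
    if K.adm (A.label s) x y ∧ K.adm (B.label t) y z then
      ∑ k, if D.N (A.label s) (B.label t) k ∧ K.adm k x z then
        K.T' (A.label s) (B.label t) k x y z • valHat f x z s t k else 0
    else 0
  have hc : ∀ x y z s t, c x y z s t ∈ M.gr x := fun x y z s t => by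
    dsimp only [c]
    split_ifs
    · refine Submodule.sum_mem _ fun k _ => ?_
      split_ifs
      · exact Submodule.smul_mem _ _ (valHat_mem f _ _ _ _ _)
      · exact zero_mem _
    · exact zero_mem _
  let F : K.obj B (K.obj A M) := ofVal
    (fun y z t => ofVal (fun x y' s => if y' = y then c x y z s t else 0)
      (fun x y' s => by
        split_ifs
        · exact hc x y z s t
        · exact zero_mem _)
      (fun x y' s h => by
        split_ifs with h'
        · exact if_neg fun h'' => h (h' ▸ h''.1)
        · rfl))
    (fun y z t => mem_gr fun x y' s h => if_neg h)
    (fun y z t h => obj_ext fun x y' s => by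
      rw [val_ofVal]
      split_ifs with h'
      · exact if_neg fun h'' => h h''.2
      · rfl)
  have hF : ∀ x y z s t, val₂ F x y z s t = c x y z s t := fun x y z s t => if_pos rfl
  refine ⟨F, obj_ext fun x z p => ?_⟩
  obtain ⟨s, t, k, hk⟩ := p
  rw [val_tensoratorLin]
  dsimp only
  by_cases hxz : K.adm k x z
  · rw [if_pos hxz]
    calc ∑ y, K.T (A.label s) (B.label t) k x y z • val₂ F x y z s t
        = ∑ y, ∑ k', (if K.adm (A.label s) x y ∧ K.adm (B.label t) y z then
            K.T (A.label s) (B.label t) k x y z * K.T' (A.label s) (B.label t) k' x y z else 0) •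
              if D.N (A.label s) (B.label t) k' ∧ K.adm k' x z then valHat f x z s t k' else 0 := by
          refine Finset.sum_congr rfl fun y _ => ?_
          rw [hF]
          dsimp only [c]
          split_ifs
          · rw [Finset.smul_sum]
            refine Finset.sum_congr rfl fun k' _ => ?_
            split_ifs
            · rw [smul_smul]
            · rw [smul_zero, smul_zero]
          · simp
      _ = ∑ k', (∑ y, if K.adm (A.label s) x y ∧ K.adm (B.label t) y z then
            K.T (A.label s) (B.label t) k x y z * K.T' (A.label s) (B.label t) k' x y z else 0) •
              if D.N (A.label s) (B.label t) k' ∧ K.adm k' x z then valHat f x z s t k' else 0 := by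
          simp only [Finset.sum_smul]
          exact Finset.sum_comm
      _ = val f x z ⟨s, t, k, hk⟩ := by
          rw [Finset.sum_eq_single k (fun k' _ hk' => ?_) (by simp), K.T_T' _ _ _ _ _ _ hk hxz hk hxz,
            if_pos rfl, one_smul, if_pos ⟨hk, hxz⟩]
          · exact dif_pos hk
          · split_ifs with h
            · rw [K.T_T' _ _ _ _ _ _ hk hxz h.1 h.2, if_neg hk'.symm, zero_smul]
            · rw [smul_zero]
  · rw [if_neg hxz]
    exact (val_eq_zero f hxz).symm

variable (K A B M) in
theorem isIso_tensorator : IsIso (K.tensorator A B M) :=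
  isIso_of_bijective _ ⟨K.tensoratorLin_injective A B M, K.tensoratorLin_surjective A B M⟩

theorem tensorator_naturality (φ : M ⟶ N) :
    map B (map A φ) ≫ K.tensorator A B N = K.tensorator A B M ≫ map (FusionObj.tensor A B) φ :=
  gr_hom_ext fun F x z p => by
    refine (val_tensoratorLin _ x z p).trans
      (Eq.trans ?_ (congrArg φ.lin (val_tensoratorLin F x z p)).symm)
    split_ifs
    · rw [map_sum]
      exact Finset.sum_congr rfl fun y _ => (map_smul φ.lin _ _).symm
    · exact (map_zero _).symm

theorem natApp_tensorator_left (h : A ⟶ B) :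
    map C (natApp h M) ≫ K.tensorator B C M = K.tensorator A C M ≫ natApp (h ▷ C) M :=
  gr_hom_ext fun F x z p => by
    refine (val_tensoratorLin _ x z p).trans ?_
    refine Eq.trans ?_ (FusionObj.sum_tensorIdx A C fun s t k =>
      (if k = p.out then h.mat s p.fst * FusionObj.Hom.mat (𝟙 C) t p.snd else 0) • if K.adm k x z then
        ∑ y, K.T (A.label s) (C.label t) k x y z • val₂ F x y z s t else 0).symm
    have h1 : ∀ y, val₂ ((map C (natApp h M)).lin F) x y z p.fst p.snd =
      ∑ s, h.mat s p.fst • val₂ F x y z s p.snd := fun y => rfl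
    simp only [h1]
    have h2 : ∀ s, (∑ t, ∑ k, if D.N (A.label s) (C.label t) k then
      (if k = p.out then h.mat s p.fst * FusionObj.Hom.mat (𝟙 C) t p.snd else 0) • (if K.adm k x z then
        ∑ y, K.T (A.label s) (C.label t) k x y z • val₂ F x y z s t else 0) else 0) =
      if K.adm p.out x z then
        ∑ y, K.T (B.label p.fst) (C.label p.snd) p.out x y z • h.mat s p.fst • val₂ F x y z s p.snd
      else 0 := fun s => by
      rw [Finset.sum_eq_single p.snd (fun t _ ht => Finset.sum_eq_zero fun k _ => ?_) (by simp),
        Finset.sum_eq_single p.out (fun k _ hk => ?_) (by simp)]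
      · rw [if_pos rfl, FusionObj.id_mat, if_pos rfl, mul_one]
        by_cases hs : A.label s = B.label p.fst
        · rw [hs, if_pos p.adm]
          split_ifs
          · rw [Finset.smul_sum]
            exact Finset.sum_congr rfl fun y _ => smul_comm _ _ _
          · rw [smul_zero]
        · simp [h.supp s _ hs]
      · rw [if_neg hk, zero_smul, ite_self]
      · rw [FusionObj.id_mat, if_neg ht, mul_zero, ite_self, zero_smul, ite_self]
    rw [Finset.sum_congr rfl fun s _ => h2 s]
    split_ifs
    · simp only [Finset.smul_sum]
      exact Finset.sum_comm
    · rw [Finset.sum_const_zero]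

theorem natApp_tensorator_right (h : B ⟶ C) :
    natApp h (K.obj A M) ≫ K.tensorator A C M = K.tensorator A B M ≫ natApp (A ◁ h) M :=
  gr_hom_ext fun F x z p => by
    refine (val_tensoratorLin _ x z p).trans ?_
    refine Eq.trans ?_ (FusionObj.sum_tensorIdx A B fun s t k =>
      (if k = p.out then FusionObj.Hom.mat (𝟙 A) s p.fst * h.mat t p.snd else 0) • if K.adm k x z then
        ∑ y, K.T (A.label s) (B.label t) k x y z • val₂ F x y z s t else 0).symm
    have h1 : ∀ y, val₂ ((natApp h (K.obj A M)).lin F) x y z p.fst p.snd =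
        ∑ t, h.mat t p.snd • val₂ F x y z p.fst t := fun y => by
      unfold val₂
      rw [val_natApp, val_sum]
      rfl
    simp only [h1]
    have h2 : ∀ t, (∑ k, if D.N (A.label p.fst) (B.label t) k then
      (if k = p.out then FusionObj.Hom.mat (𝟙 A) p.fst p.fst * h.mat t p.snd else 0) • (if K.adm k x z then
        ∑ y, K.T (A.label p.fst) (B.label t) k x y z • val₂ F x y z p.fst t else 0) else 0) =
      if K.adm p.out x z then
        ∑ y, K.T (A.label p.fst) (C.label p.snd) p.out x y z • h.mat t p.snd • val₂ F x y z p.fst t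
      else 0 := fun t => by
      rw [Finset.sum_eq_single p.out (fun k _ hk => ?_) (by simp)]
      · rw [if_pos rfl, FusionObj.id_mat, if_pos rfl, one_mul]
        by_cases ht : B.label t = C.label p.snd
        · rw [ht, if_pos p.adm]
          split_ifs
          · rw [Finset.smul_sum]
            exact Finset.sum_congr rfl fun y _ => smul_comm _ _ _
          · rw [smul_zero]
        · simp [h.supp t _ ht]
      · rw [if_neg hk, zero_smul, ite_self]
    rw [Finset.sum_eq_single p.fst (fun s _ hs => Finset.sum_eq_zero fun t _ =>
      Finset.sum_eq_zero fun k _ => ?_) (by simp), Finset.sum_congr rfl fun t _ => h2 t]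
    · split_ifs
      · simp only [Finset.smul_sum]
        exact Finset.sum_comm
      · rw [Finset.sum_const_zero]
    · rw [FusionObj.id_mat, if_neg hs, zero_mul, ite_self, zero_smul, ite_self]

/-- The module pentagon `K.T_assoc`, applied to the vectors attached to the paths
`x → y → z → w`. -/
theorem sum_T_assoc {E : Type*} [AddCommGroup E] [Module ℂ E] {i j k f d : I} {x w : X}
    (q : X → X → E) (hq : ∀ y z, q y z ≠ 0 → K.adm i x y ∧ K.adm j y z ∧ K.adm k z w)
    (h1 : D.N j k f) (h2 : D.N i f d) (h3 : K.adm d x w) :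
    (∑ e, if D.N i j e ∧ D.N e k d then D.F i j k d e f • ∑ z, K.T e k d x z w •
      (if K.adm e x z then ∑ y, K.T i j e x y z • q y z else 0) else 0) =
    ∑ y, K.T i f d x y w • if K.adm f y w then ∑ z, K.T j k f y z w • q y z else 0 := by
  calc _ = ∑ e, ∑ z, ∑ y, (if D.N i j e ∧ D.N e k d ∧ K.adm e x z then
        D.F i j k d e f * K.T i j e x y z * K.T e k d x z w else 0) • q y z := by
        refine Finset.sum_congr rfl fun e _ => ?_
        by_cases he : D.N i j e ∧ D.N e k d
        · rw [if_pos he, Finset.smul_sum]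
          refine Finset.sum_congr rfl fun z _ => ?_
          by_cases hz : K.adm e x z
          · rw [if_pos hz, Finset.smul_sum, Finset.smul_sum]
            refine Finset.sum_congr rfl fun y _ => ?_
            rw [if_pos ⟨he.1, he.2, hz⟩, smul_smul, smul_smul, mul_assoc, mul_comm (K.T e k d x z w),
              mul_assoc]
          · rw [if_neg hz, smul_zero, smul_zero]
            exact (Finset.sum_eq_zero fun y _ => by rw [if_neg fun h => hz h.2.2, zero_smul]).symm
        · rw [if_neg he]
          exact (Finset.sum_eq_zero fun z _ => Finset.sum_eq_zero fun y _ => by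
            rw [if_neg fun h => he ⟨h.1, h.2.1⟩, zero_smul]).symm
    _ = ∑ y, ∑ z, (∑ e, if D.N i j e ∧ D.N e k d ∧ K.adm e x z then
        D.F i j k d e f * K.T i j e x y z * K.T e k d x z w else 0) • q y z := by
        simp only [Finset.sum_smul]
        rw [Finset.sum_comm, Finset.sum_congr rfl fun z _ => Finset.sum_comm, Finset.sum_comm]
    _ = _ := by
        refine Finset.sum_congr rfl fun y _ => ?_
        have h4 : ∀ z, (∑ e, if D.N i j e ∧ D.N e k d ∧ K.adm e x z then
            D.F i j k d e f * K.T i j e x y z * K.T e k d x z w else 0) • q y z =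
            (if K.adm f y w then K.T j k f y z w * K.T i f d x y w else 0) • q y z := fun z => by
          by_cases hz : q y z = 0
          · rw [hz, smul_zero, smul_zero]
          · obtain ⟨h5, h6, h7⟩ := hq y z hz
            rw [K.T_assoc i j k f d x y z w h5 h6 h7 h1 h2 h3]
        rw [Finset.sum_congr rfl fun z _ => h4 z]
        split_ifs
        · rw [Finset.smul_sum]
          refine Finset.sum_congr rfl fun z _ => ?_
          rw [smul_smul, mul_comm]
        · simp

/-- The tensorators are associative. -/
theorem tensorator_assoc :
    map C (K.tensorator A B M) ≫ K.tensorator (A ⊗ B) C M ≫ natApp (α_ A B C).hom M =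
      K.tensorator B C (K.obj A M) ≫ K.tensorator A (B ⊗ C) M :=
  gr_hom_ext fun F x w p => by
    refine (FusionObj.sum_assocHom A B C p fun s t u e d => if K.adm d x w then
      ∑ z, K.T e (C.label u) d x z w • (if K.adm e x z then
        ∑ y, K.T (A.label s) (B.label t) e x y z • val₂ (val F z w u) x y z s t else 0)
      else 0).trans ?_
    refine Eq.trans ?_ (val_tensoratorLin _ x w p).symm
    by_cases h3 : K.adm p.out x w
    · rw [if_pos h3]
      simp only [if_pos h3]
      refine (sum_T_assoc (fun y z => val₂ (val F z w p.snd.snd) x y z p.fst p.snd.fst)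
        (fun y z hq => ⟨?_, ?_, ?_⟩) p.snd.adm p.adm h3).trans ?_
      · exact not_imp_comm.1 (val₂_eq_zero_left _ _ _) hq
      · exact not_imp_comm.1 (val₂_eq_zero_right _ _ _) hq
      · refine not_imp_comm.1 (fun h => ?_) hq
        rw [val_eq_zero F h]
        rfl
      · refine Finset.sum_congr rfl fun y _ => congrArg _ ?_
        refine Eq.trans ?_ (congrArg (fun f => val f x y p.fst)
          (val_tensoratorLin F y w p.snd)).symm
        split_ifs
        · rw [val_sum]
          rfl
        · rfl
    · rw [if_neg h3]
      simp only [if_neg h3, smul_zero, ite_self, Finset.sum_const_zero]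

variable (K M) in
/-- The comparison of the identity functor with the functor attached to the unit object. -/
noncomputable def unitComparisonLin : M →ₗ[ℂ] K.obj (FusionObj.unit D) M :=
  mkLin (fun m x y _ => if x = y then M.proj x m else 0)
    (fun m m' x y s => by split_ifs <;> simp)
    (fun c m x y s => by split_ifs <;> simp)
    (fun m x y s => by
      split_ifs
      · exact proj_mem x m
      · exact zero_mem _)
    (fun m x y s h => if_neg fun h' => h ((K.adm_one x y).2 h'))

theorem val_unitComparisonLin (m : M) (x y : X) (s : (FusionObj.unit D).ι) :
    val (K.unitComparisonLin M m) x y s = if x = y then M.proj x m else 0 := rfl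

variable (K M) in
/-- The comparison of the identity functor with the functor attached to the unit object, at `M`. -/
noncomputable def unitComparison : M ⟶ K.obj (FusionObj.unit D) M where
  lin := K.unitComparisonLin M
  map_gr x₀ m hm := mem_gr fun x y s hy => by
    rw [val_unitComparisonLin]
    split_ifs with h
    · exact proj_of_mem_ne (h ▸ hy) hm
    · rfl

variable (K M) in
theorem isIso_unitComparison : IsIso (K.unitComparison M) := by
  refine isIso_of_bijective _ ⟨(injective_iff_map_eq_zero _).2 fun m hm => ?_, fun f => ?_⟩
  · rw [← sum_proj m]
    refine Finset.sum_eq_zero fun x _ => ?_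
    have := congrArg (fun f => val f x x (show (FusionObj.unit D).ι from ())) hm
    exact (if_pos rfl).symm.trans this
  · let s₀ : (FusionObj.unit D).ι := ()
    refine ⟨∑ x, val f x x s₀, obj_ext fun x y s => ?_⟩
    refine (val_unitComparisonLin _ x y s).trans ?_
    split_ifs with h
    · subst h
      rw [map_sum, Finset.sum_eq_single x (fun y _ hy => proj_of_mem_ne hy.symm (val_mem f _ _ _))
        (by simp)]
      exact proj_of_mem (val_mem f _ _ _)
    · exact (val_eq_zero f fun h' => h ((K.adm_one x y).1 h')).symm

theorem val_natApp_leftUnitor (F : K.obj (FusionObj.tensor (FusionObj.unit D) A) M)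
    (c : X → X → A.ι → I → M)
    (hF : ∀ x z p, val F x z p = c x z p.snd p.out) (x z : X) (s : A.ι) :
    val ((natApp (FusionObj.lunitHom A) M).lin F) x z s = c x z s (A.label s) := by
  rw [val_natApp]
  simp only [hF]
  refine (FusionObj.sum_tensorIdx (FusionObj.unit D) A fun _ t k =>
    (if t = s then 1 else 0 : ℂ) • c x z t k).trans ?_
  refine (Fintype.sum_unique (ι := Unit) _).trans ?_
  rw [Finset.sum_eq_single s (fun t _ ht => by simp [ht]) (by simp)]
  refine (Finset.sum_eq_single (A.label s) (fun k _ hk => if_neg fun h => hk ((D.one_N _ _).1 h))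
    (by simp)).trans ?_
  rw [if_pos rfl, one_smul]
  exact if_pos ((D.one_N _ _).2 rfl)

theorem val_natApp_rightUnitor (F : K.obj (FusionObj.tensor A (FusionObj.unit D)) M)
    (c : X → X → A.ι → I → M)
    (hF : ∀ x z p, val F x z p = c x z p.fst p.out) (x z : X) (s : A.ι) :
    val ((natApp (FusionObj.runitHom A) M).lin F) x z s = c x z s (A.label s) := by
  rw [val_natApp]
  simp only [hF]
  refine (FusionObj.sum_tensorIdx A (FusionObj.unit D) fun t _ k =>
    (if t = s then 1 else 0 : ℂ) • c x z t k).trans ?_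
  refine (Finset.sum_congr rfl fun t _ => Fintype.sum_unique (ι := Unit) _).trans ?_
  rw [Finset.sum_eq_single s (fun t _ ht => by simp [ht]) (by simp)]
  refine (Finset.sum_eq_single (A.label s) (fun k _ hk => if_neg fun h => hk ((D.N_one _ _).1 h))
    (by simp)).trans ?_
  rw [if_pos rfl, one_smul]
  exact if_pos ((D.N_one _ _).2 rfl)

theorem tensorator_unit_left :
    map A (K.unitComparison M) ≫ K.tensorator (FusionObj.unit D) A M ≫
      natApp (FusionObj.lunitHom A) M = 𝟙 _ :=
  gr_hom_ext fun f x z s => by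
    refine (val_natApp_leftUnitor _ (fun x z t k => if K.adm k x z then
      ∑ y, K.T D.one (A.label t) k x y z • (if x = y then M.proj x (val f y z t) else 0) else 0)
      (fun x z p => rfl) x z s).trans ?_
    by_cases h : K.adm (A.label s) x z
    · rw [if_pos h, Finset.sum_eq_single x (fun y _ hy => by rw [if_neg hy.symm, smul_zero])
        (by simp), K.T_one_left _ _ _ h, if_pos rfl, one_smul]
      exact proj_of_mem (val_mem f x z s)
    · rw [if_neg h]
      exact (val_eq_zero f h).symm

theorem tensorator_unit_right :
    K.unitComparison (K.obj A M) ≫ K.tensorator A (FusionObj.unit D) M ≫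
      natApp (FusionObj.runitHom A) M = 𝟙 _ :=
  gr_hom_ext fun f x z s => by
    refine (val_natApp_rightUnitor _ (fun x z t k => if K.adm k x z then
      ∑ y, K.T (A.label t) D.one k x y z • val (if y = z then (K.obj A M).proj y f else 0) x y t
      else 0) (fun x z p => rfl) x z s).trans ?_
    by_cases h : K.adm (A.label s) x z
    · rw [if_pos h, Finset.sum_eq_single z (fun y _ hy => by rw [if_neg hy]; exact smul_zero _)
        (by simp), K.T_one_right _ _ _ h, if_pos rfl, one_smul]
      have h1 : val (∑ y, (K.obj A M).proj y f) x z s = val f x z s := by rw [sum_proj]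
      rw [val_sum] at h1
      refine Eq.trans ?_ h1
      exact (Finset.sum_eq_single z (fun y _ hy => val_of_mem (proj_mem y f) s hy.symm)
        (by simp)).symm
    · rw [if_neg h]
      exact (val_eq_zero f h).symm

end Tensorator

section Action

theorem proj_tmul [Fintype G] {V : GrVect G} {M : GrVect X} {g : G} {v : V} (hv : v ∈ V.gr g)
    (x : X) (m : M) :
    (V ⊙ₗ M).proj x (v ⊗ₜ[ℂ] m : V ⊗[ℂ] M) = (v ⊗ₜ[ℂ] M.proj (g⁻¹ • x) m : V ⊗[ℂ] M) := by
  induction m using induction_homogeneous with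
  | hz =>
    rw [map_zero, TensorProduct.tmul_zero]
    exact map_zero _
  | hadd m m' h h' =>
    rw [map_add, TensorProduct.tmul_add, TensorProduct.tmul_add, ← h, ← h']
    exact map_add _ _ _
  | hmem y m hm =>
    have hvm : (v ⊗ₜ[ℂ] m : V ⊗[ℂ] M) ∈ (V ⊙ₗ M).gr (g • y) := tmul_mem (m := (· • ·)) rfl hv hm
    by_cases h : x = g • y
    · subst h
      rw [inv_smul_smul, proj_of_mem hm]
      exact proj_of_mem hvm
    · rw [proj_of_mem_ne (fun h' => h (by rw [← h', smul_inv_smul])) hm, TensorProduct.tmul_zero]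
      exact proj_of_mem_ne h hvm

variable [Fintype G] {K} {A B C : FusionObj D} {M : GrVect X}

theorem val₂_lineatorLin {V : GrVect G} {g : G} {v : V} (hv : v ∈ V.gr g)
    (F : K.obj B (K.obj A M)) (x y z : X) (s : A.ι) (t : B.ι) :
    val₂ ((map B (K.lineator A V M)).lin (K.lineatorLin B V (K.obj A M) (v ⊗ₜ F))) x y z s t =
      (K.char (A.label s) g * K.char (B.label t) g) •
        (v ⊗ₜ[ℂ] val₂ F (g⁻¹ • x) (g⁻¹ • y) (g⁻¹ • z) s t : V ⊗[ℂ] M) := by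
  have h1 : val₂ ((map B (K.lineator A V M)).lin (K.lineatorLin B V (K.obj A M) (v ⊗ₜ F)))
      x y z s t = val (K.lineatorLin A V M (K.char (B.label t) g •
        (v ⊗ₜ[ℂ] val F (g⁻¹ • y) (g⁻¹ • z) t))) x y s :=
    congrArg (fun f => val (K.lineatorLin A V M f) x y s) (K.val_lineatorLin hv F y z t)
  rw [h1, map_smul, val_smul, K.val_lineatorLin hv, mul_comm]
  exact smul_smul (M := ℂ) (α := V ⊗[ℂ] M) _ _ _

variable (K A B M) in
theorem tensorator_comm (V : GrVect G) :
    (K.lineator B V (K.obj A M) ≫ map B (K.lineator A V M)) ≫ K.tensorator A B (V ⊙ₗ M) =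
      V ⊴ₗ K.tensorator A B M ≫ K.lineator (FusionObj.tensor A B) V M :=
  GrVect.hom_ext <| tensor_ext fun g v hv F => obj_ext fun x z p => by
    refine (val_tensoratorLin (M := V ⊙ₗ M) _ x z p).trans
      (Eq.trans ?_ (K.val_lineatorLin hv (K.tensoratorLin A B M F) x z p).symm)
    rw [val_tensoratorLin]
    refine ite_sum_smul_tmul (K.adm_smul_iff g⁻¹ _ _ _).symm (MulAction.toPerm g⁻¹) _ _ _ _ v
      (fun y => val₂ F (g⁻¹ • x) y (g⁻¹ • z) p.fst p.snd) _
      (fun y => val₂_lineatorLin hv F x y z p.fst p.snd) fun hxz y hu => ?_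
    have h1 := not_imp_comm.1 (val₂_eq_zero_left F _ _) hu
    have h2 := not_imp_comm.1 (val₂_eq_zero_right F _ _) hu
    have h3 := K.T_smul g _ _ _ _ _ _ p.adm h1 h2 ((K.adm_smul_iff g⁻¹ _ _ _).2 hxz)
    rw [mul_comm]
    refine Eq.trans ?_ h3.symm
    simp only [MulAction.toPerm_apply, smul_inv_smul]

variable (K A B) in
/-- The functors attached to `A` and `B` compose to the one attached to `A ⊗ B`. -/
noncomputable def tensoratorIso : K.modEnd A ⊗ K.modEnd B ≅ K.modEnd (A ⊗ B) :=
  ModEnd.mkIso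
    (NatIso.ofComponents (fun M => @asIso _ _ _ _ (K.tensorator A B M) (isIso_tensorator K A B M))
      fun φ => tensorator_naturality φ)
    fun V M => tensorator_comm K A B M V

variable (K M) in
theorem unitComparison_comm (V : GrVect G) :
    K.unitComparison (V ⊙ₗ M) =
      V ⊴ₗ K.unitComparison M ≫ K.lineator (FusionObj.unit D) V M :=
  GrVect.hom_ext <| tensor_ext fun g v hv m => obj_ext fun x y s => by
    refine (val_unitComparisonLin (M := V ⊙ₗ M) _ x y s).trans ?_
    refine Eq.trans ?_ (K.val_lineatorLin hv (K.unitComparisonLin M m) x y s).symm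
    rw [val_unitComparisonLin]
    have h1 : K.char ((FusionObj.unit D).label s) g = 1 := by
      change K.char D.one g = 1
      rw [K.char_one, MonoidHom.one_apply]
    rw [h1]
    refine Eq.trans ?_ (one_smul (M := ℂ) (α := V ⊗[ℂ] M) _).symm
    by_cases h : x = y
    · rw [if_pos h, if_pos (congrArg _ h)]
      exact proj_tmul hv x m
    · rw [if_neg h, if_neg fun h' => h (smul_left_cancel _ h'), TensorProduct.tmul_zero]
      rfl

variable (K) in
/-- The identity functor is the one attached to the unit object. -/
noncomputable def unitIso : 𝟙_ (ModEnd (GrVect G) (GrVect X)) ≅ K.modEnd (𝟙_ (FusionObj D)) :=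
  ModEnd.mkIso
    (NatIso.ofComponents (fun M => @asIso _ _ _ _ (K.unitComparison M) (isIso_unitComparison K M))
      fun {M N} φ => gr_hom_ext fun m x y s => by
        refine (val_unitComparisonLin (φ.lin m) x y s).trans ?_
        refine Eq.trans ?_ (congrArg φ.lin (val_unitComparisonLin m x y s)).symm
        split_ifs
        · exact (lin_proj φ x m).symm
        · exact (map_zero _).symm)
    fun V M => (Category.id_comp _).trans (unitComparison_comm K M V)

variable (K) in
/-- The monoidal structure of the functor to the module endofunctors. -/
noncomputable def coreMonoidal : K.toModEnd.CoreMonoidal where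
  εIso := K.unitIso
  μIso := K.tensoratorIso
  μIso_hom_natural_left f _ := ModEnd.hom_ext fun _ => natApp_tensorator_left f
  μIso_hom_natural_right _ f := ModEnd.hom_ext fun _ => natApp_tensorator_right f
  associativity _ _ _ := ModEnd.hom_ext fun _ =>
    tensorator_assoc.trans (Category.id_comp _).symm
  left_unitality _ := ModEnd.hom_ext fun _ => tensorator_unit_left.symm
  right_unitality _ := ModEnd.hom_ext fun _ => tensorator_unit_right.symm

noncomputable instance monoidal : K.toModEnd.Monoidal := K.coreMonoidal.toMonoidal

end Action

end Monoidal

end KernelData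

/-! ### Module endofunctors and the regular graded vector space -/

namespace GrVect

variable {X : Type} [Fintype X] [DecidableEq X]

/-- The graded vector space which has a basis with one vector in each degree. -/
noncomputable abbrev reg (X : Type) [Finite X] : GrVect X := free (id : X → X)

/-- The coordinates of a vector of the regular graded vector space. -/
def coord (f : reg X) (x : X) : ℂ := (show X → ℂ from f) x

/-- The basis vector of degree `x` of the regular graded vector space. -/
def pt (x : X) : reg X := (Pi.single x 1 : X → ℂ)

/-- The sum of the basis vectors of the regular graded vector space. -/
def unitVec (X : Type) [Fintype X] : reg X := (fun _ => 1 : X → ℂ)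

/-- The generator of the one-dimensional graded vector space of degree `x`. -/
def gen {X : Type} (x : X) : single x := (1 : ℂ)

theorem gen_mem {X : Type} (x : X) : gen x ∈ (single x).gr x := mem_single_self x 1

theorem pt_mem (x : X) : pt x ∈ (reg X).gr x :=
  mem_free.2 fun _ hj => Pi.single_eq_of_ne hj _

theorem sum_pt (f : reg X) : ∑ x, coord f x • pt x = f := by
  refine Eq.trans (Finset.sum_congr rfl fun x _ => ?_) (Finset.univ_sum_single (show X → ℂ from f))
  refine (Pi.single_smul (f := fun _ : X => ℂ) x (coord f x) (1 : ℂ)).symm.trans ?_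
  rw [smul_eq_mul, mul_one]
  rfl

theorem sum_pt_one : ∑ x, pt x = unitVec X := by
  refine Eq.trans (Finset.sum_congr rfl fun x _ => ?_) (sum_pt (unitVec X))
  exact (one_smul ℂ _).symm

theorem proj_pt (x y : X) : (reg X).proj x (pt y) = if x = y then pt y else 0 := by
  split_ifs with h
  · rw [h, proj_of_mem (pt_mem y)]
  · exact proj_of_mem_ne h (pt_mem y)

theorem proj_unitVec (x : X) : (reg X).proj x (unitVec X) = pt x := by
  rw [← sum_pt_one, map_sum]
  simp only [proj_pt, Finset.sum_ite_eq, Finset.mem_univ, if_true]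

theorem reg_hom_ext {M : GrVect X} {φ ψ : reg X ⟶ M} (h : ∀ x, φ.lin (pt x) = ψ.lin (pt x)) :
    φ = ψ :=
  hom_ext <| LinearMap.ext fun f => by
    rw [← sum_pt f, map_sum, map_sum]
    exact Finset.sum_congr rfl fun x _ => by rw [map_smul, map_smul, h]

/-- The morphism from the regular graded vector space with components those of `m`. -/
noncomputable def ofVec {M : GrVect X} (m : M) : reg X ⟶ M where
  lin :=
    { toFun := fun f => ∑ x, coord f x • M.proj x m
      map_add' := fun f f' => by
        rw [← Finset.sum_add_distrib]
        exact Finset.sum_congr rfl fun x _ => add_smul _ _ _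
      map_smul' := fun c f => by
        rw [Finset.smul_sum]
        exact Finset.sum_congr rfl fun x _ => mul_smul _ _ _ }
  map_gr x f hf := Submodule.sum_mem _ fun y _ => by
    by_cases h : y = x
    · exact Submodule.smul_mem _ _ (h ▸ proj_mem y m)
    · have h1 : coord f y = 0 := mem_free.1 hf y h
      rw [h1, zero_smul]
      exact zero_mem _

theorem ofVec_apply {M : GrVect X} (m : M) (f : reg X) :
    (ofVec m).lin f = ∑ x, coord f x • M.proj x m := rfl

theorem ofVec_pt {M : GrVect X} (m : M) (x : X) : (ofVec m).lin (pt x) = M.proj x m := by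
  have h : ∀ y, coord (pt x) y = if x = y then 1 else 0 := fun y => by
    simp [coord, pt, Pi.single_apply, eq_comm]
  rw [ofVec_apply]
  simp [h]

theorem ofVec_comp {M N : GrVect X} (m : M) (φ : M ⟶ N) : ofVec m ≫ φ = ofVec (φ.lin m) :=
  reg_hom_ext fun x => by
    rw [comp_lin, LinearMap.comp_apply, ofVec_pt, lin_proj, ofVec_pt]

theorem ofVec_add {M : GrVect X} (m m' : M) : ofVec (m + m') = ofVec m + ofVec m' :=
  reg_hom_ext fun x => by
    rw [add_lin, LinearMap.add_apply, ofVec_pt, ofVec_pt, ofVec_pt, map_add]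

theorem ofVec_smul {M : GrVect X} (c : ℂ) (m : M) : ofVec (c • m) = c • ofVec m :=
  reg_hom_ext fun x => by
    rw [smul_lin, LinearMap.smul_apply, ofVec_pt, ofVec_pt, map_smul]

theorem ofVec_unitVec : ofVec (unitVec X) = 𝟙 (reg X) :=
  reg_hom_ext fun x => by
    rw [ofVec_pt, proj_unitVec]
    rfl

end GrVect

namespace ModEnd

open GrVect Functor.LaxLeftLinear

variable {G X : Type} [Group G] [Fintype G] [MulAction G X] [Fintype X]
  (F F' : ModEnd (GrVect G) (GrVect X)) {V W : GrVect G} {M N : GrVect X}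

/-- The tensor `v ⊗ m`, as a vector of `V ⊙ M`. -/
def tmul (v : V) (m : M) : (V ⊙ₗ M : GrVect X) := (v ⊗ₜ[ℂ] m : V ⊗[ℂ] M)

/-- The value of the module structure of `F` on a tensor `v ⊗ u`. -/
noncomputable def mu (v : V) (u : F.functor.obj M) : F.functor.obj (V ⊙ₗ M) :=
  (μₗ F.functor V M).lin (tmul v u)

variable {F F'}

theorem mu_map (v : V) (φ : M ⟶ N) (u : F.functor.obj M) :
    F.mu v ((F.functor.map φ).lin u) = (F.functor.map (V ⊴ₗ φ)).lin (F.mu v u) :=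
  LinearMap.congr_fun (congrArg Hom.lin (μₗ_naturality_right F.functor V φ)) (tmul v u)

theorem mu_lin (φ : V ⟶ W) (v : V) (u : F.functor.obj M) :
    F.mu (φ.lin v) u = (F.functor.map (φ ⊵ₗ M)).lin (F.mu v u) :=
  LinearMap.congr_fun (congrArg Hom.lin (μₗ_naturality_left F.functor φ M)) (tmul v u)

/-- The translation by `g` on the regular graded vector space. -/
noncomputable def translation (g : G) : (single g ⊙ₗ reg X : GrVect X) ⟶ reg X where
  lin := (TensorProduct.lift (LinearMap.toSpanSingleton ℂ ((X → ℂ) →ₗ[ℂ] (X → ℂ))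
    (LinearMap.funLeft ℂ ℂ (g⁻¹ • · : X → X))) : ℂ ⊗[ℂ] (X → ℂ) →ₗ[ℂ] (X → ℂ))
  map_gr z := map_gr_of_tmul (V := single g) (W := reg X)
    (TensorProduct.lift (LinearMap.toSpanSingleton ℂ ((X → ℂ) →ₗ[ℂ] (X → ℂ))
    (LinearMap.funLeft ℂ ℂ (g⁻¹ • · : X → X))) : ℂ ⊗[ℂ] (X → ℂ) →ₗ[ℂ] (X → ℂ))
    ((reg X).gr z) z fun h x hx (c : ℂ) hc f hf => by
    refine mem_free.2 fun y hy => ?_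
    change c * coord f (g⁻¹ • y) = 0
    by_cases hg : h = g
    · subst hg
      have h1 : coord f (h⁻¹ • y) = 0 := mem_free.1 hf (h⁻¹ • y) fun h' : h⁻¹ • y = x =>
        hy (by rw [← hx, ← h', smul_inv_smul]; rfl)
      rw [h1, mul_zero]
    · rw [mem_single hc hg, zero_mul]

theorem translation_one (g : G) :
    (translation g).lin (tmul (gen g) (unitVec X)) = unitVec X :=
  funext fun _ => mul_one _

variable (F) in
/-- The operator by which `g` acts on the value of `F` at the regular graded vector space. -/
noncomputable def shift (g : G) : F.functor.obj (reg X) →ₗ[ℂ] F.functor.obj (reg X) where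
  toFun u := (F.functor.map (translation g)).lin (F.mu (gen g) u)
  map_add' u u' := by
    refine (congrArg _ ((congrArg _ (TensorProduct.tmul_add _ _ _)).trans
      (map_add (μₗ F.functor _ _).lin _ _))).trans (map_add _ _ _)
  map_smul' c u := by
    refine (congrArg _ ((congrArg _ (TensorProduct.tmul_smul _ _ _)).trans
      (map_smul (μₗ F.functor _ _).lin _ _))).trans (map_smul _ _ _)

theorem shift_mem {g : G} {y : X} {u : F.functor.obj (reg X)}
    (hu : u ∈ (F.functor.obj (reg X)).gr y) : F.shift g u ∈ (F.functor.obj (reg X)).gr (g • y) :=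
  (F.functor.map (translation g)).map_gr _ _ <| (μₗ F.functor (single g) (reg X)).map_gr _ _ <|
    tmul_mem (m := (· • ·)) rfl (gen_mem g) hu

theorem nat_shift (t : F ⟶ F') (g : G) (u : F.functor.obj (reg X)) :
    (t.nat.app (reg X)).lin (F.shift g u) = F'.shift g ((t.nat.app (reg X)).lin u) := by
  have h1 := LinearMap.congr_fun (congrArg Hom.lin (t.nat.naturality (translation g)))
    (F.mu (gen g) u)
  have h2 := LinearMap.congr_fun (congrArg Hom.lin (t.comm (single g) (reg X))) (tmul (gen g) u)
  exact h1.trans (congrArg (F'.functor.map (translation g)).lin h2)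

variable [DecidableEq X]

variable (F) in
/-- The value of `F` on the morphism with components those of `m`. -/
noncomputable def ev (M : GrVect X) :
    M →ₗ[ℂ] F.functor.obj (reg X) →ₗ[ℂ] F.functor.obj M where
  toFun m := (F.functor.map (ofVec m)).lin
  map_add' m m' := by rw [ofVec_add, F.functor.map_add, add_lin]
  map_smul' c m := by rw [ofVec_smul, F.functor.map_smul, smul_lin]; rfl

theorem map_ev (φ : M ⟶ N) (m : M) (u : F.functor.obj (reg X)) :
    (F.functor.map φ).lin (F.ev M m u) = F.ev N (φ.lin m) u := by
  have h : F.functor.map (ofVec m ≫ φ) = F.functor.map (ofVec m) ≫ F.functor.map φ :=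
    F.functor.map_comp _ _
  rw [ofVec_comp] at h
  exact (LinearMap.congr_fun (congrArg Hom.lin h) u).symm

theorem ev_mem (m : M) {u : F.functor.obj (reg X)} {y : X} (hu : u ∈ (F.functor.obj (reg X)).gr y) :
    F.ev M m u ∈ (F.functor.obj M).gr y :=
  (F.functor.map (ofVec m)).map_gr y u hu

theorem ev_unitVec (u : F.functor.obj (reg X)) : F.ev (reg X) (unitVec X) u = u := by
  have h : F.functor.map (ofVec (unitVec X)) = 𝟙 _ := by rw [ofVec_unitVec, F.functor.map_id]
  exact LinearMap.congr_fun (congrArg Hom.lin h) u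

theorem ev_ev (m : M) (f : reg X) (u : F.functor.obj (reg X)) :
    F.ev M m (F.ev (reg X) f u) = F.ev M ((ofVec m).lin f) u :=
  map_ev (ofVec m) f u

theorem translation_pt (g : G) (x : X) :
    (translation g).lin (tmul (gen g) (pt x)) = pt (g • x) :=
  funext fun y => by
    change 1 * coord (pt x) (g⁻¹ • y) = coord (pt (g • x)) y
    simp [coord, pt, Pi.single_apply, inv_smul_eq_iff]

theorem translation_hom_ext {g : G} {N : GrVect X} {φ ψ : single g ⊙ₗ reg X ⟶ N}
    (h : ∀ x, φ.lin (tmul (gen g) (pt x)) = ψ.lin (tmul (gen g) (pt x))) : φ = ψ := by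
  refine GrVect.hom_ext (TensorProduct.ext (LinearMap.ext_ring (LinearMap.ext fun f => ?_)))
  rw [← sum_pt f, map_sum, map_sum]
  refine Finset.sum_congr rfl fun x _ => ?_
  rw [map_smul, map_smul]
  exact congrArg _ (h x)

/-- The module structure of `F` is determined by the operators `F.shift g`. -/
theorem mu_ev {g : G} {v : V} (hv : v ∈ V.gr g) (m : M) (u : F.functor.obj (reg X)) :
    F.mu v (F.ev M m u) = F.ev (V ⊙ₗ M) (tmul v m) (F.shift g u) := by
  have h1 : ofMem v hv ⊵ₗ reg X ≫ V ⊴ₗ ofVec m = translation g ≫ ofVec (M := V ⊙ₗ M) (tmul v m) := by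
    refine translation_hom_ext fun x => ?_
    refine Eq.trans (b := tmul v (M.proj x m)) ?_ ?_
    · exact congrArg₂ tmul (one_smul ℂ v) (ofVec_pt m x)
    · refine Eq.trans ?_ (congrArg (ofVec (M := V ⊙ₗ M) (tmul v m)).lin (translation_pt g x)).symm
      rw [ofVec_pt]
      refine Eq.trans ?_ (KernelData.proj_tmul hv (g • x) m).symm
      rw [inv_smul_smul]
      rfl
  have h2 : v = (ofMem v hv).lin (gen g) := (one_smul ℂ v).symm
  calc F.mu v (F.ev M m u) = (F.functor.map (V ⊴ₗ ofVec m)).lin (F.mu v u) := mu_map v (ofVec m) u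
    _ = (F.functor.map (V ⊴ₗ ofVec m)).lin ((F.functor.map (ofMem v hv ⊵ₗ reg X)).lin
          (F.mu (gen g) u)) := by
        rw [← mu_lin, ← h2]
    _ = (F.functor.map (ofMem v hv ⊵ₗ reg X ≫ V ⊴ₗ ofVec m)).lin
          (F.mu (gen g) u) := by
        rw [F.functor.map_comp]; rfl
    _ = F.ev (V ⊙ₗ M) (tmul v m) (F.shift g u) := by
        rw [h1, F.functor.map_comp]; rfl

theorem mu_eq {g : G} {v : V} (hv : v ∈ V.gr g) (u : F.functor.obj (reg X)) :
    F.mu v u = F.ev (V ⊙ₗ reg X) (tmul v (unitVec X)) (F.shift g u) := by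
  rw [← mu_ev hv, ev_unitVec]

theorem shift_ev_pt (g : G) (x : X) (u : F.functor.obj (reg X)) :
    F.shift g (F.ev (reg X) (pt x) u) = F.ev (reg X) (pt (g • x)) (F.shift g u) := by
  have h : F.shift g (F.ev (reg X) (pt x) u) = (F.functor.map (translation g)).lin
    (F.mu (gen g) (F.ev (reg X) (pt x) u)) := rfl
  rw [h, mu_ev (gen_mem g), map_ev, translation_pt]

theorem shift_one (u : F.functor.obj (reg X)) : F.shift 1 u = u := by
  have h1 := LinearMap.congr_fun (congrArg Hom.lin (μₗ_unitality F.functor (reg X)))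
    (tmul (gen (1 : G)) u)
  have h2 : u = (F.functor.map (λₗ (reg X)).hom).lin (F.mu (gen (1 : G)) u) :=
    (one_smul ℂ u).symm.trans h1
  rw [mu_eq (gen_mem 1)] at h2
  have h3 : (λₗ (reg X)).hom.lin (tmul (gen (1 : G)) (unitVec X)) = unitVec X :=
    one_smul ℂ _
  refine Eq.trans ?_ h2.symm
  refine Eq.symm ((map_ev (λₗ (reg X)).hom _ _).trans ?_)
  rw [h3, ev_unitVec]

theorem shift_mul (g h : G) (u : F.functor.obj (reg X)) :
    F.shift (g * h) u = F.shift g (F.shift h u) := by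
  let gh : (single g ⊗ single h : GrVect G) := (gen g ⊗ₜ[ℂ] gen h : (single g) ⊗[ℂ] (single h))
  have hgh : gh ∈ (single g ⊗ single h : GrVect G).gr (g * h) :=
    GrVect.tmul_mem (m := (· * ·)) rfl (gen_mem g) (gen_mem h)
  have h1 : (F.functor.map (αₗ (single g) (single h) (reg X)).hom).lin (F.mu gh u) =
      F.mu (gen g) (F.mu (gen h) u) :=
    LinearMap.congr_fun (congrArg Hom.lin (μₗ_associativity F.functor (single g) (single h) (reg X)))
      (tmul gh u)
  let ψ := single g ⊴ₗ translation (X := X) h ≫ translation g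
  have h2 : (F.functor.map ψ).lin (F.mu (gen g) (F.mu (gen h) u)) = F.shift g (F.shift h u) := by
    have h3 : F.functor.map ψ = F.functor.map (single g ⊴ₗ translation h) ≫
      F.functor.map (translation g) := F.functor.map_comp _ _
    rw [h3]
    exact congrArg (F.functor.map (translation g)).lin (mu_map (gen g) (translation h) _).symm
  rw [← h2, ← h1, mu_eq hgh, map_ev, map_ev]
  have h4 : ψ.lin ((αₗ (single g) (single h) (reg X)).hom.lin (tmul gh (unitVec X))) =
      unitVec X :=
    (congrArg (fun f => (translation g).lin (tmul (gen g) f)) (translation_one h)).trans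
      (translation_one g)
  rw [h4, ev_unitVec]

end ModEnd

/-! ### Sections of a module endofunctor -/

namespace GrVect

variable {X : Type} [Fintype X] [DecidableEq X]

/-- Every graded vector space is a direct summand of a power of the regular one. -/
theorem exists_sum_comp_ofVec (M : GrVect X) : ∃ (J : Type) (_ : Fintype J) (m : J → M)
    (ξ : J → (M ⟶ reg X)), ∑ j, ξ j ≫ ofVec (m j) = 𝟙 M := by
  obtain ⟨J, _, k, b, hb⟩ := M.exists_homogeneous_basis
  refine ⟨J, inferInstance, b, fun j => ⟨(b.coord j).smulRight (pt (k j)), fun x v hv => ?_⟩, ?_⟩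
  · change b.coord j v • pt (k j) ∈ _
    by_cases h : x = k j
    · subst h
      exact Submodule.smul_mem _ _ (pt_mem (k j))
    · rw [coord_eq_zero hb h hv, zero_smul]
      exact zero_mem _
  · refine hom_ext (LinearMap.ext fun v => ?_)
    rw [sum_lin, LinearMap.sum_apply]
    refine Eq.trans (Finset.sum_congr rfl fun j _ => ?_) (b.sum_repr v)
    change (ofVec (b j)).lin (b.coord j v • pt (k j)) = b.coord j v • b j
    rw [map_smul, ofVec_pt, proj_of_mem (hb j)]

end GrVect

namespace ModEnd

open GrVect Functor.LaxLeftLinear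

variable {G X : Type} [Group G] [Fintype G] [MulAction G X] [Fintype X] [DecidableEq X]
  {F F' : ModEnd (GrVect G) (GrVect X)} {V W : GrVect G} {M N : GrVect X}

theorem ev_pt_ev_pt (x x' : X) (u : F.functor.obj (reg X)) :
    F.ev (reg X) (pt x) (F.ev (reg X) (pt x') u) =
      if x' = x then F.ev (reg X) (pt x) u else 0 := by
  rw [ev_ev, ofVec_pt, proj_pt]
  split_ifs with h
  · rfl
  · rw [map_zero]; rfl

theorem shift_proj (g : G) (y : X) (u : F.functor.obj (reg X)) :
    F.shift g ((F.functor.obj (reg X)).proj y u) =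
      (F.functor.obj (reg X)).proj (g • y) (F.shift g u) := by
  induction u using induction_homogeneous with
  | hz => simp only [map_zero]
  | hadd u u' h h' => simp only [map_add, h, h']
  | hmem z u hu =>
    by_cases h : y = z
    · subst h
      rw [proj_of_mem hu, proj_of_mem (shift_mem hu)]
    · rw [proj_of_mem_ne h hu, map_zero,
        proj_of_mem_ne (fun h' => h (smul_left_cancel g h')) (shift_mem hu)]

variable (F) in
/-- The projection of the value of `F` at the regular graded vector space onto the component of
degree `y` on which the idempotent attached to `x` is the identity. -/
noncomputable def comp (x y : X) : F.functor.obj (reg X) →ₗ[ℂ] F.functor.obj (reg X) :=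
  (F.functor.obj (reg X)).proj y ∘ₗ F.ev (reg X) (pt x)

theorem comp_eq (x y : X) (u : F.functor.obj (reg X)) :
    F.comp x y u = F.ev (reg X) (pt x) ((F.functor.obj (reg X)).proj y u) :=
  (lin_proj (F.functor.map (ofVec (pt x))) y u).symm

theorem comp_mem (x y : X) (u : F.functor.obj (reg X)) :
    F.comp x y u ∈ (F.functor.obj (reg X)).gr y := proj_mem y _

theorem ev_pt_comp (x' x y : X) (u : F.functor.obj (reg X)) :
    F.ev (reg X) (pt x') (F.comp x y u) = if x = x' then F.comp x y u else 0 := by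
  rw [comp_eq, ev_pt_ev_pt]
  split_ifs with h
  · rw [h]
  · rfl

theorem comp_comp (x y x' y' : X) (u : F.functor.obj (reg X)) :
    F.comp x' y' (F.comp x y u) = if x = x' ∧ y = y' then F.comp x y u else 0 := by
  rw [comp, LinearMap.comp_apply, ev_pt_comp]
  by_cases hx : x = x'
  · rw [if_pos hx]
    by_cases hy : y = y'
    · rw [if_pos ⟨hx, hy⟩, ← hy, proj_of_mem (comp_mem x y u)]
    · rw [if_neg fun h => hy h.2, proj_of_mem_ne (Ne.symm hy) (comp_mem x y u)]
  · rw [if_neg hx, if_neg fun h => hx h.1, map_zero]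

theorem sum_comp (u : F.functor.obj (reg X)) : ∑ x, ∑ y, F.comp x y u = u := by
  have h : ∀ x, ∑ y, F.comp x y u = F.ev (reg X) (pt x) u := fun x => sum_proj _
  rw [Finset.sum_congr rfl fun x _ => h x, ← LinearMap.sum_apply, ← map_sum, sum_pt_one, ev_unitVec]

theorem shift_comp (g : G) (x y : X) (u : F.functor.obj (reg X)) :
    F.shift g (F.comp x y u) = F.comp (g • x) (g • y) (F.shift g u) := by
  rw [comp, LinearMap.comp_apply, shift_proj, shift_ev_pt]
  rfl

theorem nat_ev (t : F ⟶ F') (m : M) (u : F.functor.obj (reg X)) :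
    (t.nat.app M).lin (F.ev M m u) = F'.ev M m ((t.nat.app (reg X)).lin u) :=
  (LinearMap.congr_fun (congrArg Hom.lin (t.nat.naturality (ofVec m))) u)

theorem nat_comp (t : F ⟶ F') (x y : X) (u : F.functor.obj (reg X)) :
    (t.nat.app (reg X)).lin (F.comp x y u) = F'.comp x y ((t.nat.app (reg X)).lin u) := by
  rw [comp, LinearMap.comp_apply, lin_proj, nat_ev]
  rfl

end ModEnd

namespace KernelData

open GrVect ModEnd

variable {I : Type} [Fintype I] [DecidableEq I] {D : FusionData I} {G X : Type} [Group G] [Fintype G]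
  [MulAction G X] [Fintype X] [DecidableEq X] (K : KernelData D G X)
  (F : ModEnd (GrVect G) (GrVect X))

/-- The equivariant families of elements of the components of the value of `F` at the regular graded
vector space, on the pairs `(x, y)` which are admissible for `i`, on which `G` acts by `K.char i`. -/
def sections (i : I) : Submodule ℂ (X → X → F.functor.obj (reg X)) where
  carrier := {e | ∀ x y, F.comp x y (e x y) = e x y ∧ (¬ K.adm i x y → e x y = 0) ∧
    ∀ g : G, F.shift g (e x y) = K.char i g • e (g • x) (g • y)}
  add_mem' he he' x y := ⟨by simp [(he x y).1, (he' x y).1],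
    fun h => by simp [(he x y).2.1 h, (he' x y).2.1 h],
    fun g => by simp [(he x y).2.2 g, (he' x y).2.2 g]⟩
  zero_mem' x y := ⟨map_zero _, fun _ => rfl, fun g => by simp⟩
  smul_mem' c e he x y := ⟨by simp [(he x y).1], fun h => by simp [(he x y).2.1 h],
    fun g => by simp [(he x y).2.2 g, smul_comm c]⟩

variable {K F} {A : FusionObj D} {e : A.ι → X → X → F.functor.obj (reg X)}

theorem ev_proj_section {i : I} {e : X → X → F.functor.obj (reg X)} (he : e ∈ K.sections F i)
    {M : GrVect X} (x y : X) (m : M) : F.ev M (M.proj x m) (e x y) = F.ev M m (e x y) := by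
  rw [← ofVec_pt, ← ev_ev, ← (he x y).1, ev_pt_comp, if_pos rfl]

variable (e) in
/-- The natural transformation attached to sections, as a linear map. -/
noncomputable def ofSectionsLin (M : GrVect X) : K.obj A M →ₗ[ℂ] F.functor.obj M :=
  ∑ x, ∑ y, ∑ s, (F.ev M).flip (e s x y) ∘ₗ valₗ x y s

theorem ofSectionsLin_apply {M : GrVect X} (f : K.obj A M) :
    ofSectionsLin e M f = ∑ x, ∑ y, ∑ s, F.ev M (val f x y s) (e s x y) := by
  simp only [ofSectionsLin, LinearMap.sum_apply]
  rfl

theorem ofSectionsLin_incl (he : ∀ s, e s ∈ K.sections F (A.label s)) {M : GrVect X} (x y : X)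
    (s : A.ι) (m : M) : ofSectionsLin e M (K.incl A M x y s m) = F.ev M m (e s x y) := by
  rw [ofSectionsLin_apply]
  simp only [val_incl]
  rw [Finset.sum_eq_single x (fun x' _ h => ?_) (by simp),
    Finset.sum_eq_single y (fun x' _ h => ?_) (by simp),
    Finset.sum_eq_single s (fun x' _ h => ?_) (by simp)]
  · by_cases h : K.adm (A.label s) x y
    · rw [if_pos ⟨rfl, rfl, rfl, h⟩, ev_proj_section (he s)]
    · rw [(he s x y).2.1 h, map_zero, map_zero]
  · rw [if_neg fun h' => h h'.2.2.1, map_zero, LinearMap.zero_apply]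
  · exact Finset.sum_eq_zero fun _ _ => by
      rw [if_neg fun h' => h h'.2.1, map_zero, LinearMap.zero_apply]
  · exact Finset.sum_eq_zero fun _ _ => Finset.sum_eq_zero fun _ _ => by
      rw [if_neg fun h' => h h'.1, map_zero, LinearMap.zero_apply]

/-- The morphism of module endofunctors attached to sections, on objects. -/
noncomputable def ofSectionsApp (he : ∀ s, e s ∈ K.sections F (A.label s)) (M : GrVect X) :
    K.obj A M ⟶ F.functor.obj M where
  lin := ofSectionsLin e M
  map_gr y₀ f hf := by
    rw [ofSectionsLin_apply]
    refine Submodule.sum_mem _ fun x _ => Submodule.sum_mem _ fun y _ =>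
      Submodule.sum_mem _ fun s _ => ?_
    by_cases h : y = y₀
    · subst h
      refine ev_mem _ ?_
      rw [← (he s x y).1]
      exact comp_mem x y _
    · rw [val_of_mem hf s h, map_zero]
      exact zero_mem _

theorem ofSectionsLin_lineatorLin (he : ∀ s, e s ∈ K.sections F (A.label s)) {V : GrVect G}
    {M : GrVect X} {g : G} {v : V} (hv : v ∈ V.gr g) (f : K.obj A M) :
    ofSectionsLin e (V ⊙ₗ M) (K.lineatorLin A V M (v ⊗ₜ f)) =
      F.mu v (ofSectionsLin e M f) := by
  have hmu : ∀ u u' : F.functor.obj M, F.mu v (u + u') = F.mu v u + F.mu v u' := fun u u' =>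
    (congrArg _ (TensorProduct.tmul_add _ _ _)).trans
      (map_add (Functor.LaxLeftLinear.μₗ F.functor V M).lin _ _)
  let μ : F.functor.obj M →+ F.functor.obj (V ⊙ₗ M) :=
    ⟨⟨F.mu v, by simpa using hmu 0 0⟩, hmu⟩
  have h1 : F.mu v (ofSectionsLin e M f) =
      ∑ x, ∑ y, ∑ s, F.mu v (F.ev M (val f x y s) (e s x y)) := by
    rw [ofSectionsLin_apply]
    change μ _ = ∑ x, ∑ y, ∑ s, μ _
    simp only [map_sum]
  have h2 : ∀ x y s, F.ev (V ⊙ₗ M) (val (K.lineatorLin A V M (v ⊗ₜ f)) x y s) (e s x y) =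
      F.mu v (F.ev M (val f (g⁻¹ • x) (g⁻¹ • y) s) (e s (g⁻¹ • x) (g⁻¹ • y))) := fun x y s => by
    rw [mu_ev hv, (he s _ _).2.2 g, smul_inv_smul, smul_inv_smul, map_smul]
    refine (congrArg (fun m => F.ev (V ⊙ₗ M) m (e s x y)) (K.val_lineatorLin hv f x y s)).trans ?_
    refine (congrArg (fun m => m (e s x y)) (map_smul (F.ev (V ⊙ₗ M)) _ _)).trans ?_
    rfl
  rw [h1, ofSectionsLin_apply]
  refine (Finset.sum_congr rfl fun x _ => Finset.sum_congr rfl fun y _ =>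
    Finset.sum_congr rfl fun s _ => h2 x y s).trans ?_
  refine Eq.trans (Finset.sum_congr rfl fun x _ => ?_) (Equiv.sum_comp (MulAction.toPerm g⁻¹)
    fun x => ∑ y, ∑ s, F.mu v (F.ev M (val f x y s) (e s x y)))
  exact Equiv.sum_comp (MulAction.toPerm g⁻¹)
    fun y => ∑ s, F.mu v (F.ev M (val f (g⁻¹ • x) y s) (e s (g⁻¹ • x) y))

theorem map_ofSectionsLin {M N : GrVect X} (φ : M ⟶ N) (f : K.obj A M) :
    ofSectionsLin e N ((map A φ).lin f) = (F.functor.map φ).lin (ofSectionsLin e M f) := by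
  simp only [ofSectionsLin_apply, map_sum, map_ev, val_map]

/-- The morphism of module endofunctors attached to sections. -/
noncomputable def ofSections (he : ∀ s, e s ∈ K.sections F (A.label s)) : K.modEnd A ⟶ F where
  nat :=
    { app := ofSectionsApp he
      naturality := fun _ _ φ => GrVect.hom_ext <| LinearMap.ext fun f => map_ofSectionsLin φ f }
  comm _ _ := GrVect.hom_ext <| tensor_ext fun _ _ hv f => ofSectionsLin_lineatorLin he hv f

end KernelData

/-! ### The equivalence with the category of module endofunctors -/

namespace KernelData

open GrVect ModEnd

variable {I : Type} [Fintype I] [DecidableEq I] {D : FusionData I} {G X : Type} [Group G] [Fintype G]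
  [MulAction G X] [Fintype X] [DecidableEq X] (K : KernelData D G X)

/-- Conditions under which the simple objects give all module endofunctors: the admissible pairs of
a simple object form one orbit, and the characters of the stabilizer of `(x, y)` attached to the
simple objects for which `(x, y)` is admissible are distinct and sum up to the regular character. -/
structure IsComplete : Prop where
  exists_adm : ∀ i, ∃ x y, K.adm i x y
  transitive : ∀ i x y x' y', K.adm i x y → K.adm i x' y' → ∃ g : G, g • x = x' ∧ g • y = y'
  separated : ∀ i j x y, K.adm i x y → K.adm j x y → i ≠ j →
    ∃ g : G, g • x = x ∧ g • y = y ∧ K.char i g ≠ K.char j g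
  exists_adm' : ∀ x y, ∃ i, K.adm i x y
  sum_char : ∀ x y, ∀ g : G, g • x = x → g • y = y → g ≠ 1 →
    (∑ i, if K.adm i x y then K.char i g else 0) = 0

variable {K} {F : ModEnd (GrVect G) (GrVect X)}

theorem eq_smul_pt {f : reg X} {x : X} (hf : f ∈ (reg X).gr x) : f = coord f x • pt x := by
  conv_lhs => rw [← sum_pt f]
  refine Finset.sum_eq_single x (fun y _ hy => ?_) (by simp)
  have h : coord f y = 0 := mem_free.1 hf y hy
  rw [h, zero_smul]

/-- A section is determined by its value at one admissible pair. -/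
theorem section_eq_zero (hK : K.IsComplete) {i : I} {e : X → X → F.functor.obj (reg X)}
    (he : e ∈ K.sections F i) {x y : X} (h : K.adm i x y) (h0 : e x y = 0) : e = 0 := by
  funext x' y'
  by_cases h' : K.adm i x' y'
  · obtain ⟨g, rfl, rfl⟩ := hK.transitive i x y x' y' h h'
    have h1 := (he x y).2.2 g
    rw [h0, map_zero] at h1
    exact (smul_eq_zero.1 h1.symm).resolve_left (K.char_ne_zero i g)
  · exact (he x' y').2.1 h'

variable (K F) in
open Classical in
/-- The average of the translates of an element of the component `(x, y)`, weighted by the inverse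
of `K.char i`. -/
noncomputable def average (i : I) (x y : X) (u : F.functor.obj (reg X)) (x' y' : X) :
    F.functor.obj (reg X) :=
  if K.adm i x y then ∑ g : G, if g • x = x' ∧ g • y = y' then
    K.char i g⁻¹ • F.shift g (F.comp x y u) else 0 else 0

theorem average_mem (i : I) (x y : X) (u : F.functor.obj (reg X)) :
    K.average F i x y u ∈ K.sections F i := by
  classical
  intro x' y'
  unfold average
  by_cases h : K.adm i x y
  swap
  · simp [h]
  simp only [if_pos h]
  refine ⟨?_, fun h' => Finset.sum_eq_zero fun g _ => if_neg ?_, fun g => ?_⟩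
  · rw [map_sum]
    refine Finset.sum_congr rfl fun g _ => ?_
    split_ifs with hg
    · rw [map_smul, shift_comp, comp_comp, if_pos hg]
    · rw [map_zero]
  · rintro ⟨rfl, rfl⟩
    exact h' (K.adm_smul g i x y h)
  · rw [map_sum, Finset.smul_sum]
    conv_rhs => rw [← Equiv.sum_comp (Equiv.mulLeft g)]
    refine Finset.sum_congr rfl fun h _ => ?_
    simp only [Equiv.coe_mulLeft, mul_smul, smul_left_cancel_iff]
    split_ifs
    · have h2 : K.char i g * K.char i g⁻¹ = 1 := by rw [← map_mul, mul_inv_cancel, map_one]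
      rw [map_smul, shift_mul, smul_smul, mul_inv_rev, map_mul, mul_left_comm, h2, mul_one]
    · rw [map_zero, smul_zero]

/-- Every element of the component `(x, y)` is a sum of values at `(x, y)` of sections of all types:
the sum over `i` of the averages of `u` is a multiple of `u` because the characters sum up to the
regular character of the stabilizer. -/
theorem exists_sum_sections (hK : K.IsComplete) (x y : X) (u : F.functor.obj (reg X)) :
    ∃ e : I → X → X → F.functor.obj (reg X), (∀ i, e i ∈ K.sections F i) ∧
      ∑ i, e i x y = F.comp x y u := by
  classical
  -- the number of types `i` of sections with a nonzero value at `(x, y)`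
  set c : ℂ := ∑ i, if K.adm i x y then 1 else 0 with hc_def
  have hc : c ≠ 0 := by
    obtain ⟨i, hi⟩ := hK.exists_adm' x y
    rw [hc_def, Finset.sum_boole]
    exact Nat.cast_ne_zero.2 (Finset.card_ne_zero.2 ⟨i, by simpa using hi⟩)
  refine ⟨fun i => c⁻¹ • K.average F i x y u,
    fun i => Submodule.smul_mem _ _ (average_mem i x y u), ?_⟩
  have h1 : ∑ i, K.average F i x y u x y = c • F.comp x y u := by
    calc ∑ i, K.average F i x y u x y = ∑ g : G, if g • x = x ∧ g • y = y then
          (∑ i, if K.adm i x y then K.char i g⁻¹ else 0) • F.shift g (F.comp x y u) else 0 := by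
          simp only [Finset.sum_smul, average]
          have h2 : ∀ g : G, (if g • x = x ∧ g • y = y then
              ∑ i, (if K.adm i x y then K.char i g⁻¹ else 0) • F.shift g (F.comp x y u) else 0) =
              ∑ i, if g • x = x ∧ g • y = y then
                (if K.adm i x y then K.char i g⁻¹ else 0) • F.shift g (F.comp x y u) else 0 :=
            fun g => by
              split_ifs
              · rfl
              · rw [Finset.sum_const_zero]
          rw [Finset.sum_congr rfl fun g _ => h2 g, Finset.sum_comm]
          refine Finset.sum_congr rfl fun i _ => ?_
          split_ifs
          · rfl
          · simp
      _ = c • F.comp x y u := by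
          rw [Finset.sum_eq_single 1 (fun g _ hg => ?_) (by simp)]
          · rw [if_pos ⟨one_smul _ _, one_smul _ _⟩, shift_one, inv_one]
            simp only [map_one]
            rfl
          · split_ifs with h'
            · rw [hK.sum_char x y _ (inv_smul_eq_iff.2 h'.1.symm) (inv_smul_eq_iff.2 h'.2.symm)
                (inv_ne_one.2 hg), zero_smul]
            · rfl
  simp only [Pi.smul_apply]
  rw [← Finset.smul_sum, h1, smul_smul, inv_mul_cancel₀ hc, one_smul]

/-- The characters of the stabilizer of `(x, y)` attached to distinct simple objects are
orthogonal. -/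
theorem sum_char_eq_zero [DecidableEq G] (hK : K.IsComplete) {i j : I} {x y : X} (hi : K.adm i x y)
    (hj : K.adm j x y) (hij : i ≠ j) :
    (∑ g : G, if g • x = x ∧ g • y = y then K.char j g⁻¹ * K.char i g else 0) = 0 := by
  obtain ⟨h, hx, hy, hh⟩ := hK.separated i j x y hi hj hij
  set S := ∑ g : G, if g • x = x ∧ g • y = y then K.char j g⁻¹ * K.char i g else 0 with hS
  -- translation by an element `h` which separates the characters rescales the sum
  have h1 : S = K.char j h⁻¹ * K.char i h * S := by
    conv_lhs => rw [hS, ← Equiv.sum_comp (Equiv.mulLeft h)]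
    rw [Finset.mul_sum]
    refine Finset.sum_congr rfl fun g _ => ?_
    have h2 : ∀ z : X, h • z = z → ((h * g) • z = z ↔ g • z = z) := fun z hz => by
      rw [mul_smul, smul_eq_iff_eq_inv_smul, inv_smul_eq_iff.2 hz.symm]
    simp only [Equiv.coe_mulLeft, h2 x hx, h2 y hy]
    split_ifs
    · rw [mul_inv_rev, map_mul, map_mul]
      ring
    · rw [mul_zero]
  have h3 : K.char j h⁻¹ * K.char i h ≠ 1 := fun h4 => hh <| by
    have h5 : K.char j h * K.char j h⁻¹ = 1 := by rw [← map_mul, mul_inv_cancel, map_one]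
    linear_combination K.char j h * h4 - K.char i h * h5
  have h4 : (1 - K.char j h⁻¹ * K.char i h) * S = 0 := by linear_combination h1
  exact (mul_eq_zero.1 h4).resolve_left (sub_ne_zero.2 h3.symm)

/-- Values at `(x, y)` of sections of different types are linearly independent. -/
theorem sections_eq_zero_of_sum (hK : K.IsComplete) {e : I → X → X → F.functor.obj (reg X)}
    (he : ∀ i, e i ∈ K.sections F i) {x y : X} (h : ∑ i, e i x y = 0) (j : I) : e j x y = 0 := by
  classical
  by_cases hj : K.adm j x y
  swap
  · exact (he j x y).2.1 hj
  -- the projection onto the isotypic component of `K.char j`, applied to the relation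
  have h1 : ∑ i, (∑ g : G, if g • x = x ∧ g • y = y then K.char j g⁻¹ * K.char i g else 0) •
      e i x y = 0 := by
    simp only [Finset.sum_smul]
    rw [Finset.sum_comm]
    refine Finset.sum_eq_zero fun g _ => ?_
    by_cases hg : g • x = x ∧ g • y = y
    · have h2 := congrArg (fun u => K.char j g⁻¹ • F.shift g u) h
      simp only [map_sum, map_zero, smul_zero, Finset.smul_sum] at h2
      rw [← h2]
      refine Finset.sum_congr rfl fun i _ => ?_
      rw [if_pos hg, (he i x y).2.2 g, hg.1, hg.2, smul_smul]
    · simp only [if_neg hg, zero_smul, Finset.sum_const_zero]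
  rw [Finset.sum_eq_single j (fun i _ hij => ?_) (by simp)] at h1
  · refine (smul_eq_zero.1 h1).resolve_left ?_
    have h3 : ∀ g : G, (if g • x = x ∧ g • y = y then K.char j g⁻¹ * K.char j g else 0) =
        if g • x = x ∧ g • y = y then 1 else 0 := fun g => by
      rw [← map_mul, inv_mul_cancel, map_one]
    simp only [h3, Finset.sum_boole]
    exact Nat.cast_ne_zero.2 (Finset.card_ne_zero.2 ⟨1, by simp⟩)
  · by_cases hi : K.adm i x y
    · rw [sum_char_eq_zero hK hi hj hij, zero_smul]
    · rw [(he i x y).2.1 hi, smul_zero]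

section EssSurj

variable (K F) in
/-- The formal direct sum in which the multiplicity of `i` is the dimension of the space of
sections of type `i`. -/
noncomputable def ofModEnd : FusionObj D where
  ι := Σ i : I, Fin (Module.finrank ℂ (K.sections F i))
  label := Sigma.fst

variable (K F) in
/-- A basis of the spaces of sections. -/
noncomputable def basisSection (s : (K.ofModEnd F).ι) : X → X → F.functor.obj (reg X) :=
  (Module.finBasis ℂ (K.sections F (Sigma.fst s)) (Sigma.snd s) : K.sections F (Sigma.fst s)).1

theorem basisSection_mem (s : (K.ofModEnd F).ι) :
    K.basisSection F s ∈ K.sections F ((K.ofModEnd F).label s) :=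
  (Module.finBasis ℂ (K.sections F (Sigma.fst s)) (Sigma.snd s)).2

/-- It is enough to reach the values `F.ev M m u`, because `M` is a direct summand of a power of the
regular graded vector space, and these are sums of values of sections. -/
theorem ofSectionsLin_surjective (hK : K.IsComplete) (M : GrVect X) :
    Function.Surjective (ofSectionsLin (K := K) (K.basisSection F) M) := by
  rw [← LinearMap.range_eq_top, eq_top_iff]
  set R := LinearMap.range (ofSectionsLin (K := K) (K.basisSection F) M) with hR
  have h1 : ∀ i, ∀ e ∈ K.sections F i, ∀ x y (m : M), F.ev M m (e x y) ∈ R := fun i e he x y m => by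
    have h2 := (Module.finBasis ℂ (K.sections F i)).sum_repr ⟨e, he⟩
    have h3 := congrArg (fun e : K.sections F i => F.ev M m (e.1 x y)) h2
    simp only [Submodule.coe_sum, Submodule.coe_smul, Finset.sum_apply, Pi.smul_apply, map_sum,
      map_smul] at h3
    rw [← h3]
    exact Submodule.sum_mem _ fun k _ => Submodule.smul_mem _ _
      ⟨K.incl (K.ofModEnd F) M x y ⟨i, k⟩ m, ofSectionsLin_incl basisSection_mem x y ⟨i, k⟩ m⟩
  have h2 : ∀ (m : M) u, F.ev M m u ∈ R := fun m u => by
    rw [← sum_comp u, map_sum]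
    refine Submodule.sum_mem _ fun x _ => ?_
    rw [map_sum]
    refine Submodule.sum_mem _ fun y _ => ?_
    obtain ⟨e, he, h3⟩ := exists_sum_sections hK x y u
    rw [← h3, map_sum]
    exact Submodule.sum_mem _ fun i _ => h1 i _ (he i) x y m
  intro w _
  obtain ⟨J, _, m, ξ, h⟩ := exists_sum_comp_ofVec M
  have h3 : ∑ j, F.ev M (m j) ((F.functor.map (ξ j)).lin w) = w := by
    have h4 := congrArg (fun φ => (F.functor.map φ).lin w) h
    simp only [Functor.map_sum, Functor.map_comp, sum_lin, LinearMap.sum_apply,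
      CategoryTheory.Functor.map_id] at h4
    exact h4
  rw [← h3]
  exact Submodule.sum_mem _ fun j _ => h2 _ _

/-- A relation between the values of the basic sections at a pair `(x, y)` splits into one relation
for each type of sections, which then holds at all pairs, and contradicts linear independence. -/
theorem ofSectionsLin_reg_injective (hK : K.IsComplete) :
    Function.Injective (ofSectionsLin (K := K) (K.basisSection F) (reg X)) := by
  rw [injective_iff_map_eq_zero]
  intro f hf
  have h1 : ∀ x y s, val f x y s = coord (val f x y s) x • pt x := fun x y s =>
    eq_smul_pt (val_mem f x y s)
  have h2 : ∀ x y, ∑ s, coord (val f x y s) x • K.basisSection F s x y = 0 := fun x y => by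
    have h3 : ∀ x' y' s, F.comp x y (F.ev (reg X) (val f x' y' s) (K.basisSection F s x' y')) =
        if x' = x ∧ y' = y then coord (val f x' y' s) x' • K.basisSection F s x' y' else 0 :=
      fun x' y' s => by
        have h4 := (basisSection_mem s x' y').1
        rw [h1, map_smul, LinearMap.smul_apply, map_smul, ← h4, ev_pt_comp, if_pos rfl, comp_comp,
          ← h1, h4]
        split_ifs
        · rfl
        · rw [smul_zero]
    have h5 := congrArg (F.comp x y) hf
    simp only [ofSectionsLin_apply, map_sum, map_zero, h3] at h5
    rw [← h5, Finset.sum_eq_single x (fun x' _ hx => Finset.sum_eq_zero fun y' _ =>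
        Finset.sum_eq_zero fun s _ => if_neg fun h => hx h.1) (by simp),
      Finset.sum_eq_single y (fun y' _ hy =>
        Finset.sum_eq_zero fun s _ => if_neg fun h => hy h.2) (by simp)]
    exact Finset.sum_congr rfl fun s _ => (if_pos ⟨rfl, rfl⟩).symm
  refine obj_ext fun x y s => ?_
  by_cases h : K.adm ((K.ofModEnd F).label s) x y
  swap
  · exact val_eq_zero f h
  obtain ⟨i, k⟩ := s
  let b := fun j => Module.finBasis ℂ (K.sections F j)
  let c : ∀ j, Fin (Module.finrank ℂ (K.sections F j)) → ℂ := fun j l => coord (val f x y ⟨j, l⟩) x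
  have h3 : ∑ j, (∑ l, c j l • b j l : K.sections F j).1 x y = 0 := by
    refine Eq.trans ?_ (h2 x y)
    refine Eq.trans ?_ (Fintype.sum_sigma _).symm
    refine Finset.sum_congr rfl fun j _ => ?_
    rw [Submodule.coe_sum, Finset.sum_apply, Finset.sum_apply]
    rfl
  have h4 := sections_eq_zero_of_sum hK (fun j => (∑ l, c j l • b j l : K.sections F j).2) h3 i
  have h5 : ∑ l, c i l • b i l = 0 :=
    Subtype.ext (section_eq_zero hK (∑ l, c i l • b i l : K.sections F i).2 h h4)
  have h6 : c i k = 0 := Fintype.linearIndependent_iff.1 (b i).linearIndependent _ h5 k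
  refine (h1 x y ⟨i, k⟩).trans ?_
  exact (congrArg (· • pt x) h6).trans (zero_smul _ _)

theorem ofSectionsLin_injective (hK : K.IsComplete) (M : GrVect X) :
    Function.Injective (ofSectionsLin (K := K) (K.basisSection F) M) := by
  rw [injective_iff_map_eq_zero]
  intro f hf
  obtain ⟨J, _, m, ξ, h⟩ := exists_sum_comp_ofVec M
  have h1 : ∀ j, (map (K := K) (K.ofModEnd F) (ξ j)).lin f = 0 := fun j =>
    (injective_iff_map_eq_zero _).1 (ofSectionsLin_reg_injective hK) _ <| by
      rw [map_ofSectionsLin, hf, map_zero]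
  refine obj_ext fun x y s => ?_
  have h2 := congrArg (fun φ => Hom.lin φ (val f x y s)) h
  simp only [sum_lin, LinearMap.sum_apply, comp_lin, LinearMap.comp_apply] at h2
  refine h2.symm.trans (Finset.sum_eq_zero fun j _ => ?_)
  have h3 : (ξ j).lin (val f x y s) = 0 := congrArg (fun f => val f x y s) (h1 j)
  rw [h3, map_zero]

theorem essSurj (hK : K.IsComplete) : K.toModEnd.EssSurj where
  mem_essImage F := by
    refine ⟨K.ofModEnd F, ⟨?_⟩⟩
    have h : ∀ M, IsIso (ofSectionsApp (basisSection_mem (K := K) (F := F)) M) := fun M =>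
      isIso_of_bijective _ ⟨ofSectionsLin_injective hK M, ofSectionsLin_surjective hK M⟩
    exact ModEnd.mkIso (NatIso.ofComponents
      (fun M => @asIso _ _ _ _ (ofSectionsApp basisSection_mem M) (h M))
      fun φ => (ofSections (K := K) (F := F) basisSection_mem).nat.naturality φ)
      (ofSections basisSection_mem).comm

end EssSurj

end KernelData

namespace KernelData

open GrVect ModEnd

variable {I : Type} [Fintype I] [DecidableEq I] {D : FusionData I} {G X : Type} [Group G] [Fintype G]
  [MulAction G X] [Fintype X] [DecidableEq X] {K : KernelData D G X}
  {F : ModEnd (GrVect G) (GrVect X)} {A B : FusionObj D}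

theorem val_ev {M : GrVect X} (m : M) (f : K.obj A (reg X)) (x y : X) (s : A.ι) :
    val (K := K) (A := A) (M := M) ((K.modEnd A).ev M m f) x y s =
      (ofVec m).lin (val f x y s) := rfl

theorem coord_val_shift (g : G) (f : K.obj A (reg X)) (x y z : X) (s : A.ι) :
    coord (val (K := K) (A := A) (M := reg X) ((K.modEnd A).shift g f) x y s) z =
      K.char (A.label s) g * coord (val f (g⁻¹ • x) (g⁻¹ • y) s) (g⁻¹ • z) := by
  have h1 := K.val_lineatorLin (gen_mem g) f x y s
  have h2 : val (K := K) (A := A) (M := reg X) ((K.modEnd A).shift g f) x y s =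
      (translation g).lin (K.char (A.label s) g • tmul (gen g) (val f (g⁻¹ • x) (g⁻¹ • y) s)) :=
    congrArg (translation g).lin h1
  rw [h2, map_smul]
  exact congrArg (K.char (A.label s) g * ·) (one_mul (coord _ _))

variable (K A) in
/-- The generators of the module endofunctor attached to `A`. -/
noncomputable def generator (s : A.ι) (x y : X) : (K.modEnd A).functor.obj (reg X) :=
  K.incl A (reg X) x y s (pt x)

theorem val_generator (s : A.ι) (x y x' y' : X) (s' : A.ι) :
    val (K := K) (A := A) (M := reg X) (K.generator A s x y) x' y' s' =
      if x' = x ∧ y' = y ∧ s' = s ∧ K.adm (A.label s) x y then pt x else 0 := by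
  refine (val_incl x y s (pt x) x' y' s').trans ?_
  rw [proj_pt, if_pos rfl]

theorem ev_generator {M : GrVect X} (m : M) (s : A.ι) (x y : X) :
    (K.modEnd A).ev M m (K.generator A s x y) = K.incl A M x y s m :=
  obj_ext fun x' y' s' => by
    refine (congrArg (ofVec m).lin (val_generator s x y x' y' s')).trans ?_
    rw [val_incl]
    split_ifs
    · rw [ofVec_pt]
    · rw [map_zero]

theorem generator_mem (s : A.ι) : K.generator A s ∈ K.sections (K.modEnd A) (A.label s) := by
  refine fun x y => ⟨?_, fun h => ?_, fun g => ?_⟩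
  · have h1 : (K.modEnd A).ev (reg X) (pt x) (K.generator A s x y) = K.generator A s x y :=
      ev_generator (pt x) s x y
    rw [ModEnd.comp, LinearMap.comp_apply, h1]
    exact proj_of_mem (incl_mem x y s (pt x))
  · exact obj_ext fun x' y' s' => (val_generator s x y x' y' s').trans (if_neg fun h' => h h'.2.2.2)
  · refine obj_ext fun x' y' s' => funext fun z => ?_
    refine (coord_val_shift g _ x' y' z s').trans ?_
    refine Eq.trans ?_ (congrArg (fun m => coord (K.char (A.label s) g • m) z)
      (val_generator s (g • x) (g • y) x' y' s')).symm
    rw [val_generator]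
    simp only [inv_smul_eq_iff, K.adm_smul_iff]
    by_cases h : x' = g • x ∧ y' = g • y ∧ s' = s ∧ K.adm (A.label s) x y
    · rw [if_pos h, if_pos h, h.2.2.1]
      refine congrArg (K.char (A.label s) g * ·) ?_
      simp [coord, pt, Pi.single_apply, inv_smul_eq_iff]
    · rw [if_neg h, if_neg h, smul_zero]
      exact mul_zero _

/-- A morphism from the module endofunctor attached to `A` is determined by its values on the
generators. -/
theorem modEnd_hom_ext {t t' : K.modEnd A ⟶ F}
    (h : ∀ s x y, K.adm (A.label s) x y → (t.nat.app (reg X)).lin (K.generator A s x y) =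
      (t'.nat.app (reg X)).lin (K.generator A s x y)) : t = t' :=
  ModEnd.hom_ext fun M => GrVect.hom_ext <| LinearMap.ext fun f => by
    have h0 : ∀ s x y, (t.nat.app (reg X)).lin (K.generator A s x y) =
        (t'.nat.app (reg X)).lin (K.generator A s x y) := fun s x y => by
      by_cases hs : K.adm (A.label s) x y
      · exact h s x y hs
      · rw [(generator_mem s x y).2.1 hs, map_zero, map_zero]
    have h1 : f = ∑ x, ∑ y, ∑ s, (K.modEnd A).ev M (val (K := K) (A := A) (M := M) f x y s)
        (K.generator A s x y) := by
      refine (sum_incl (K := K) (A := A) (M := M) f).symm.trans ?_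
      exact Finset.sum_congr rfl fun x _ => Finset.sum_congr rfl fun y _ =>
        Finset.sum_congr rfl fun s _ => (ev_generator _ s x y).symm
    rw [h1]
    simp only [map_sum, nat_ev, h0]

theorem map_mem_sections (t : F ⟶ K.modEnd B) {i : I} {e : X → X → F.functor.obj (reg X)}
    (he : e ∈ K.sections F i) :
    (fun x y => (t.nat.app (reg X)).lin (e x y)) ∈ K.sections (K.modEnd B) i :=
  fun x y => ⟨by rw [← nat_comp, (he x y).1], fun h => (congrArg _ ((he x y).2.1 h)).trans (map_zero _),
    fun g => by rw [← nat_shift, (he x y).2.2 g, map_smul]⟩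

/-- The coefficient of a generator in a section of the module endofunctor attached to `B`. -/
noncomputable def coeff (e : X → X → (K.modEnd B).functor.obj (reg X)) (t : B.ι) (x y : X) : ℂ :=
  coord (val (K := K) (A := B) (M := reg X) (e x y) x y t) x

theorem val_section {i : I} {e : X → X → (K.modEnd B).functor.obj (reg X)}
    (he : e ∈ K.sections (K.modEnd B) i) (x y x' y' : X) (t : B.ι) :
    val (K := K) (A := B) (M := reg X) (e x y) x' y' t =
      if x' = x ∧ y' = y then coeff e t x y • pt x else 0 := by
  have h1 : e x y ∈ ((K.modEnd B).functor.obj (reg X)).gr y := by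
    rw [← (he x y).1]
    exact comp_mem x y _
  have h2 : (K.modEnd B).ev (reg X) (pt x) (e x y) = e x y := by
    rw [← (he x y).1, ev_pt_comp, if_pos rfl]
  by_cases hy : y' = y
  · subst hy
    have h3 := eq_smul_pt (val_mem (K := K) (A := B) (M := reg X) (e x y') x' y' t)
    by_cases hx : x' = x
    · subst hx
      rw [if_pos ⟨rfl, rfl⟩]
      exact h3
    · rw [if_neg fun h => hx h.1]
      have h4 := congrArg (fun f => val (K := K) (A := B) (M := reg X) f x' y' t) h2
      refine h4.symm.trans ((val_ev _ _ _ _ _).trans ?_)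
      rw [h3, map_smul, ofVec_pt, proj_pt, if_neg hx, smul_zero]
  · rw [if_neg fun h => hy h.2]
    exact val_of_mem (K := K) (A := B) (M := reg X) h1 t hy

theorem coeff_smul {i : I} {e : X → X → (K.modEnd B).functor.obj (reg X)}
    (he : e ∈ K.sections (K.modEnd B) i) (g : G) (t : B.ι) (x y : X) :
    K.char (B.label t) g * coeff e t x y = K.char i g * coeff e t (g • x) (g • y) := by
  have h1 := coord_val_shift g (e x y) (g • x) (g • y) (g • x) t
  rw [inv_smul_smul, inv_smul_smul] at h1
  refine h1.symm.trans ?_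
  exact congrArg (fun f => coord (val (K := K) (A := B) (M := reg X) f (g • x) (g • y) t) (g • x))
    ((he x y).2.2 g)

/-- A section of type `i` has no coefficients at the summands of other types, since the stabilizer of
a common admissible pair separates the characters. -/
theorem coeff_eq_zero (hK : K.IsComplete) {i : I} {e : X → X → (K.modEnd B).functor.obj (reg X)}
    (he : e ∈ K.sections (K.modEnd B) i) {t : B.ι} (h : i ≠ B.label t) (x y : X) :
    coeff e t x y = 0 := by
  by_cases h1 : K.adm i x y
  · by_cases h2 : K.adm (B.label t) x y
    · obtain ⟨g, hx, hy, hg⟩ := hK.separated _ _ x y h1 h2 h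
      have h3 := coeff_smul he g t x y
      rw [hx, hy] at h3
      have h4 : (K.char i g - K.char (B.label t) g) * coeff e t x y = 0 := by
        linear_combination -h3
      exact (mul_eq_zero.1 h4).resolve_left (sub_ne_zero.2 hg)
    · exact congrArg (fun f => coord f x)
        (val_eq_zero (K := K) (A := B) (M := reg X) (e x y) h2)
  · unfold coeff
    rw [(he x y).2.1 h1]
    rfl

theorem coeff_eq_coeff (hK : K.IsComplete) {i : I}
    {e : X → X → (K.modEnd B).functor.obj (reg X)} (he : e ∈ K.sections (K.modEnd B) i) {t : B.ι}
    (hi : i = B.label t) {x y x' y' : X} (h : K.adm i x y) (h' : K.adm i x' y') :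
    coeff e t x y = coeff e t x' y' := by
  subst hi
  obtain ⟨g, rfl, rfl⟩ := hK.transitive _ x y x' y' h h'
  exact mul_left_cancel₀ (K.char_ne_zero _ g) (coeff_smul he g t x y)

theorem val_natApp_generator (h : A ⟶ B) {s : A.ι} {x y : X} (hs : K.adm (A.label s) x y)
    (x' y' : X) (t : B.ι) :
    val (K := K) (A := B) (M := reg X) ((natApp h (reg X)).lin (K.generator A s x y)) x' y' t =
      if x' = x ∧ y' = y then h.mat s t • pt x else 0 := by
  refine (val_natApp h _ x' y' t).trans ?_
  refine (Finset.sum_congr rfl fun s' _ => congrArg (h.mat s' t • ·)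
    (val_generator s x y x' y' s')).trans ?_
  rw [Finset.sum_eq_single s (fun s' _ h' => by rw [if_neg fun h => h' h.2.2.1, smul_zero])
    (by simp)]
  by_cases h' : x' = x ∧ y' = y
  · rw [if_pos h', if_pos ⟨h'.1, h'.2, rfl, hs⟩]
  · rw [if_neg h', if_neg fun h => h' ⟨h.1, h.2.1⟩, smul_zero]

theorem smul_pt_injective {x : X} {c c' : ℂ} (h : c • pt x = c' • pt x) : c = c' := by
  have h1 : ∀ c : ℂ, coord (c • pt x) x = c := fun c => by
    change c * (Pi.single x 1 : X → ℂ) x = c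
    rw [Pi.single_eq_same, mul_one]
  rw [← h1 c, h, h1]

theorem faithful (hK : K.IsComplete) : K.toModEnd.Faithful where
  map_injective {A B h h'} hh := FusionObj.hom_ext fun s t => by
    obtain ⟨x, y, hs⟩ := hK.exists_adm (A.label s)
    have h1 : natApp (K := K) h (reg X) = natApp h' (reg X) :=
      congrArg (fun t : K.modEnd A ⟶ K.modEnd B => t.nat.app (reg X)) hh
    have h2 := val_natApp_generator h hs x y t
    rw [h1, val_natApp_generator h' hs, if_pos ⟨rfl, rfl⟩, if_pos ⟨rfl, rfl⟩] at h2
    exact (smul_pt_injective h2).symm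

/-- A morphism sends the generators of `A` to sections for `B`, whose coefficients are constant along
the orbits and are the entries of a matrix. -/
theorem full (hK : K.IsComplete) : K.toModEnd.Full where
  map_surjective {A B} τ := by
    choose x y hs using hK.exists_adm
    let e : A.ι → X → X → (K.modEnd B).functor.obj (reg X) := fun s x y =>
      (ModEnd.Hom.nat (F := K.modEnd A) (G := K.modEnd B) τ).app (reg X) |>.lin
        (K.generator A s x y)
    have he : ∀ s, e s ∈ K.sections (K.modEnd B) (A.label s) := fun s =>
      map_mem_sections (F := K.modEnd A) τ (generator_mem s)
    let h : A ⟶ B := ⟨fun s t => coeff (e s) t (x (A.label s)) (y (A.label s)),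
      fun s t hst => coeff_eq_zero hK (he s) hst _ _⟩
    refine ⟨h, modEnd_hom_ext (K := K) (A := A) (F := K.modEnd B) fun s x' y' hs' =>
      obj_ext fun x'' y'' t => ?_⟩
    refine (val_natApp_generator h hs' x'' y'' t).trans
      (Eq.trans ?_ (val_section (he s) x' y' x'' y'' t).symm)
    have h1 : h.mat s t = coeff (e s) t x' y' := by
      by_cases hst : A.label s = B.label t
      · exact coeff_eq_coeff hK (he s) hst (hs (A.label s)) hs'
      · exact (h.supp s t hst).trans (coeff_eq_zero hK (he s) hst x' y').symm
    rw [h1]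

theorem isEquivalence (hK : K.IsComplete) : K.toModEnd.IsEquivalence where
  faithful := faithful hK
  full := full hK
  essSurj := essSurj hK

end KernelData

/-! ### Coordinates on the cosets of the diagonal subgroup -/

/-- The additive character `a ↦ ω ^ a` of `ℤ/3`. -/
noncomputable def zeta (a : ZMod 3) : ℂ := omega ^ a.val

theorem zeta_add (a b : ZMod 3) : zeta (a + b) = zeta a * zeta b := omega_pow_val_add a b

theorem zeta_zero : zeta 0 = 1 := by simp [zeta]

theorem zeta_eq_one {a : ZMod 3} (h : zeta a = 1) : a = 0 := by
  have h3 := (omega_isPrimitiveRoot.pow_eq_one_iff_dvd _).1 h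
  exact (ZMod.val_eq_zero a).1 (Nat.eq_zero_of_dvd_of_lt h3 (ZMod.val_lt a))

theorem zeta_neg_mul (a : ZMod 3) : zeta (-a) * zeta a = 1 := by
  rw [← zeta_add, neg_add_cancel, zeta_zero]

theorem zeta_injective {a b : ZMod 3} (h : zeta a = zeta b) : a = b := by
  refine sub_eq_zero.1 (zeta_eq_one ?_)
  rw [sub_eq_add_neg, zeta_add, h, mul_comm, zeta_neg_mul]

theorem sum_zeta_mul (a : ZMod 3) : ∑ c : ZMod 3, zeta (a * c) = if a = 0 then 3 else 0 := by
  split_ifs with h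
  · simp [h, zeta_zero]
  · have h1 : ∑ c : ZMod 3, zeta (a * c) = zeta a * ∑ c : ZMod 3, zeta (a * c) := by
      rw [Finset.mul_sum, ← Equiv.sum_comp (Equiv.addLeft (1 : ZMod 3))]
      refine Finset.sum_congr rfl fun c _ => ?_
      rw [← zeta_add, Equiv.coe_addLeft, mul_add, mul_one]
    have h2 : (zeta a - 1) * ∑ c : ZMod 3, zeta (a * c) = 0 := by linear_combination -h1
    exact (mul_eq_zero.1 h2).resolve_left (sub_ne_zero.2 fun h' => h (zeta_eq_one h'))

namespace Z3S3

/-- The number `b` for which the inverse of the permutation `π` of `ℤ/3` is `j ↦ b + c * j`. -/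
def base (π : Equiv.Perm (Fin 3)) : ZMod 3 := (π⁻¹ 0 : Fin 3)

/-- The number `c = ± 1` for which the inverse of the permutation `π` of `ℤ/3` is
`j ↦ b + c * j`. -/
def slope (π : Equiv.Perm (Fin 3)) : ZMod 3 := (π⁻¹ 1 - π⁻¹ 0 : Fin 3)

theorem base_mul (ρ π : Equiv.Perm (Fin 3)) : base (ρ * π) = base π + slope π * base ρ := by
  revert ρ π
  decide

theorem slope_mul (ρ π : Equiv.Perm (Fin 3)) : slope (ρ * π) = slope ρ * slope π := by
  revert ρ π
  decide

theorem slope_mul_self (π : Equiv.Perm (Fin 3)) : slope π * slope π = 1 := by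
  revert π
  decide

theorem exists_perm (c b : ZMod 3) (h : c * c = 1) :
    ∃ π : Equiv.Perm (Fin 3), slope π = c ∧ base π = b := by
  revert c b
  decide

theorem eq_one {π : Equiv.Perm (Fin 3)} (h : slope π = 1) (h' : base π = 0) : π = 1 := by
  revert π
  decide

/-- The component in `ℤ/3` of an element of `ℤ/3 × S₃`. -/
def shift (g : Z3S3) : ZMod 3 := Multiplicative.toAdd g.1

theorem shift_mul (g h : Z3S3) : shift (g * h) = shift g + shift h := rfl

/-- The diagonal subgroup consists of the pairs of an element of `ℤ/3` and the rotation by it. -/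
theorem mem_diagonal_iff (h : Z3S3) :
    h ∈ diagonalZ3 ↔ slope h.2 = 1 ∧ base h.2 + shift h = 0 := by
  constructor
  · intro hh
    let K : Subgroup Z3S3 :=
      { carrier := {h | slope h.2 = 1 ∧ base h.2 + shift h = 0}
        one_mem' := by decide
        mul_mem' := fun {g h} hg hh => by
          refine ⟨by rw [Prod.snd_mul, slope_mul, hg.1, hh.1, mul_one], ?_⟩
          rw [Prod.snd_mul, base_mul, hh.1, shift_mul]
          linear_combination hg.2 + hh.2
        inv_mem' := fun {g} hg => by
          have h1 : slope (g⁻¹).2 = 1 := by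
            have := slope_mul (g⁻¹).2 g.2
            rw [hg.1, mul_one, ← Prod.snd_mul, inv_mul_cancel] at this
            rw [← this]
            decide
          have h2 := base_mul g.2 (g⁻¹).2
          have h3 := shift_mul g g⁻¹
          rw [h1, ← Prod.snd_mul, mul_inv_cancel] at h2
          rw [mul_inv_cancel] at h3
          have h4 : base (1 : Z3S3).2 = 0 := by decide
          have h5 : shift (1 : Z3S3) = 0 := rfl
          exact ⟨h1, by linear_combination -h2 - h3 - hg.2 + h4 + h5⟩ }
    have hK : diagonalZ3 ≤ K := Subgroup.zpowers_le.2 (by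
      change slope (finRotate 3) = 1 ∧ base (finRotate 3) + 1 = 0
      decide)
    exact hK hh
  · rintro ⟨h1, h2⟩
    have h3 : ∀ z : ZMod 3, ∀ π : Equiv.Perm (Fin 3), slope π = 1 → base π + z = 0 →
        (Multiplicative.ofAdd (1 : ZMod 3), finRotate 3) ^ z.val =
          (Multiplicative.ofAdd z, π) := by
      decide
    exact ⟨(shift h).val, (zpow_natCast _ _).trans (h3 (shift h) h.2 h1 h2)⟩

/-- The first coordinate of a coset, which is `± 1`. -/
def sgn : Z3S3 ⧸ diagonalZ3 → ZMod 3 :=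
  Quotient.lift (fun g : Z3S3 => slope g.2) fun a b h => by
    have h1 := (mem_diagonal_iff _).1 (QuotientGroup.leftRel_apply.1 h)
    have h2 := slope_mul a.2 (a⁻¹ * b).2
    rw [h1.1, mul_one, ← Prod.snd_mul, mul_inv_cancel_left] at h2
    exact h2.symm

/-- The second coordinate of a coset. -/
def pos : Z3S3 ⧸ diagonalZ3 → ZMod 3 :=
  Quotient.lift (fun g : Z3S3 => -(shift g + base g.2)) fun a b h => by
    have h1 := (mem_diagonal_iff _).1 (QuotientGroup.leftRel_apply.1 h)
    have h2 := base_mul a.2 (a⁻¹ * b).2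
    have h3 := shift_mul a (a⁻¹ * b)
    rw [h1.1, one_mul, ← Prod.snd_mul, mul_inv_cancel_left] at h2
    rw [mul_inv_cancel_left] at h3
    linear_combination h2 + h3 + h1.2

theorem sgn_smul (g : Z3S3) (x : Z3S3 ⧸ diagonalZ3) : sgn (g • x) = slope g.2 * sgn x := by
  induction x using QuotientGroup.induction_on with
  | H h => exact slope_mul g.2 h.2

theorem pos_smul (g : Z3S3) (x : Z3S3 ⧸ diagonalZ3) :
    pos (g • x) = pos x - shift g - sgn x * base g.2 := by
  induction x using QuotientGroup.induction_on with
  | H h =>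
    change -(shift (g * h) + base (g.2 * h.2)) =
      -(shift h + base h.2) - shift g - slope h.2 * base g.2
    rw [shift_mul, base_mul]
    ring

theorem sgn_mul_self (x : Z3S3 ⧸ diagonalZ3) : sgn x * sgn x = 1 := by
  induction x using QuotientGroup.induction_on with
  | H h => exact slope_mul_self h.2

theorem coset_ext {x y : Z3S3 ⧸ diagonalZ3} (h1 : sgn x = sgn y) (h2 : pos x = pos y) : x = y := by
  induction x using QuotientGroup.induction_on with
  | H a =>
  induction y using QuotientGroup.induction_on with
  | H b =>
    have h1 : slope a.2 = slope b.2 := h1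
    have h2 : -(shift a + base a.2) = -(shift b + base b.2) := h2
    have h3 := slope_mul a.2 (a⁻¹ * b).2
    have h4 := base_mul a.2 (a⁻¹ * b).2
    have h5 := shift_mul a (a⁻¹ * b)
    rw [← Prod.snd_mul, mul_inv_cancel_left] at h3 h4
    rw [mul_inv_cancel_left] at h5
    have h6 := slope_mul_self a.2
    have h7 : slope (a⁻¹ * b).2 = 1 := by
      linear_combination -slope a.2 * (h1 + h3) - (slope (a⁻¹ * b).2 - 1) * h6
    rw [h7] at h4
    exact QuotientGroup.eq.2 ((mem_diagonal_iff _).2 ⟨h7, by linear_combination h2 - h4 - h5⟩)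

theorem exists_coset (c m : ZMod 3) (h : c * c = 1) :
    ∃ x : Z3S3 ⧸ diagonalZ3, sgn x = c ∧ pos x = m := by
  obtain ⟨π, h1, h2⟩ := exists_perm c 0 h
  refine ⟨QuotientGroup.mk (Multiplicative.ofAdd (-m), π), h1, ?_⟩
  change -(-m + base π) = m
  rw [h2]
  ring

noncomputable instance : Fintype (Z3S3 ⧸ diagonalZ3) := Fintype.ofFinite _

noncomputable instance : DecidableEq (Z3S3 ⧸ diagonalZ3) := Classical.decEq _

/-- A function of the second coordinate may be summed over the cosets with a given first
coordinate. -/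
theorem sum_coset (c : ZMod 3) (h : c * c = 1) (f : ZMod 3 → ℂ) :
    (∑ x : Z3S3 ⧸ diagonalZ3, if sgn x = c then f (pos x) else 0) = ∑ m, f m := by
  rw [← Finset.sum_filter]
  refine Finset.sum_nbij pos (fun _ _ => Finset.mem_univ _) (fun x hx y hy hxy => ?_)
    (fun m _ => ?_) fun _ _ => rfl
  · exact coset_ext ((Finset.mem_filter.1 hx).2.trans (Finset.mem_filter.1 hy).2.symm) hxy
  · obtain ⟨x, h1, h2⟩ := exists_coset c m h
    exact ⟨x, Finset.mem_coe.2 (Finset.mem_filter.2 ⟨Finset.mem_univ _, h1⟩), h2⟩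

theorem sgn_ne_neg (x : Z3S3 ⧸ diagonalZ3) : sgn x ≠ -sgn x := by
  have h := sgn_mul_self x
  generalize sgn x = c at h
  revert c
  decide

end Z3S3

/-! ### The kernels of the Tambara–Yamagami category on these cosets -/

namespace Z3S3

/-- The orbits of the group on pairs of cosets, indexed by the simple objects: each of the objects
`(n, k)` corresponds to the orbit of the pairs with the same first coordinate whose second
coordinates differ by `n`, and `σ` to the orbit of the pairs with opposite first coordinates. -/
def adm : Option (ZMod 3 × ZMod 3) → Z3S3 ⧸ diagonalZ3 → Z3S3 ⧸ diagonalZ3 → Prop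
  | some a, x, y => sgn y = sgn x ∧ pos y = pos x + a.1
  | none, x, y => sgn y = -sgn x

instance (i : Option (ZMod 3 × ZMod 3)) (x y : Z3S3 ⧸ diagonalZ3) : Decidable (adm i x y) := by
  cases i <;> unfold adm <;> infer_instance

/-- The exponents of the characters: the object `(n, k)` corresponds to the character
`g ↦ ω ^ (-k w)`, where `w` is the component of `g` in `ℤ/3`, and `σ` to the trivial character. -/
def charExp : Option (ZMod 3 × ZMod 3) → Z3S3 → ZMod 3
  | some a, g => -(a.2 * shift g)
  | none, _ => 0

/-- The structure constants of the compositions of kernels are the powers of `ω` with these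
exponents, in terms of the second coordinates of the three cosets. -/
def mulExp : Option (ZMod 3 × ZMod 3) → Option (ZMod 3 × ZMod 3) → Option (ZMod 3 × ZMod 3) →
    Z3S3 ⧸ diagonalZ3 → Z3S3 ⧸ diagonalZ3 → Z3S3 ⧸ diagonalZ3 → ZMod 3
  | some a, some b, _, _, _, _ => a.1 * b.2
  | some a, none, _, x, _, z => a.2 * (pos x + pos z)
  | none, some a, _, x, _, z => a.2 * (pos x + pos z) - a.1 * a.2
  | none, none, some a, x, y, _ => -(a.2 * (pos x + pos y))
  | none, none, none, _, _, _ => 0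

/-- The normalization of the inverses of the structure constants: the sum which expresses that they
are inverse has three terms for `σ ⊗ σ`, and one term otherwise. -/
noncomputable def normalization : Option (ZMod 3 × ZMod 3) → Option (ZMod 3 × ZMod 3) → ℂ
  | none, none => 1 / 3
  | _, _ => 1

theorem tau_eq : TambaraYamagami.tau (ZMod 3 × ZMod 3) 1 = 1 / 3 := by
  have h : Fintype.card (ZMod 3 × ZMod 3) = 9 := rfl
  have h' : Real.sqrt ((9 : ℕ) : ℝ) = 3 := by
    rw [Real.sqrt_eq_iff_mul_self_eq] <;> norm_num
  rw [TambaraYamagami.tau, h, h']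
  norm_num

theorem hyperbolicChar_apply (a b : ZMod 3 × ZMod 3) :
    hyperbolicChar a b = zeta (a.1 * b.2 + a.2 * b.1) := rfl

theorem zeta_inv (a : ZMod 3) : (zeta a)⁻¹ = zeta (-a) :=
  (eq_inv_of_mul_eq_one_left (zeta_neg_mul a)).symm

theorem three_eq : (3 : ZMod 3) = 0 := rfl

theorem adm_smul (g : Z3S3) (i : Option (ZMod 3 × ZMod 3)) (x y : Z3S3 ⧸ diagonalZ3)
    (h : adm i x y) : adm i (g • x) (g • y) := by
  rcases i with _ | a
  · have h : sgn y = -sgn x := h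
    change sgn (g • y) = -sgn (g • x)
    rw [sgn_smul, sgn_smul, h, mul_neg]
  · obtain ⟨h1, h2⟩ : sgn y = sgn x ∧ pos y = pos x + a.1 := h
    refine ⟨by rw [sgn_smul, sgn_smul, h1], ?_⟩
    rw [pos_smul, pos_smul, h1, h2]
    ring

theorem adm_one (x y : Z3S3 ⧸ diagonalZ3) : adm (some 0) x y ↔ x = y := by
  constructor
  · rintro ⟨h1, h2⟩
    exact coset_ext h1.symm (by rw [h2, Prod.fst_zero, add_zero])
  · rintro rfl
    exact ⟨rfl, (add_zero _).symm⟩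

/-- Equivariance of the structure constants. An element with component `w` in `ℤ/3` changes the sum of
the second coordinates of cosets with opposite first coordinates by `-2 w = w`. -/
theorem mulExp_smul (g : Z3S3) (i j k : Option (ZMod 3 × ZMod 3)) (x y z : Z3S3 ⧸ diagonalZ3)
    (hN : TambaraYamagami.N i j k) (h1 : adm i x y) (h2 : adm j y z) :
    charExp k g + mulExp i j k x y z =
      charExp i g + charExp j g + mulExp i j k (g • x) (g • y) (g • z) := by
  have h3 := three_eq
  rcases i with _ | a <;> rcases j with _ | b <;> rcases k with _ | c <;>
    simp only [TambaraYamagami.N] at hN <;>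
    simp only [adm] at h1 h2 <;>
    simp only [charExp, mulExp, pos_smul]
  · rw [h1]
    linear_combination (-c.2 * shift g) * h3
  · rw [h2.1, h1]
    linear_combination (b.2 * shift g) * h3
  · rw [h2, h1.1]
    linear_combination (a.2 * shift g) * h3
  · rw [hN, Prod.snd_add]
    ring

/-- The structure constants are invertible. For `σ ⊗ σ` this is the orthogonality of the characters
of `ℤ/3`. -/
theorem sum_inv_mul (i j : Option (ZMod 3 × ZMod 3)) (x y y' z : Z3S3 ⧸ diagonalZ3)
    (h1 : adm i x y) (h2 : adm j y z) (h1' : adm i x y') (h2' : adm j y' z) :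
    (∑ k, if TambaraYamagami.N i j k ∧ adm k x z then
      normalization i j * zeta (-mulExp i j k x y z) * zeta (mulExp i j k x y' z) else 0) =
      if y = y' then 1 else 0 := by
  rcases i with _ | a <;> rcases j with _ | b
  · have h1 : sgn y = -sgn x := h1
    have h2 : sgn z = -sgn y := h2
    have h1' : sgn y' = -sgn x := h1'
    rw [Fintype.sum_option, Fintype.sum_prod_type, if_neg fun h => h.1, zero_add,
      Fintype.sum_eq_single (pos z - pos x)]
    · have h : ∀ c : ZMod 3, (if TambaraYamagami.N none none (some (pos z - pos x, c)) ∧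
          adm (some (pos z - pos x, c)) x z then normalization none none *
            zeta (-mulExp none none (some (pos z - pos x, c)) x y z) *
            zeta (mulExp none none (some (pos z - pos x, c)) x y' z) else 0) =
          1 / 3 * zeta ((pos y - pos y') * c) := fun c => by
        rw [if_pos ⟨trivial, by rw [h2, h1, neg_neg], (add_sub_cancel _ _).symm⟩, mul_assoc,
          ← zeta_add]
        refine congrArg (fun t => 1 / 3 * zeta t) ?_
        simp only [mulExp]
        ring
      rw [Finset.sum_congr rfl fun c _ => h c, ← Finset.mul_sum, sum_zeta_mul]
      by_cases hy : y = y'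
      · rw [if_pos hy, hy, if_pos (sub_self _)]
        norm_num
      · rw [if_neg hy, if_neg fun h => hy (coset_ext (h1.trans h1'.symm) (sub_eq_zero.1 h)),
          mul_zero]
    · intro c hc
      refine Finset.sum_eq_zero fun d _ => if_neg fun h => hc ?_
      rw [h.2.2]
      exact (add_sub_cancel_left _ _).symm
  · obtain ⟨h3, h4⟩ : sgn z = sgn y ∧ pos z = pos y + b.1 := h2
    obtain ⟨h3', h4'⟩ : sgn z = sgn y' ∧ pos z = pos y' + b.1 := h2'
    have h1 : sgn y = -sgn x := h1
    obtain rfl : y = y' := coset_ext (h3.symm.trans h3') (add_right_cancel (h4.symm.trans h4'))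
    rw [if_pos rfl, Fintype.sum_option, if_pos ⟨trivial, h3.trans h1⟩,
      Finset.sum_eq_zero fun c _ => if_neg fun h => h.1, mul_assoc, zeta_neg_mul]
    simp [normalization]
  · obtain ⟨h3, h4⟩ : sgn y = sgn x ∧ pos y = pos x + a.1 := h1
    obtain ⟨h3', h4'⟩ : sgn y' = sgn x ∧ pos y' = pos x + a.1 := h1'
    have h2 : sgn z = -sgn y := h2
    obtain rfl : y = y' := coset_ext (h3.trans h3'.symm) (h4.trans h4'.symm)
    rw [if_pos rfl, Fintype.sum_option, if_pos ⟨trivial, h2.trans (by rw [h3])⟩,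
      Finset.sum_eq_zero fun c _ => if_neg fun h => h.1, mul_assoc, zeta_neg_mul]
    simp [normalization]
  · obtain ⟨h3, h4⟩ : sgn y = sgn x ∧ pos y = pos x + a.1 := h1
    obtain ⟨h3', h4'⟩ : sgn y' = sgn x ∧ pos y' = pos x + a.1 := h1'
    obtain ⟨h5, h6⟩ : sgn z = sgn y ∧ pos z = pos y + b.1 := h2
    obtain rfl : y = y' := coset_ext (h3.trans h3'.symm) (h4.trans h4'.symm)
    have h7 : adm (some (a + b)) x z :=
      ⟨h5.trans h3, by rw [h6, h4, Prod.fst_add, add_assoc]⟩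
    rw [if_pos rfl, Fintype.sum_eq_single (some (a + b)), if_pos ⟨rfl, h7⟩, mul_assoc,
      zeta_neg_mul]
    · simp [normalization]
    · rintro (_ | c) hc
      · exact if_neg fun h => h.1
      · exact if_neg fun h => hc (congrArg some h.1)

/-- The inverses of the structure constants are inverse on the other side as well. -/
theorem sum_mul_inv (i j k k' : Option (ZMod 3 × ZMod 3)) (x z : Z3S3 ⧸ diagonalZ3)
    (hN : TambaraYamagami.N i j k) (h : adm k x z) (hN' : TambaraYamagami.N i j k')
    (h' : adm k' x z) :
    (∑ y, if adm i x y ∧ adm j y z then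
      zeta (mulExp i j k x y z) * (normalization i j * zeta (-mulExp i j k' x y z)) else 0) =
      if k = k' then 1 else 0 := by
  rcases i with _ | a <;> rcases j with _ | b <;> rcases k with _ | c <;>
    rcases k' with _ | c' <;> simp only [TambaraYamagami.N] at hN hN'
  · obtain ⟨h1, h2⟩ : sgn z = sgn x ∧ pos z = pos x + c.1 := h
    obtain ⟨h1', h2'⟩ : sgn z = sgn x ∧ pos z = pos x + c'.1 := h'
    have hc : c.1 = c'.1 := add_left_cancel (h2.symm.trans h2')
    have key : ∀ y, (if adm none x y ∧ adm none y z then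
        zeta (mulExp none none (some c) x y z) *
          (normalization none none * zeta (-mulExp none none (some c') x y z)) else 0) =
        if sgn y = -sgn x then 1 / 3 * zeta ((c'.2 - c.2) * (pos x + pos y)) else 0 := fun y => by
      refine ite_congr (propext ⟨fun h => h.1, fun h => ⟨h, ?_⟩⟩) (fun _ => ?_) fun _ => rfl
      · change sgn z = -sgn y
        rw [h, neg_neg, h1]
      · rw [mul_left_comm, ← zeta_add]
        refine congrArg (fun t => 1 / 3 * zeta t) ?_
        simp only [mulExp]
        ring
    have hs : ∑ m, zeta ((c'.2 - c.2) * (pos x + m)) = ∑ m, zeta ((c'.2 - c.2) * m) :=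
      Equiv.sum_comp (Equiv.addLeft (pos x)) fun m => zeta ((c'.2 - c.2) * m)
    rw [Finset.sum_congr rfl fun y _ => key y,
      sum_coset (-sgn x) (by rw [neg_mul_neg, sgn_mul_self])
        (fun m => 1 / 3 * zeta ((c'.2 - c.2) * (pos x + m))), ← Finset.mul_sum, hs,
      sum_zeta_mul]
    by_cases hcc : c = c'
    · rw [if_pos (congrArg some hcc), hcc, if_pos (sub_self _)]
      norm_num
    · rw [if_neg fun h => hcc (Option.some_injective _ h),
        if_neg fun h => hcc (Prod.ext hc (sub_eq_zero.1 h).symm), mul_zero]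
  · have h : sgn z = -sgn x := h
    obtain ⟨y, h1, h2⟩ := exists_coset (sgn z) (pos z - b.1) (sgn_mul_self z)
    rw [if_pos rfl, Fintype.sum_eq_single y, if_pos ⟨h1.trans h, h1.symm, by rw [h2]; ring⟩,
      mul_left_comm, mul_comm (zeta _), zeta_neg_mul]
    · simp [normalization]
    · refine fun y' hy => if_neg fun h' => hy (coset_ext (h'.2.1.symm.trans h1.symm) ?_)
      rw [h2, h'.2.2]
      ring
  · have h : sgn z = -sgn x := h
    obtain ⟨y, h1, h2⟩ := exists_coset (sgn x) (pos x + a.1) (sgn_mul_self x)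
    rw [if_pos rfl, Fintype.sum_eq_single y, if_pos ⟨⟨h1, h2⟩, h.trans (by rw [h1])⟩,
      mul_left_comm, mul_comm (zeta _), zeta_neg_mul]
    · simp [normalization]
    · exact fun y' hy => if_neg fun h' => hy (coset_ext (h'.1.1.trans h1.symm)
        (h'.1.2.trans h2.symm))
  · obtain ⟨h3, h4⟩ : sgn z = sgn x ∧ pos z = pos x + c.1 := h
    obtain ⟨y, h1, h2⟩ := exists_coset (sgn x) (pos x + a.1) (sgn_mul_self x)
    have h5 : adm (some b) y z :=
      ⟨h3.trans h1.symm, by rw [h4, h2, hN, Prod.fst_add, add_assoc]⟩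
    rw [if_pos (congrArg some (hN.trans hN'.symm)), Fintype.sum_eq_single y,
      if_pos ⟨⟨h1, h2⟩, h5⟩, mul_left_comm, mul_comm (zeta _), hN, hN', zeta_neg_mul]
    · simp [normalization]
    · exact fun y' hy => if_neg fun h' => hy (coset_ext (h'.1.1.trans h1.symm)
        (h'.1.2.trans h2.symm))

/-- Compatibility of the structure constants with the F-symbols. -/
theorem sum_mul_assoc (i j k f d : Option (ZMod 3 × ZMod 3)) (x y z w : Z3S3 ⧸ diagonalZ3)
    (h1 : adm i x y) (h2 : adm j y z) (hw : adm k z w) (hN : TambaraYamagami.N j k f)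
    (hN' : TambaraYamagami.N i f d) (h4 : adm d x w) :
    (∑ e, if TambaraYamagami.N i j e ∧ TambaraYamagami.N e k d ∧ adm e x z then
      TambaraYamagami.F hyperbolicChar 1 i j k d e f * zeta (mulExp i j e x y z) *
        zeta (mulExp e k d x z w) else 0) =
      if adm f y w then zeta (mulExp j k f y z w) * zeta (mulExp i f d x y w) else 0 := by
  rcases i with _ | a <;> rcases j with _ | b <;> rcases k with _ | c <;>
    rcases f with _ | f <;> simp only [TambaraYamagami.N] at hN <;>
    rcases d with _ | d <;> simp only [TambaraYamagami.N] at hN'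
  -- the case `σ, σ, σ`, where the sum is a Fourier transform on `ℤ/3`
  · have h1 : sgn y = -sgn x := h1
    have h2 : sgn z = -sgn y := h2
    have hw : sgn w = -sgn z := hw
    have hs : sgn z = sgn x := by rw [h2, h1, neg_neg]
    rw [Fintype.sum_option, Fintype.sum_prod_type, if_neg fun h => h.1, zero_add,
      Fintype.sum_eq_single (pos z - pos x)]
    · have key : ∀ c : ZMod 3, (if TambaraYamagami.N none none (some (pos z - pos x, c)) ∧
          TambaraYamagami.N (some (pos z - pos x, c)) none none ∧
            adm (some (pos z - pos x, c)) x z then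
          TambaraYamagami.F hyperbolicChar 1 none none none none (some (pos z - pos x, c))
            (some f) * zeta (mulExp none none (some (pos z - pos x, c)) x y z) *
            zeta (mulExp (some (pos z - pos x, c)) none none x z w) else 0) =
          1 / 3 * zeta (-(pos z - pos x) * f.2) * zeta ((pos w - (pos y + f.1)) * c) := fun c => by
        rw [if_pos ⟨trivial, trivial, hs, (add_sub_cancel _ _).symm⟩]
        simp only [mulExp, TambaraYamagami.F, hyperbolicChar_apply, tau_eq, zeta_inv]
        rw [mul_assoc, mul_assoc, mul_assoc, ← zeta_add, ← zeta_add, ← zeta_add]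
        refine congrArg (fun t => 1 / 3 * zeta t) ?_
        ring
      rw [Finset.sum_congr rfl fun c _ => key c, ← Finset.mul_sum, sum_zeta_mul]
      by_cases hf : pos w = pos y + f.1
      · have h5 : adm (some f) y w := ⟨by rw [hw, h2, neg_neg], hf⟩
        rw [if_pos h5, if_pos (sub_eq_zero.2 hf)]
        simp only [mulExp]
        rw [← zeta_add, mul_right_comm, one_div, inv_mul_cancel₀ three_ne_zero, one_mul]
        refine congrArg zeta ?_
        rw [hf]
        ring
      · have h5 : ¬ adm (some f) y w := fun h => hf h.2
        rw [if_neg h5, if_neg fun h => hf (sub_eq_zero.1 h), mul_zero]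
    · intro c hc
      refine Finset.sum_eq_zero fun d _ => if_neg fun h => hc ?_
      rw [h.2.2.2]
      exact (add_sub_cancel_left _ _).symm
  -- the remaining cases, where the sum has only one term
  · have h1 : sgn y = -sgn x := h1
    have h2 : sgn z = -sgn y := h2
    obtain ⟨hw, hw'⟩ : sgn w = sgn z ∧ pos w = pos z + c.1 := hw
    obtain ⟨h4, h4'⟩ : sgn w = sgn x ∧ pos w = pos x + d.1 := h4
    have h5 : adm (some (d - c)) x z := ⟨by rw [h2, h1, neg_neg],
      by rw [Prod.fst_sub]; linear_combination h4' - hw'⟩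
    have h6 : adm none y w := hw.trans h2
    rw [Fintype.sum_eq_single (some (d - c)), if_pos ⟨trivial, (sub_add_cancel _ _).symm, h5⟩,
      if_pos h6]
    · simp only [mulExp, TambaraYamagami.F, one_mul, ← zeta_add]
      refine congrArg zeta ?_
      simp only [Prod.fst_sub, Prod.snd_sub]
      linear_combination -c.2 * h4'
    · rintro (_ | e) he
      · exact if_neg fun h => h.1
      · exact if_neg fun h => he (congrArg some (eq_sub_of_add_eq h.2.1.symm))
  · have h1 : sgn y = -sgn x := h1
    obtain ⟨h2, h2'⟩ : sgn z = sgn y ∧ pos z = pos y + b.1 := h2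
    have hw : sgn w = -sgn z := hw
    obtain ⟨h4, h4'⟩ : sgn w = sgn x ∧ pos w = pos x + d.1 := h4
    have h5 : adm none x z := h2.trans h1
    have h6 : adm none y w := hw.trans (congrArg Neg.neg h2)
    rw [Fintype.sum_eq_single none, if_pos ⟨trivial, trivial, h5⟩, if_pos h6]
    · simp only [mulExp, TambaraYamagami.F, hyperbolicChar_apply, ← zeta_add]
      refine congrArg zeta ?_
      linear_combination (b.2 - d.2) * h2' - b.2 * h4'
    · rintro (_ | e) he
      · exact absurd rfl he
      · exact if_neg fun h => h.1
  · have h1 : sgn y = -sgn x := h1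
    obtain ⟨h2, h2'⟩ : sgn z = sgn y ∧ pos z = pos y + b.1 := h2
    obtain ⟨hw, hw'⟩ : sgn w = sgn z ∧ pos w = pos z + c.1 := hw
    have h4 : sgn w = -sgn x := h4
    have h5 : adm none x z := h2.trans h1
    have h6 : adm (some f) y w := ⟨hw.trans h2, by rw [hw', h2', hN, Prod.fst_add, add_assoc]⟩
    rw [Fintype.sum_eq_single none, if_pos ⟨trivial, trivial, h5⟩, if_pos h6]
    · simp only [mulExp, TambaraYamagami.F, one_mul, ← zeta_add]
      refine congrArg zeta ?_
      simp only [hN, Prod.fst_add, Prod.snd_add]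
      linear_combination -b.2 * hw'
    · rintro (_ | e) he
      · exact absurd rfl he
      · exact if_neg fun h => h.1
  · obtain ⟨h1, h1'⟩ : sgn y = sgn x ∧ pos y = pos x + a.1 := h1
    have h2 : sgn z = -sgn y := h2
    have hw : sgn w = -sgn z := hw
    obtain ⟨h4, h4'⟩ : sgn w = sgn x ∧ pos w = pos x + d.1 := h4
    have h5 : adm none x z := h2.trans (congrArg Neg.neg h1)
    have h6 : adm (some f) y w := ⟨by rw [hw, h2, neg_neg],
      by rw [h4', h1', hN', Prod.fst_add, add_assoc]⟩
    rw [Fintype.sum_eq_single none, if_pos ⟨trivial, trivial, h5⟩, if_pos h6]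
    · simp only [mulExp, TambaraYamagami.F, one_mul, ← zeta_add]
      refine congrArg zeta ?_
      simp only [hN', Prod.snd_add]
      linear_combination f.2 * h1'
    · rintro (_ | e) he
      · exact absurd rfl he
      · exact if_neg fun h => h.1
  · obtain ⟨h1, h1'⟩ : sgn y = sgn x ∧ pos y = pos x + a.1 := h1
    have h2 : sgn z = -sgn y := h2
    obtain ⟨hw, hw'⟩ : sgn w = sgn z ∧ pos w = pos z + c.1 := hw
    have h4 : sgn w = -sgn x := h4
    have h5 : adm none x z := h2.trans (congrArg Neg.neg h1)
    have h6 : adm none y w := hw.trans h2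
    rw [Fintype.sum_eq_single none, if_pos ⟨trivial, trivial, h5⟩, if_pos h6]
    · simp only [mulExp, TambaraYamagami.F, hyperbolicChar_apply, ← zeta_add]
      refine congrArg zeta ?_
      linear_combination -a.2 * hw' - c.2 * h1'
    · rintro (_ | e) he
      · exact absurd rfl he
      · exact if_neg fun h => h.1
  · obtain ⟨h1, h1'⟩ : sgn y = sgn x ∧ pos y = pos x + a.1 := h1
    obtain ⟨h2, h2'⟩ : sgn z = sgn y ∧ pos z = pos y + b.1 := h2
    have hw : sgn w = -sgn z := hw
    have h4 : sgn w = -sgn x := h4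
    have h5 : adm (some (a + b)) x z := ⟨h2.trans h1, by rw [h2', h1', Prod.fst_add, add_assoc]⟩
    have h6 : adm none y w := hw.trans (congrArg Neg.neg h2)
    rw [Fintype.sum_eq_single (some (a + b)), if_pos ⟨rfl, trivial, h5⟩, if_pos h6]
    · simp only [mulExp, TambaraYamagami.F, one_mul, ← zeta_add]
      refine congrArg zeta ?_
      simp only [Prod.snd_add]
      linear_combination -b.2 * h1'
    · rintro (_ | e) he
      · exact if_neg fun h => h.1
      · exact if_neg fun h => he (congrArg some h.1)
  · obtain ⟨h1, h1'⟩ : sgn y = sgn x ∧ pos y = pos x + a.1 := h1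
    obtain ⟨h2, h2'⟩ : sgn z = sgn y ∧ pos z = pos y + b.1 := h2
    obtain ⟨hw, hw'⟩ : sgn w = sgn z ∧ pos w = pos z + c.1 := hw
    obtain ⟨h4, h4'⟩ : sgn w = sgn x ∧ pos w = pos x + d.1 := h4
    have h5 : adm (some (a + b)) x z := ⟨h2.trans h1, by rw [h2', h1', Prod.fst_add, add_assoc]⟩
    have h6 : adm (some f) y w := ⟨hw.trans h2, by rw [hw', h2', hN, Prod.fst_add, add_assoc]⟩
    rw [Fintype.sum_eq_single (some (a + b)),
      if_pos ⟨rfl, by rw [hN', hN]; exact (add_assoc _ _ _).symm, h5⟩, if_pos h6]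
    · simp only [mulExp, TambaraYamagami.F, one_mul, ← zeta_add]
      refine congrArg zeta ?_
      simp only [hN, Prod.fst_add, Prod.snd_add]
      ring
    · rintro (_ | e) he
      · exact if_neg fun h => h.1
      · exact if_neg fun h => he (congrArg some h.1)

/-- The kernels which realize the Tambara–Yamagami category on the vector spaces graded by the
cosets of the diagonal subgroup. -/
noncomputable def kernelData :
    KernelData (tyData hyperbolicChar 1) Z3S3 (Z3S3 ⧸ diagonalZ3) where
  adm := adm
  char i :=
    { toFun := fun g => zeta (charExp i g)
      map_one' := by
        rcases i with _ | a
        · exact zeta_zero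
        · change zeta (-(a.2 * 0)) = 1
          rw [mul_zero, neg_zero, zeta_zero]
      map_mul' := fun g h => by
        rw [← zeta_add]
        refine congrArg zeta ?_
        rcases i with _ | a
        · exact (add_zero _).symm
        · change -(a.2 * shift (g * h)) = -(a.2 * shift g) + -(a.2 * shift h)
          rw [shift_mul]
          ring }
  T i j k x y z := zeta (mulExp i j k x y z)
  T' i j k x y z := normalization i j * zeta (-mulExp i j k x y z)
  adm_smul := adm_smul
  adm_one := adm_one
  char_one := MonoidHom.ext fun g => by
    change zeta (-(0 * shift g)) = 1
    rw [zero_mul, neg_zero, zeta_zero]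
  T_smul g i j k x y z hN h1 h2 _ := by
    change zeta (charExp k g) * _ = zeta (charExp i g) * zeta (charExp j g) * _
    rw [← zeta_add, ← zeta_add, ← zeta_add]
    exact congrArg zeta (mulExp_smul g i j k x y z hN h1 h2)
  T'_T := sum_inv_mul
  T_T' := sum_mul_inv
  T_one_left j x z _ := by
    rcases j with _ | b
    · change zeta (0 * (pos x + pos z)) = 1
      rw [zero_mul, zeta_zero]
    · change zeta (0 * b.2) = 1
      rw [zero_mul, zeta_zero]
  T_one_right i x z _ := by
    rcases i with _ | a
    · change zeta (0 * (pos x + pos z) - 0 * 0) = 1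
      rw [zero_mul, zero_mul, sub_zero, zeta_zero]
    · change zeta (a.1 * 0) = 1
      rw [mul_zero, zeta_zero]
  T_assoc := sum_mul_assoc

theorem exists_smul_eq (x x' : Z3S3 ⧸ diagonalZ3) : ∃ g : Z3S3, g • x = x' :=
  MulAction.exists_smul_eq Z3S3 x x'

theorem adm_transitive (i : Option (ZMod 3 × ZMod 3)) (x y x' y' : Z3S3 ⧸ diagonalZ3)
    (h : adm i x y) (h' : adm i x' y') : ∃ g : Z3S3, g • x = x' ∧ g • y = y' := by
  obtain ⟨g, hg⟩ := exists_smul_eq x x'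
  have h1 := adm_smul g i x y h
  rw [hg] at h1
  rcases i with _ | a
  · -- the stabilizer of `x'` contains a rotation which moves the second coordinate of `y'`
    have h2 : sgn (g • y) = -sgn x' := h1
    have h3 : sgn y' = -sgn x' := h'
    obtain ⟨π, hs, hb⟩ := exists_perm 1 (-(sgn x' * (pos y' - pos (g • y)))) (one_mul 1)
    have h4 := sgn_mul_self x'
    have h5 := three_eq
    have hsh : shift (Multiplicative.ofAdd (pos y' - pos (g • y)), π) = pos y' - pos (g • y) := rfl
    refine ⟨(Multiplicative.ofAdd (pos y' - pos (g • y)), π) * g, ?_, ?_⟩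
    · rw [mul_smul, hg]
      refine coset_ext ?_ ?_
      · rw [sgn_smul, hs, one_mul]
      · rw [pos_smul, hsh, hb]
        linear_combination (pos y' - pos (g • y)) * h4
    · rw [mul_smul]
      refine coset_ext ?_ ?_
      · rw [sgn_smul, hs, one_mul, h2, h3]
      · rw [pos_smul, hsh, hb, h2]
        linear_combination -(pos y' - pos (g • y)) * h4 - (pos y' - pos (g • y)) * h5
  · exact ⟨g, hg, coset_ext (h1.1.trans h'.1.symm) (h1.2.trans h'.2.symm)⟩

/-- The stabilizer of a coset contains an element with any given component in `ℤ/3`, which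
stabilizes all cosets with the same first coordinate. -/
theorem exists_smul_eq_self (x : Z3S3 ⧸ diagonalZ3) (w : ZMod 3) :
    ∃ g : Z3S3, shift g = w ∧ ∀ y, sgn y = sgn x → g • y = y := by
  obtain ⟨π, hs, hb⟩ := exists_perm 1 (-(sgn x * w)) (one_mul 1)
  have hsh : shift (Multiplicative.ofAdd w, π) = w := rfl
  refine ⟨(Multiplicative.ofAdd w, π), hsh, fun y hy => coset_ext ?_ ?_⟩
  · rw [sgn_smul, hs, one_mul]
  · rw [pos_smul, hsh, hb, hy]
    linear_combination w * sgn_mul_self x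

theorem shift_ne_zero {g : Z3S3} (hg : g ≠ 1) {x : Z3S3 ⧸ diagonalZ3} (hx : g • x = x) :
    shift g ≠ 0 := by
  have h1 := sgn_smul g x
  have h2 := pos_smul g x
  have h3 := sgn_mul_self x
  rw [hx] at h1 h2
  have hs : slope g.2 = 1 := by linear_combination -(sgn x * h1) + (1 - slope g.2) * h3
  intro h
  have hb : base g.2 = 0 := by linear_combination sgn x * h2 - sgn x * h - base g.2 * h3
  exact hg (Prod.ext h (eq_one hs hb))

theorem kernelData_isComplete : kernelData.IsComplete where
  exists_adm i := by
    obtain ⟨x, hx⟩ : ∃ x : Z3S3 ⧸ diagonalZ3, True := ⟨QuotientGroup.mk 1, trivial⟩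
    rcases i with _ | a
    · obtain ⟨y, h1, -⟩ := exists_coset (-sgn x) 0 (by rw [neg_mul_neg, sgn_mul_self])
      exact ⟨x, y, h1⟩
    · obtain ⟨y, h1, h2⟩ := exists_coset (sgn x) (pos x + a.1) (sgn_mul_self x)
      exact ⟨x, y, h1, h2⟩
  transitive := adm_transitive
  separated i j x y hi hj hij := by
    rcases i with _ | a <;> rcases j with _ | b
    · exact absurd rfl hij
    · exact absurd (hj.1.symm.trans hi) (sgn_ne_neg x)
    · exact absurd (hi.1.symm.trans hj) (sgn_ne_neg x)
    · obtain ⟨g, hg, h⟩ := exists_smul_eq_self x 1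
      refine ⟨g, h x rfl, h y hi.1, fun h' => hij ?_⟩
      have h1 : -(a.2 * shift g) = -(b.2 * shift g) := zeta_injective h'
      rw [hg, mul_one, mul_one, neg_inj] at h1
      exact congrArg some (Prod.ext (add_left_cancel (hi.2.symm.trans hj.2)) h1)
  exists_adm' x y := by
    have h : ∀ c c' : ZMod 3, c * c = 1 → c' * c' = 1 → c' = c ∨ c' = -c := by decide
    rcases h (sgn x) (sgn y) (sgn_mul_self x) (sgn_mul_self y) with h1 | h1
    · exact ⟨some (pos y - pos x, 0), h1, (add_sub_cancel _ _).symm⟩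
    · exact ⟨none, h1⟩
  sum_char x y g hx hy hg := by
    have hne := shift_ne_zero hg hx
    change (∑ i, if adm i x y then zeta (charExp i g) else 0) = 0
    by_cases hxy : sgn y = sgn x
    · have h1 : ¬ adm none x y := fun h => sgn_ne_neg x (hxy.symm.trans h)
      rw [Fintype.sum_option, Fintype.sum_prod_type, if_neg h1, zero_add,
        Fintype.sum_eq_single (pos y - pos x)]
      · have h2 : ∀ c : ZMod 3, (if adm (some (pos y - pos x, c)) x y then
            zeta (charExp (some (pos y - pos x, c)) g) else 0) = zeta (-shift g * c) := fun c => by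
          rw [if_pos ⟨hxy, (add_sub_cancel _ _).symm⟩]
          refine congrArg zeta ?_
          simp only [charExp]
          ring
        rw [Finset.sum_congr rfl fun c _ => h2 c, sum_zeta_mul, if_neg (neg_ne_zero.2 hne)]
      · intro c hc
        refine Finset.sum_eq_zero fun d _ => if_neg fun h => hc ?_
        rw [h.2]
        exact (add_sub_cancel_left _ _).symm
    · -- an element which stabilizes cosets with opposite first coordinates is trivial
      have h : ∀ c c' : ZMod 3, c * c = 1 → c' * c' = 1 → c' ≠ c → c' = -c := by decide
      have h1 := h (sgn x) (sgn y) (sgn_mul_self x) (sgn_mul_self y) hxy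
      have h2 := pos_smul g x
      have h3 := pos_smul g y
      rw [hx] at h2
      rw [hy, h1] at h3
      exact absurd (by linear_combination -h2 - h3 + shift g * three_eq) hne

end Z3S3

/-! ### The dual category of `Q₈` -/

/-- The category `Q₈` is an indecomposable module category over `Vec(ℤ/3 × S₃)` whose dual category
is the Tambara–Yamagami category `TY(ℤ/3 × ℤ/3, χ, 1)` with `χ((g₀, h₀), (g₁, h₁)) = ω ^ (g₀ h₁ + h₀ g₁)`.
In particular, the fusion categories `Vec(ℤ/3 × S₃)` and `TY(ℤ/3 × ℤ/3, χ, 1)` are Morita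
equivalent. -/
theorem mainTheorem2 :
    MoritaEquivalent (GrVect Z3S3) (TY hyperbolicChar 1) ∧
      IsMoritaContext (GrVect Z3S3) (TY hyperbolicChar 1) Q8 := by
  have h : IsMoritaContext (GrVect Z3S3) (TY hyperbolicChar 1) Q8 :=
    ⟨GrVect.isSimpleBasis_single.isFiniteSemisimple, GrVect.isIndecomposableModule,
      Z3S3.kernelData.toModEnd, Z3S3.kernelData.monoidal,
      Z3S3.kernelData.isEquivalence Z3S3.kernelData_isComplete, inferInstance, inferInstance⟩
  exact ⟨⟨GrVect.isFusionCategory, TY.isFusionCategory _ _, Q8, inferInstance, inferInstance,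
    inferInstance, inferInstance, inferInstance, h⟩, h⟩
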